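/- **Setting.** Let $p$ be a prime, $\mathbb G$ a group of order $p$ with generators $g,g_1,g_2,h$, and $\lambda\ge 0$. Let $f_k(x)=g^{1/(1+k+x)}$ ($k,x\in\mathbb Z_p$; value $1$ if $1+k+x=0$) be the Dodis–Yampolinsky function and $\mathrm{comm}(m_1,m_2;r)=g_1^{m_1}g_2^{m_2}h^r$, $\mathrm{comm}(m;r)=g_1^mh^r$ the Pedersen commitment (a randomness that is not written is uniform). Let $\mathsf{sgn}$ be a signature scheme, $\mathsf{bsgn}$ a blind signature scheme, $\mathsf{zsgn}$ a scheme for signing committed messages (all correct), $H$ a hash function, used on triples of group elements, on $\mathbb G$ with values in $\mathbb Z_p$, and on $\mathbb G\times\{0,1\}^\lambda$ with values in $\mathbb Z_p$. Let $\Pi$ be a complete non-interactive proof system in the random oracle model with a simulator, for these statements: (i) "I know an opening of $P$ and a $\mathsf{zsgn}$-signature on it under $pk$"; (ii) "I know openings $\alpha_1,\alpha_2,\gamma$ of $\kappa_1,\kappa_2,Q$ with $X=f_{\alpha_1}(id)$ and $Y=g^\gamma f_{\alpha_2}(0)^{r_c}$"; (iii) "I know an opening $(\alpha,\gamma)$ of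 $P$ with $Z=g^\alpha f_\gamma(id)^{r_t}$". **Scheme.** The bank has key pairs for $\mathsf{sgn}$ and $\mathsf{bsgn}$ and two key pairs $pk_z,pk_z'$ for $\mathsf{zsgn}$. A user has uniform $sk,u\in\mathbb Z_p$, the public key $g^{sk}$, a signature under $pk_z$ on $(sk,u)$ and signing keys. An ATM has a uniform $sk_j$, a signature on it under $pk_z'$ and signing keys. A coin is $C=(\kappa_1,\kappa_2,Q,\sigma_c)$ with $\kappa_i=\mathrm{comm}(k_i)$ for uniform $k_i$, $Q=\mathrm{comm}(sk_j)$ and $\sigma_c$ the bank's blind signature on $H(\kappa_1,\kappa_2,Q)$. To withdraw, the user sends $P=\mathrm{comm}(sk,u)$ with a proof $\pi_{sk}$ of (i) for $pk_z$; the ATM verifies it, sets $r_c=H(P)$, $id=r_c+1$, $X=f_{k_1}(id)$, $Y=g^{sk_j}f_{k_2}(0)^{r_c}$ and issues $C$ and the voucher $V=(P,\pi_{sk},X,Y,\pi_{id},\pi_{ATM},r_c)$, where $\pi_{id}$ proves (ii) and $\pi_{ATM}$ proves (i) for $(pk_z',Q)$. $V$ is *linked* to $C$ if $r_c=H(P)$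 and $\sigma_c$ and the three proofs verify. To spend at a merchant with public key $y$ who has sent $r_v$, the user sends $T=(Z,\pi_T,r_v,r_t)$ with $r_t=H(y,r_v)$, $Z=g^{sk}f_u(id)^{r_t}$ and a proof $\pi_T$ of (iii). **Experiment $\mathrm{anon}$-$b$.** The bank, $\gamma$ ATMs and $\eta$ users, the first $\eta_H$ of them honest, are initialized. The adversary $A_1$ gets all keys of the bank and of the ATMs, all public keys and signing keys of the users, and all secrets of the dishonest users. (So it can run every interface of the bank and of the ATMs itself.) It has access to the random oracle and to the honest users: it can make an honest user start a withdrawal, which returns $(g^{sk},P,\pi_{sk})$, and later make that user spend a coin $C$ with voucher $V$ at a merchant, both of its choice; the user accepts only if $V$ is linked to $C$ and is on the user's own $P$, and spends at most one coin per withdrawal. $A_1$ outputs two distinct honest users $i_0,i_1$, an ATM $j$, a merchant $m$ and a state (on invalid choices the result is $0$). User $i_b$ withdraws from ATM $j$, which follows the protocol with a fresh coin; if this fails, or $V$ is not linked to $C$, the result is $0$. User $i_b$ spends the coin at $m$, with uniform $r_v$. $A_2$, with the same oracles, gets $C,V,T$, the bank's keys and the state, and its output bit is the result. **Adversaries.**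 They are oracle circuits. Every randomized operation has a running time in $\mathbb N\cup\{\infty\}$, given by an arbitrary cost model; the running time of a circuit is the total time of all its operations plus the number of its branchings, and its number of queries is its number of oracle gates. $\mathrm{Adv}(t,q)$ is the supremum over adversaries with time at most $t$ and at most $q$ queries of: for $\mathrm{Adv}^{\mathrm{prf}}_f$, the distinguishing advantage between $f_k$ with uniform $k$ and a random function $\mathbb Z_p\to\mathbb G$; for $\mathrm{Adv}^{\mathrm{hide}}_{\mathrm{comm}}$, that between the two bits $b$ of an oracle that on $(m_0,m_1)$ returns $\mathrm{comm}(m_b)$; for $\mathrm{Adv}^{\mathrm{zk}}_\Pi$, that between real proofs with the random oracle and simulated proofs with the simulated oracle, where the distinguisher may adaptively ask for proofs of statements for which it supplies a witness. **Theorem.** There is an absolute constant $a$ such that the following holds. Let $\tau$ bound the time of each of the basic operations of the scheme (arithmetic in $\mathbb Z_p$ and $\mathbb G$, equality tests, sampling, hashing, initialization, coin requests, blind signature verification, table access, the simulator of $\Pi$) and of the prover and the verifier of $\Pi$, and let $\rho$ bound the number of random oracle queries of the latter two. Let $(A_1,A_2)$ run in total time at most $t$ and make at most $q$ oracle queries,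 $w$ of which start withdrawals. With $t'=t+a(q+1)(\rho+1)(\tau+1)$ and $q'=a(q+1)(\rho+1)$, $$\bigl|\Pr[\mathrm{anon}\text{-}0=1]-\Pr[\mathrm{anon}\text{-}1=1]\bigr|\le 4\,\mathrm{Adv}^{\mathrm{zk}}_\Pi(t',q')+2\,\mathrm{Adv}^{\mathrm{hide}}_{\mathrm{comm}}(t',q+1)+2\,\mathrm{Adv}^{\mathrm{prf}}_f(t',q+1)+2(w\mu+\zeta),$$ where $\mu=\max_{v}\Pr_{P\leftarrow\mathbb G}[H(P)=v]$ and $\zeta=\max_{y\in\mathbb G}\Pr_{r\leftarrow\{0,1\}^\lambda}[H(y,r)=0]$. In particular, if $H$ never takes the value $0$ on pairs $(y,r)$ and the adversary starts no withdrawals, the last term vanishes. -/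

import Mathlib

open scoped ENNReal

noncomputable section

namespace ECash

/-! ### Oracle circuits and their size -/

/-- An oracle interface: a family of oracles, each with a query type and a response type. -/
structure Iface : Type 1 where
  Idx : Type
  Query : Idx → Type
  Resp : Idx → Type

/-- Values of type `X`, or failure. -/
abbrev Opt (X : Type) : Type := X ⊕ Unit

/-- (Non-uniform, probabilistic) oracle circuits from `X` to `Y`. A gate `op f` performs the
(randomized) operation `f`, a gate `ask i` queries the `i`-th oracle, `case` branches; the
remaining constructors are composition and wiring. -/
inductive Circuit (I : Iface) : Type → Type → Type 1
  | op {X Y : Type} (f : X → PMF Y) : Circuit I X Y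
  | ask (i : I.Idx) : Circuit I (I.Query i) (I.Resp i)
  | seq {X Y Z : Type} (A : Circuit I X Y) (B : Circuit I Y Z) : Circuit I X Z
  | par {X Y X' Y' : Type} (A : Circuit I X Y) (B : Circuit I X' Y') :
      Circuit I (X × X') (Y × Y')
  | case {X Y Z : Type} (A : Circuit I X Z) (B : Circuit I Y Z) : Circuit I (X ⊕ Y) Z
  | id {X : Type} : Circuit I X X
  | dup {X : Type} : Circuit I X (X × X)
  | fst {X Y : Type} : Circuit I (X × Y) X
  | snd {X Y : Type} : Circuit I (X × Y) Y
  | inl {X Y : Type} : Circuit I X (X ⊕ Y)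
  | inr {X Y : Type} : Circuit I Y (X ⊕ Y)
  | dist {X Y Z : Type} : Circuit I ((X ⊕ Y) × Z) ((X × Z) ⊕ (Y × Z))
  | split : Circuit I Bool (Unit ⊕ Unit)
  | bit {X : Type} (b : Bool) : Circuit I X Bool
  | drop {X : Type} : Circuit I X Unit

/-- A cost model assigns a running time to every (randomized) operation. -/
abbrev CostModel : Type 1 := ∀ X Y : Type, (X → PMF Y) → ℕ∞

namespace Circuit

variable {I : Iface}

/-- Execution of a circuit in a monad `M`, where `h` answers the oracle queries. The first summand
of a `Bool` wire stands for `true`. -/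
def run {M : Type → Type} [Monad M] [MonadLiftT PMF M] (h : ∀ i, I.Query i → M (I.Resp i)) :
    ∀ {X Y : Type}, Circuit I X Y → X → M Y
  | _, _, op f, x => liftM (f x)
  | _, _, ask i, x => h i x
  | _, _, seq A B, x => do
      let y ← A.run h x
      B.run h y
  | _, _, par A B, x => do
      let y ← A.run h x.1
      let y' ← B.run h x.2
      pure (y, y')
  | _, _, case A _, .inl x => A.run h x
  | _, _, case _ B, .inr x => B.run h x
  | _, _, id, x => pure x
  | _, _, dup, x => pure (x, x)
  | _, _, fst, x => pure x.1
  | _, _, snd, x => pure x.2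
  | _, _, inl, x => pure (.inl x)
  | _, _, inr, x => pure (.inr x)
  | _, _, dist, (.inl x, z) => pure (.inl (x, z))
  | _, _, dist, (.inr y, z) => pure (.inr (y, z))
  | _, _, split, b => pure (if b then .inl () else .inr ())
  | _, _, bit b, _ => pure b
  | _, _, drop, _ => pure ()

/-- Running time (circuit size): the total cost of all the operations, plus one for every branching.
Both branches of a `case` count, so that the length of the program is part of the running time. -/
def time (c : CostModel) : ∀ {X Y : Type}, Circuit I X Y → ℕ∞
  | X, Y, op f => c X Y f
  | _, _, seq A B => A.time c + B.time c
  | _, _, par A B => A.time c + B.time c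
  | _, _, case A B => A.time c + B.time c + 1
  | _, _, _ => 0

/-- Number of oracle gates, where a gate of the `i`-th oracle counts `w i` times. -/
def gates (w : I.Idx → ℕ) : ∀ {X Y : Type}, Circuit I X Y → ℕ
  | _, _, ask i => w i
  | _, _, seq A B => A.gates w + B.gates w
  | _, _, par A B => A.gates w + B.gates w
  | _, _, case A B => A.gates w + B.gates w
  | _, _, _ => 0

/-- Number of oracle queries, i.e. of oracle gates. -/
def queries {X Y : Type} (A : Circuit I X Y) : ℕ := A.gates (fun _ => 1)

end Circuit

/-- Probability that an experiment returns `true`. -/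
def prTrue (e : PMF Bool) : ℝ := (e true).toReal

/-- The deterministic operation `f`. -/
def det {X Y : Type} (f : X → Y) : X → PMF Y := fun x => PMF.pure (f x)

/-- `n` independent samples. -/
def iid {X : Type} (e : PMF X) : ∀ n : ℕ, PMF (Fin n → X)
  | 0 => PMF.pure Fin.elim0
  | n + 1 => do
      let x ← e
      let xs ← iid e n
      pure (Fin.cons x xs)

/-! ### Pseudorandom functions -/

inductive OneOracle
  | it

/-- The interface with a single oracle. -/
def oneIface (Q R : Type) : Iface where
  Idx := OneOracle
  Query _ := Q
  Resp _ := R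

/-- The PRF experiment: the oracle is `F k` for a uniform key `k` if `b`, and a uniformly random
function otherwise. -/
def prfExp {K D R : Type} [Fintype K] [Nonempty K] [Fintype D] [DecidableEq D] [Fintype R]
    [Nonempty R] (F : K → D → R) (b : Bool) (A : Circuit (oneIface D R) Unit Bool) :
    PMF Bool :=
  if b then do
    let k ← PMF.uniformOfFintype K
    A.run (M := PMF) (fun _ x => PMF.pure (F k x)) ()
  else do
    let f ← PMF.uniformOfFintype (D → R)
    A.run (M := PMF) (fun _ x => PMF.pure (f x)) ()

def prfAdv {K D R : Type} [Fintype K] [Nonempty K] [Fintype D] [DecidableEq D] [Fintype R]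
    [Nonempty R] (F : K → D → R) (c : CostModel) (t : ℕ∞) (q : ℕ) : ℝ :=
  sSup {a | ∃ A : Circuit (oneIface D R) Unit Bool, A.time c ≤ t ∧ A.queries ≤ q ∧
    a = |prTrue (prfExp F true A) - prTrue (prfExp F false A)|}

/-! ### Commitments -/

/-- The hiding experiment: on the query `(m₀, m₁)` the oracle returns a fresh commitment to `m_b`
(`b = false` is `0`, `b = true` is `1`). -/
def hidingExp {Msg Rnd Com : Type} [Fintype Rnd] [Nonempty Rnd] (comm : Msg → Rnd → Com)
    (b : Bool) (A : Circuit (oneIface (Msg × Msg) Com) Unit Bool) : PMF Bool :=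
  A.run (M := PMF) (fun _ (m : Msg × Msg) => do
    let r ← PMF.uniformOfFintype Rnd
    PMF.pure (comm (if b then m.2 else m.1) r)) ()

def hidingAdv {Msg Rnd Com : Type} [Fintype Rnd] [Nonempty Rnd] (comm : Msg → Rnd → Com)
    (c : CostModel) (t : ℕ∞) (q : ℕ) : ℝ :=
  sSup {a | ∃ A : Circuit (oneIface (Msg × Msg) Com) Unit Bool, A.time c ≤ t ∧ A.queries ≤ q ∧
    a = |prTrue (hidingExp comm false A) - prTrue (hidingExp comm true A)|}

/-! ### The random oracle and non-interactive zero-knowledge proofs -/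

/-- Bit strings of length `lam`. -/
abbrev Bits (lam : ℕ) : Type := Fin lam → Bool

/-- Interface of a random oracle from `{0,1}^*` to `{0,1}^lam`. -/
def roIface (lam : ℕ) : Iface := oneIface (List Bool) (Bits lam)

/-- Computations with a random oracle; the state is the table of the answers given so far. -/
abbrev RO (lam : ℕ) : Type → Type := StateT (List Bool → Opt (Bits lam)) PMF

/-- The random oracle, sampled lazily. -/
def hashRO {lam : ℕ} (x : List Bool) : RO lam (Bits lam) := fun tab =>
  match tab x with
  | .inl y => PMF.pure (y, tab)
  | .inr () => do
      let y ← PMF.uniformOfFintype (Bits lam)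
      PMF.pure (y, Function.update tab x (.inl y))

/-- Execution of an algorithm that has access to the random oracle. -/
def runRO {lam : ℕ} {X Y : Type} (A : Circuit (roIface lam) X Y) (x : X) : RO lam Y :=
  A.run (M := RO lam) (fun _ z => hashRO z) x

/-- The empty table of a random oracle. -/
def emptyTable (lam : ℕ) : List Bool → Opt (Bits lam) := fun _ => .inr ()

/-- A non-interactive proof system in the random oracle model for the relation `Rel`, with a
simulator whose two interfaces `simHash` and `simGo` share a state. -/
structure NIZK (lam : ℕ) (Stmt Wit : Type) (Rel : Stmt → Wit → Prop) : Type 1 where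
  Proof : Type
  prove : Circuit (roIface lam) (Stmt × Wit) Proof
  verify : Circuit (roIface lam) (Stmt × Proof) Bool
  SimState : Type
  simInit : PMF SimState
  simHash : SimState × List Bool → PMF (Bits lam × SimState)
  simGo : SimState × Stmt → PMF (Proof × SimState)
  complete : ∀ x w, Rel x w → ∀ tab,
    ∀ r ∈ ((runRO prove (x, w) >>= fun π => runRO verify (x, π)) tab).support, r.1 = true

inductive ZKOracle
  | hash
  | prove

/-- Interface of the zero-knowledge experiment: the hash function, and proofs of statements for
which the distinguisher supplies a witness. -/
def zkIface (lam : ℕ) (Stmt Wit Proof : Type) : Iface where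
  Idx := ZKOracle
  Query
    | .hash => List Bool
    | .prove => Stmt × Wit
  Resp
    | .hash => Bits lam
    | .prove => Opt Proof

open Classical in
/-- The oracles of the real experiment. -/
def zkReal {lam : ℕ} {Stmt Wit : Type} {Rel : Stmt → Wit → Prop} (N : NIZK lam Stmt Wit Rel) :
    ∀ i, (zkIface lam Stmt Wit N.Proof).Query i →
      RO lam ((zkIface lam Stmt Wit N.Proof).Resp i)
  | .hash, x => hashRO x
  | .prove, x =>
      if Rel x.1 x.2 then do
        let π ← runRO N.prove x
        pure (.inl π)
      else pure (.inr ())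

open Classical in
/-- The oracles of the simulated experiment. -/
def zkSim {lam : ℕ} {Stmt Wit : Type} {Rel : Stmt → Wit → Prop} (N : NIZK lam Stmt Wit Rel) :
    ∀ i, (zkIface lam Stmt Wit N.Proof).Query i →
      StateT N.SimState PMF ((zkIface lam Stmt Wit N.Proof).Resp i)
  | .hash, x => fun s => N.simHash (s, x)
  | .prove, x =>
      if Rel x.1 x.2 then do
        let π ← (fun s => N.simGo (s, x.1) : StateT N.SimState PMF N.Proof)
        pure (.inl π)
      else pure (.inr ())

/-- The zero-knowledge experiment: real (`b = false`) or simulated (`b = true`). -/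
def zkExp {lam : ℕ} {Stmt Wit : Type} {Rel : Stmt → Wit → Prop} (N : NIZK lam Stmt Wit Rel)
    (b : Bool) (D : Circuit (zkIface lam Stmt Wit N.Proof) Unit Bool) : PMF Bool :=
  if b then do
    let s ← N.simInit
    let r ← D.run (M := StateT N.SimState PMF) (zkSim N) () s
    PMF.pure r.1
  else do
    let r ← D.run (M := RO lam) (zkReal N) () (emptyTable lam)
    PMF.pure r.1

def zkAdv {lam : ℕ} {Stmt Wit : Type} {Rel : Stmt → Wit → Prop} (N : NIZK lam Stmt Wit Rel)
    (c : CostModel) (t : ℕ∞) (q : ℕ) : ℝ :=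
  sSup {a | ∃ D : Circuit (zkIface lam Stmt Wit N.Proof) Unit Bool, D.time c ≤ t ∧
    D.queries ≤ q ∧ a = prTrue (zkExp N true D) - prTrue (zkExp N false D)}

/-! ### Signature schemes -/

/-- A digital signature scheme. -/
structure SignatureScheme : Type 1 where
  PK : Type
  SK : Type
  Msg : Type
  Sig : Type
  keyGen : PMF (PK × SK)
  sign : SK × Msg → PMF Sig
  verify : PK × Msg × Sig → Bool
  correct : ∀ k ∈ keyGen.support, ∀ m, ∀ σ ∈ (sign (k.2, m)).support, verify (k.1, m, σ) = true

/-- A blind signature scheme for messages in `Msg`. -/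
structure BlindSignatureScheme (Msg : Type) : Type 1 where
  PK : Type
  SK : Type
  Rnd : Type
  Blinded : Type
  BlindSig : Type
  Sig : Type
  keyGen : PMF (PK × SK)
  sampleRnd : PMF Rnd
  blind : PK × Msg × Rnd → Blinded
  sign : SK × Blinded → PMF BlindSig
  unblind : PK × BlindSig × Rnd → Sig
  verify : PK × Msg × Sig → Bool
  correct : ∀ k ∈ keyGen.support, ∀ m r, ∀ σ ∈ (sign (k.2, blind (k.1, m, r))).support,
    verify (k.1, m, unblind (k.1, σ, r)) = true

/-- A scheme for signing committed messages: the signer signs a commitment, and the holder of the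
opening obtains from the answer a signature on the committed message. -/
structure CommittedSignatureScheme {Msg Rnd Com : Type} (comm : Msg → Rnd → Com) : Type 1 where
  PK : Type
  SK : Type
  PreSig : Type
  Sig : Type
  keyGen : PMF (PK × SK)
  sign : SK × Com → PMF PreSig
  finish : Rnd × PreSig → Sig
  check : PK × Msg × Sig → Bool
  correct : ∀ k ∈ keyGen.support, ∀ m r, ∀ σ ∈ (sign (k.2, comm m r)).support,
    check (k.1, m, finish (r, σ)) = true

/-! ### The group, the Dodis-Yampolinsky function and Pedersen commitments -/

/-- A group of prime order `p` with generators. -/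
structure GroupParams (p : ℕ) (G : Type) [CommGroup G] where
  card_eq : Nat.card G = p
  g : G
  g₁ : G
  g₂ : G
  h : G
  g_ne : g ≠ 1
  g₁_ne : g₁ ≠ 1
  g₂_ne : g₂ ≠ 1
  h_ne : h ≠ 1

/-- `x ^ a` for `a ∈ ℤ/p`. -/
def gpow {p : ℕ} {G : Type} [CommGroup G] (x : G) (a : ZMod p) : G := x ^ a.val

/-- Dodis-Yampolinsky: `f_k(x) = g ^ (1 / (1 + k + x))`, with value `1` if `1 + k + x = 0`. -/
def dyPRF {p : ℕ} [Fact p.Prime] {G : Type} [CommGroup G] (pp : GroupParams p G)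
    (k x : ZMod p) : G :=
  gpow pp.g (1 + k + x)⁻¹

/-- Pedersen commitments to pairs. -/
def comm {p : ℕ} {G : Type} [CommGroup G] (pp : GroupParams p G) (m : ZMod p × ZMod p)
    (r : ZMod p) : G :=
  gpow pp.g₁ m.1 * gpow pp.g₂ m.2 * gpow pp.h r

/-- Pedersen commitment to a single message, `g₁ ^ m * h ^ r`. -/
def comm₁ {p : ℕ} {G : Type} [CommGroup G] (pp : GroupParams p G) (m r : ZMod p) : G :=
  comm pp (m, 0) r

/-! ### The statements proved in the scheme -/

/-- `sig pk P`: knowledge of an opening of `P` and of a signature on it under `pk`.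
`voucher κ₁ κ₂ X Y Q id rc`: the tokens `X`, `Y` are computed from the openings of `κ₁`, `κ₂`, `Q`.
`spend P Z id rt`: the token `Z` is computed from the opening of `P`. -/
inductive Stmt (p : ℕ) (G ZPK : Type)
  | sig (pk : ZPK) (P : G)
  | voucher (κ₁ κ₂ X Y Q : G) (id rc : ZMod p)
  | spend (P Z : G) (id rt : ZMod p)

inductive Wit (p : ℕ) (ZSig : Type)
  | sig (m : ZMod p × ZMod p) (r : ZMod p) (σ : ZSig)
  | voucher (α₁ β₁ α₂ β₂ γ δ : ZMod p)
  | spend (α β γ : ZMod p)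

/-- The witness relation. -/
def Rel {p : ℕ} [Fact p.Prime] {G : Type} [CommGroup G] (pp : GroupParams p G)
    (zs : CommittedSignatureScheme (comm pp)) : Stmt p G zs.PK → Wit p zs.Sig → Prop
  | .sig pk P, .sig m r σ => comm pp m r = P ∧ zs.check (pk, m, σ) = true
  | .voucher κ₁ κ₂ X Y Q id rc, .voucher α₁ β₁ α₂ β₂ γ δ =>
      κ₁ = comm₁ pp α₁ β₁ ∧ κ₂ = comm₁ pp α₂ β₂ ∧ Q = comm₁ pp γ δ ∧ X = dyPRF pp α₁ id ∧
        Y = gpow pp.g γ * gpow (dyPRF pp α₂ 0) rc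
  | .spend P Z id rt, .spend α β γ =>
      comm pp (α, γ) β = P ∧ Z = gpow pp.g α * gpow (dyPRF pp γ id) rt
  | _, _ => False

/-! ### The e-cash scheme -/

/-- The building blocks of the (non-compact) multi-issuer e-cash scheme: the group parameters, the
three signature schemes, the hash function (on its three kinds of inputs: coins, user commitments,
and merchant key with transaction randomness) and the proof system. -/
structure Scheme (p lam : ℕ) [Fact p.Prime] (G : Type) [CommGroup G] : Type 1 where
  pp : GroupParams p G
  sgn : SignatureScheme
  CoinMsg : Type
  bsgn : BlindSignatureScheme CoinMsg
  zsgn : CommittedSignatureScheme (comm pp)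
  hashCoin : G × G × G → CoinMsg
  hashCom : G → ZMod p
  hashTx : G × Bits lam → ZMod p
  nizk : NIZK lam (Stmt p G zsgn.PK) (Wit p zsgn.Sig) (Rel pp zsgn)

namespace Scheme

variable {p lam : ℕ} [Fact p.Prime] {G : Type} [CommGroup G]

/-- Key pair of the digital signature scheme. -/
abbrev SigKeys (S : Scheme p lam G) : Type := S.sgn.PK × S.sgn.SK

/-- The bank's key pairs: for signatures, for blind signatures, and for signing the committed
secrets of the users and of the ATMs. -/
abbrev BankKeys (S : Scheme p lam G) : Type :=
  S.SigKeys × (S.bsgn.PK × S.bsgn.SK) × (S.zsgn.PK × S.zsgn.SK) × (S.zsgn.PK × S.zsgn.SK)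

/-- Identity key, the bank's signature on it, signing keys. -/
abbrev ATMKeys (S : Scheme p lam G) : Type := ZMod p × S.zsgn.Sig × S.SigKeys

/-- Identity key `sk`, PRF key `u`, the bank's signature on `(sk, u)`, signing keys. -/
abbrev UserKeys (S : Scheme p lam G) : Type := ZMod p × ZMod p × S.zsgn.Sig × S.SigKeys

abbrev Keys (S : Scheme p lam G) (η γ : ℕ) : Type :=
  S.BankKeys × (Fin γ → S.ATMKeys) × (Fin η → S.UserKeys)

/-- A coin `(κ₁, κ₂, Q, σ_c)`. -/
abbrev Coin (S : Scheme p lam G) : Type := G × G × G × S.bsgn.Sig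

/-- A coin with the secrets `(k₁, r₁), (k₂, r₂), r_Q` of the ATM. -/
abbrev StoredCoin (S : Scheme p lam G) : Type :=
  (ZMod p × ZMod p) × (ZMod p × ZMod p) × ZMod p × S.Coin

/-- A voucher `(P, π_sk, X, Y, π_id, π_ATM, r_c)`. -/
abbrev Voucher (S : Scheme p lam G) : Type :=
  G × S.nizk.Proof × G × G × S.nizk.Proof × S.nizk.Proof × ZMod p

/-- A transaction `(Z, π_T, r_v, r_t)`. -/
abbrev Tx (S : Scheme p lam G) : Type := G × S.nizk.Proof × Bits lam × ZMod p

/-- A withdrawal of an honest user: user, commitment `P`, its randomness, and whether the coin has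
been spent. -/
abbrev Session (p η : ℕ) (G : Type) : Type := Fin η × G × ZMod p × Bool

/-- Uniform element of `ℤ/p`. -/
def scalar (p : ℕ) [Fact p.Prime] : PMF (ZMod p) := PMF.uniformOfFintype (ZMod p)

def initBank (S : Scheme p lam G) : PMF S.BankKeys := do
  let k ← S.sgn.keyGen
  let kb ← S.bsgn.keyGen
  let kz ← S.zsgn.keyGen
  let kz' ← S.zsgn.keyGen
  pure (k, kb, kz, kz')

def initATM (S : Scheme p lam G) (B : S.BankKeys) : PMF S.ATMKeys := do
  let sk ← scalar p
  let r ← scalar p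
  let σ ← S.zsgn.sign (B.2.2.2.2, comm₁ S.pp sk r)
  let k ← S.sgn.keyGen
  pure (sk, S.zsgn.finish (r, σ), k)

def initUser (S : Scheme p lam G) (B : S.BankKeys) : PMF S.UserKeys := do
  let sk ← scalar p
  let u ← scalar p
  let r ← scalar p
  let σ ← S.zsgn.sign (B.2.2.1.2, comm S.pp (sk, u) r)
  let k ← S.sgn.keyGen
  pure (sk, u, S.zsgn.finish (r, σ), k)

/-- Initialization of the bank, `γ` ATMs and `η` users. -/
def setup (S : Scheme p lam G) (η γ : ℕ) : PMF (S.Keys η γ) := do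
  let B ← S.initBank
  let atms ← iid (S.initATM B) γ
  let users ← iid (S.initUser B) η
  pure (B, atms, users)

/-- An ATM requests one coin, which the bank signs blindly. -/
def reqCoin (S : Scheme p lam G) (x : S.BankKeys × S.ATMKeys) : PMF S.StoredCoin := do
  let (B, atm) := x
  let k₁ ← scalar p
  let r₁ ← scalar p
  let k₂ ← scalar p
  let r₂ ← scalar p
  let rQ ← scalar p
  let κ₁ := comm₁ S.pp k₁ r₁
  let κ₂ := comm₁ S.pp k₂ r₂
  let Q := comm₁ S.pp atm.1 rQ
  let rb ← S.bsgn.sampleRnd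
  let σ' ← S.bsgn.sign (B.2.1.2, S.bsgn.blind (B.2.1.1, S.hashCoin (κ₁, κ₂, Q), rb))
  pure ((k₁, r₁), (k₂, r₂), rQ, κ₁, κ₂, Q, S.bsgn.unblind (B.2.1.1, σ', rb))

/-- First step of a withdrawal by a user: the commitment `P`, its randomness and the proof
`π_sk`. -/
def withdraw (S : Scheme p lam G) (B : S.BankKeys) (usr : S.UserKeys) :
    RO lam (G × ZMod p × S.nizk.Proof) := do
  let (sk, u, σ, _) := usr
  let r ← (liftM (scalar p) : RO lam (ZMod p))
  let P := comm S.pp (sk, u) r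
  let π ← runRO S.nizk.prove (.sig B.2.2.1.1 P, .sig (sk, u) r σ)
  pure (P, r, π)

/-- The ATM's part of the withdrawal: on input `P, π_sk` it issues a stored coin with a voucher, or
aborts if `π_sk` is not valid. -/
def issueVoucher (S : Scheme p lam G) (B : S.BankKeys) (atm : S.ATMKeys) (coin : S.StoredCoin)
    (P : G) (πsk : S.nizk.Proof) : RO lam (Opt (S.Coin × S.Voucher)) := do
  let (skj, σj, _) := atm
  let ((k₁, r₁), (k₂, r₂), rQ, κ₁, κ₂, Q, σc) := coin
  let ok ← runRO S.nizk.verify (.sig B.2.2.1.1 P, πsk)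
  if ok then do
    let rc := S.hashCom P
    let id := rc + 1
    let X := dyPRF S.pp k₁ id
    let Y := gpow S.pp.g skj * gpow (dyPRF S.pp k₂ 0) rc
    let πatm ← runRO S.nizk.prove (.sig B.2.2.2.1 Q, .sig (skj, 0) rQ σj)
    let πid ← runRO S.nizk.prove
      (.voucher κ₁ κ₂ X Y Q id rc, .voucher k₁ r₁ k₂ r₂ skj rQ)
    pure (.inl ((κ₁, κ₂, Q, σc), (P, πsk, X, Y, πid, πatm, rc)))
  else pure (.inr ())

open Classical in
/-- The check that a coin is valid and linked to a voucher. -/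
def linked (S : Scheme p lam G) (B : S.BankKeys) (C : S.Coin) (V : S.Voucher) : RO lam Bool := do
  let (κ₁, κ₂, Q, σc) := C
  let (P, πsk, X, Y, πid, πatm, rc) := V
  let b₁ ← runRO S.nizk.verify (.sig B.2.2.1.1 P, πsk)
  let b₂ ← runRO S.nizk.verify (.sig B.2.2.2.1 Q, πatm)
  let b₃ ← runRO S.nizk.verify (.voucher κ₁ κ₂ X Y Q (rc + 1) rc, πid)
  pure (decide (rc = S.hashCom P) && b₁ && b₂ &&
    S.bsgn.verify (B.2.1.1, S.hashCoin (κ₁, κ₂, Q), σc) && b₃)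

/-- A user with keys `usr` and commitment `P` (randomness `r`, voucher randomness `rc`) spends the
coin at the merchant with public key `pkm`, who has sent `rv`. -/
def spendCoin (S : Scheme p lam G) (usr : S.UserKeys) (P : G) (r rc : ZMod p) (pkm : G)
    (rv : Bits lam) : RO lam S.Tx := do
  let (sk, u, _, _) := usr
  let rt := S.hashTx (pkm, rv)
  let id := rc + 1
  let Z := gpow S.pp.g sk * gpow (dyPRF S.pp u id) rt
  let πT ← runRO S.nizk.prove (.spend P Z id rt, .spend sk r u)
  pure (Z, πT, rv, rt)

/-! ### The anonymity experiment -/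

inductive AnonOracle
  | hash
  | withdraw
  | spend

/-- The adversary's oracles: the random oracle; starting a withdrawal by a user (which returns the
user's public key, the commitment and the proof); and making the user of the `s`-th withdrawal spend
a coin with a voucher at the merchant with the given public key and randomness. -/
def anonIface (S : Scheme p lam G) (η : ℕ) : Iface where
  Idx := AnonOracle
  Query
    | .hash => List Bool
    | .withdraw => Fin η
    | .spend => ℕ × S.Coin × S.Voucher × G × Bits lam
  Resp
    | .hash => Bits lam
    | .withdraw => Opt (G × G × S.nizk.Proof)
    | .spend => Opt S.Tx

/-- The monad of the experiment: the random oracle and the list of the withdrawals of the honest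
users. -/
abbrev AnonM (p lam η : ℕ) (G : Type) : Type → Type := StateT (List (Session p η G)) (RO lam)

open Classical in
/-- The oracles. The honest users are those with index below `ηH`. An honest user accepts only
a valid coin with a voucher linked to it that is on the user's own commitment, and spends a coin only
once. -/
def anonOracle (S : Scheme p lam G) {η γ : ℕ} (ηH : ℕ) (K : S.Keys η γ) :
    ∀ i, (S.anonIface η).Query i → AnonM p lam η G ((S.anonIface η).Resp i)
  | .hash, x => (liftM (hashRO x : RO lam (Bits lam)) : AnonM p lam η G (Bits lam))
  | .withdraw, i =>
      if i.val < ηH then do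
        let (P, r, π) ← (liftM (S.withdraw K.1 (K.2.2 i)) :
          AnonM p lam η G (G × ZMod p × S.nizk.Proof))
        modify (fun l => l ++ [(i, P, r, false)])
        pure (.inl (gpow S.pp.g (K.2.2 i).1, P, π))
      else pure (.inr ())
  | .spend, (s, C, V, pkm, rv) => do
      let l ← get
      match l[s]? with
      | none => pure (.inr ())
      | some (i, P, r, spent) => do
          let ok ← (liftM (S.linked K.1 C V) : AnonM p lam η G Bool)
          if ok = true ∧ V.1 = P ∧ spent = false then do
            let T ← (liftM (S.spendCoin (K.2.2 i) P r V.2.2.2.2.2.2 pkm rv) :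
              AnonM p lam η G S.Tx)
            set (l.set s (i, P, r, true))
            pure (.inl T)
          else pure (.inr ())

/-- The adversary's view of the users: the public keys, the signing keys, and the remaining secrets
of the dishonest users. -/
abbrev UserView (S : Scheme p lam G) : Type := G × S.SigKeys × Opt S.UserKeys

/-- The adversary's input: all keys of the bank and of the ATMs, and its view of the users. -/
abbrev AdvInput (S : Scheme p lam G) (η γ : ℕ) : Type :=
  S.BankKeys × (Fin γ → S.ATMKeys) × (Fin η → S.UserView)

def advInput (S : Scheme p lam G) {η γ : ℕ} (ηH : ℕ) (K : S.Keys η γ) : S.AdvInput η γ :=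
  (K.1, K.2.1, fun i => (gpow S.pp.g (K.2.2 i).1, (K.2.2 i).2.2.2,
    if i.val < ηH then .inr () else .inl (K.2.2 i)))

/-- An anonymity adversary. The first stage outputs `i₀, i₁, j, m` (two users, an ATM, a merchant)
and a state; the second gets coin, voucher, transaction, the bank's keys and the state. -/
structure AnonAdversary (S : Scheme p lam G) (η γ : ℕ) : Type 1 where
  State : Type
  A₁ : Circuit (S.anonIface η) (S.AdvInput η γ) (Fin η × Fin η × Fin γ × Fin η × State)
  A₂ : Circuit (S.anonIface η) (S.Coin × S.Voucher × S.Tx × S.BankKeys × State) Bool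

/-- Total running time of an adversary. -/
def AnonAdversary.time {S : Scheme p lam G} {η γ : ℕ} (A : S.AnonAdversary η γ)
    (c : CostModel) : ℕ∞ :=
  A.A₁.time c + A.A₂.time c

/-- Total number of oracle queries of an adversary. -/
def AnonAdversary.queries {S : Scheme p lam G} {η γ : ℕ} (A : S.AnonAdversary η γ) : ℕ :=
  A.A₁.queries + A.A₂.queries

def AnonOracle.isWithdraw : AnonOracle → ℕ
  | .withdraw => 1
  | _ => 0

/-- Number of withdrawals by honest users that an adversary starts. -/
def AnonAdversary.withdrawals {S : Scheme p lam G} {η γ : ℕ} (A : S.AnonAdversary η γ) : ℕ :=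
  A.A₁.gates AnonOracle.isWithdraw + A.A₂.gates AnonOracle.isWithdraw

/-- The challenge: the user `i` withdraws a coin from the ATM `j` and spends it at the
merchant `m`. -/
def challenge (S : Scheme p lam G) {η γ : ℕ} (K : S.Keys η γ) (i : Fin η) (j : Fin γ)
    (m : Fin η) : RO lam (Opt (S.Coin × S.Voucher × S.Tx)) := do
  let (P, r, πsk) ← S.withdraw K.1 (K.2.2 i)
  let coin ← (liftM (S.reqCoin (K.1, K.2.1 j)) : RO lam S.StoredCoin)
  let CV ← S.issueVoucher K.1 (K.2.1 j) coin P πsk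
  match CV with
  | .inr () => pure (.inr ())
  | .inl (C, V) => do
      let ok ← S.linked K.1 C V
      if ok then do
        let rv ← (liftM (PMF.uniformOfFintype (Bits lam)) : RO lam (Bits lam))
        let T ← S.spendCoin (K.2.2 i) P r V.2.2.2.2.2.2 (gpow S.pp.g (K.2.2 m).1) rv
        pure (.inl (C, V, T))
      else pure (.inr ())

/-- The anonymity experiment with the bit `b` (`false` is `0`, `true` is `1`), after the
initialization. -/
def anonGame (S : Scheme p lam G) {η γ : ℕ} (ηH : ℕ) (b : Bool) (A : S.AnonAdversary η γ)
    (K : S.Keys η γ) : AnonM p lam η G Bool := do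
  let (i₀, i₁, j, m, φ) ←
    A.A₁.run (M := AnonM p lam η G) (S.anonOracle ηH K) (S.advInput ηH K)
  if i₀.val < ηH ∧ i₁.val < ηH ∧ i₀ ≠ i₁ then
    let CVT ← (liftM (S.challenge K (if b then i₁ else i₀) j m) :
      AnonM p lam η G (Opt (S.Coin × S.Voucher × S.Tx)))
    match CVT with
    | .inr () => pure false
    | .inl (C, V, T) =>
        A.A₂.run (M := AnonM p lam η G) (S.anonOracle ηH K) (C, V, T, K.1, φ)
  else
    pure false

/-- The anonymity experiment with the bit `b`. -/
def anonExp (S : Scheme p lam G) {η γ : ℕ} (ηH : ℕ) (b : Bool) (A : S.AnonAdversary η γ) :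
    PMF Bool := do
  let K ← S.setup η γ
  let r ← (S.anonGame ηH b A K []) (emptyTable lam)
  pure r.1.1

/-! ### Time and statistical quantities of the scheme -/

open Classical in
/-- The basic operations of the scheme, in terms of which its running time is measured. -/
inductive BasicOp (S : Scheme p lam G) (η ηH γ : ℕ) : ∀ {X Y : Type}, (X → PMF Y) → Prop
  | mul : BasicOp S η ηH γ (det fun x : G × G => x.1 * x.2)
  | pow : BasicOp S η ηH γ (det fun x : G × ZMod p => gpow x.1 x.2)
  | add : BasicOp S η ηH γ (det fun x : ZMod p × ZMod p => x.1 + x.2)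
  | zero : BasicOp S η ηH γ (det fun _ : Unit => (0 : ZMod p))
  | one : BasicOp S η ηH γ (det fun _ : Unit => (1 : ZMod p))
  | gen : BasicOp S η ηH γ (det fun _ : Unit => S.pp.g)
  | commit : BasicOp S η ηH γ (det fun x : (ZMod p × ZMod p) × ZMod p => comm S.pp x.1 x.2)
  | prf : BasicOp S η ηH γ (det fun x : ZMod p × ZMod p => dyPRF S.pp x.1 x.2)
  | eqGroup : BasicOp S η ηH γ (det fun x : G × G => decide (x.1 = x.2))
  | eqScalar : BasicOp S η ηH γ (det fun x : ZMod p × ZMod p => decide (x.1 = x.2))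
  | eqUser : BasicOp S η ηH γ (det fun x : Fin η × Fin η => decide (x.1 = x.2))
  | honest : BasicOp S η ηH γ (det fun i : Fin η => decide (i.val < ηH))
  | scalar : BasicOp S η ηH γ (fun _ : Unit => Scheme.scalar p)
  | bits : BasicOp S η ηH γ (fun _ : Unit => PMF.uniformOfFintype (Bits lam))
  | hashCoin : BasicOp S η ηH γ (det S.hashCoin)
  | hashCom : BasicOp S η ηH γ (det S.hashCom)
  | hashTx : BasicOp S η ηH γ (det S.hashTx)
  | blindVerify : BasicOp S η ηH γ (det S.bsgn.verify)
  | setup : BasicOp S η ηH γ (fun _ : Unit => S.setup η γ)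
  | input : BasicOp S η ηH γ (det fun K : S.Keys η γ => S.advInput ηH K)
  | user : BasicOp S η ηH γ (det fun x : (Fin η → S.UserKeys) × Fin η => x.1 x.2)
  | atm : BasicOp S η ηH γ (det fun x : (Fin γ → S.ATMKeys) × Fin γ => x.1 x.2)
  | reqCoin : BasicOp S η ηH γ S.reqCoin
  | stmtSig : BasicOp S η ηH γ (det fun x : S.zsgn.PK × G =>
      (Stmt.sig x.1 x.2 : Stmt p G S.zsgn.PK))
  | stmtVoucher : BasicOp S η ηH γ (det fun x : G × G × G × G × G × ZMod p × ZMod p =>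
      (Stmt.voucher x.1 x.2.1 x.2.2.1 x.2.2.2.1 x.2.2.2.2.1 x.2.2.2.2.2.1 x.2.2.2.2.2.2 :
        Stmt p G S.zsgn.PK))
  | stmtSpend : BasicOp S η ηH γ (det fun x : G × G × ZMod p × ZMod p =>
      (Stmt.spend x.1 x.2.1 x.2.2.1 x.2.2.2 : Stmt p G S.zsgn.PK))
  | witSig : BasicOp S η ηH γ (det fun x : (ZMod p × ZMod p) × ZMod p × S.zsgn.Sig =>
      (Wit.sig x.1 x.2.1 x.2.2 : Wit p S.zsgn.Sig))
  | witVoucher : BasicOp S η ηH γ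
      (det fun x : ZMod p × ZMod p × ZMod p × ZMod p × ZMod p × ZMod p =>
        (Wit.voucher x.1 x.2.1 x.2.2.1 x.2.2.2.1 x.2.2.2.2.1 x.2.2.2.2.2 : Wit p S.zsgn.Sig))
  | witSpend : BasicOp S η ηH γ (det fun x : ZMod p × ZMod p × ZMod p =>
      (Wit.spend x.1 x.2.1 x.2.2 : Wit p S.zsgn.Sig))
  | simInit : BasicOp S η ηH γ (fun _ : Unit => S.nizk.simInit)
  | simHash : BasicOp S η ηH γ S.nizk.simHash
  | simGo : BasicOp S η ηH γ S.nizk.simGo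
  | noSession : BasicOp S η ηH γ (det fun _ : Unit => ([] : List (Session p η G)))
  | addSession : BasicOp S η ηH γ (det fun x : List (Session p η G) × Session p η G =>
      x.1 ++ [x.2])
  | getSession : BasicOp S η ηH γ (det fun x : List (Session p η G) × ℕ =>
      (match x.1[x.2]? with
        | none => .inr ()
        | some s => .inl s : Opt (Session p η G)))
  | setSession : BasicOp S η ηH γ (det fun x : List (Session p η G) × ℕ × Session p η G =>
      x.1.set x.2.1 x.2.2)

/-- `τ` bounds the time of every basic operation of the scheme and of the prover and the verifier of
the proof system, and `ρ` bounds the number of random oracle queries of the latter two. -/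
structure CostBound (S : Scheme p lam G) (η ηH γ : ℕ) (c : CostModel) (τ : ℕ∞) (ρ : ℕ) :
    Prop where
  basic : ∀ (X Y : Type) (f : X → PMF Y), BasicOp S η ηH γ f → c X Y f ≤ τ
  prove_time : S.nizk.prove.time c ≤ τ
  verify_time : S.nizk.verify.time c ≤ τ
  prove_queries : S.nizk.prove.queries ≤ ρ
  verify_queries : S.nizk.verify.queries ≤ ρ

/-- `max_v Pr[H(P) = v]` for a uniformly random group element `P`. -/
def hashMass (S : Scheme p lam G) : ℝ :=
  ⨆ v : ZMod p, (Nat.card {P : G // S.hashCom P = v} : ℝ) / p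

/-- `max_y Pr[H(y, r) = 0]` for uniformly random `r ∈ {0,1}^lam`. -/
def zeroMass (S : Scheme p lam G) : ℝ :=
  ⨆ y : G, (Nat.card {r : Bits lam // S.hashTx (y, r) = 0} : ℝ) / 2 ^ lam

end Scheme

end ECash

end

/-! The proof is a sequence of games, all obtained by running one program with different oracles for
hashing, proving, verifying and evaluating the users' functions.

Simulated proofs. Every statement proved in the experiment is true: the keys carry valid signatures,
the coins open to the stored values, and each session's commitment opens to its user's keys. The
experiment can therefore be run inside the zero-knowledge experiment, and replacing real by
simulated proofs costs `zkAdv` for each bit (`zkExp_false`, `zkExp_true`, `abs_le_zkAdv`).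

Erasing secrets. A simulated proof uses no witness, and a Pedersen commitment with uniform
randomness is a uniform group element (`scalar_comm`). Hence the PRF key `u` of an honest user
survives only in the values of the user's function. A user accepts only vouchers with `rc = H(P)`,
so these values are taken at the single point `H(P) + 1` for each withdrawal (`gameG_eq`). Hiding
holds perfectly, and the hiding advantage enters the final bound only as a nonnegative term.

One PRF for all users. The function `dyPRF` depends on key and argument only through their sum, so
`f_k(x + u) = f_{u+k}(x)`. A single PRF oracle, queried at `x + u_i` on behalf of user `i`, produces
the keys `u_i + k`. These are distributed like the `u_i`, because nothing else in the game depends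
on the honest users' keys (`simExp_shift`, `prfExp_true_eq`). Passing to a random function thus
costs one `prfAdv` for each bit, whatever the number of users.

Statistical part. With a random function `f`, the challenge uses `f` at `H(P) + 1 + u_i`. Unless
another withdrawal leads to the same point, this value is an independent uniform element `y`
(`ev_game_not_collides`). Each other withdrawal collides with probability at most `μ`, thanks to
whichever of the two commitments is drawn later (`ev_collides_le`). Finally, `Z = g^sk * y^{r_t}` is
uniform for every `sk` if `r_t ≠ 0`, and coin and voucher do not depend on the user beyond `P`. So
the two bits give the same ideal game up to the event `r_t = 0`, of probability at most `ζ`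
(`idealProb_le_idealProb`).

The total is two zero-knowledge terms, two PRF terms and `2wμ + ζ`, which the stated bound
dominates. -/

noncomputable section

namespace ECash

/-! ### Evaluation of state monad programs -/

section StateT

variable {M : Type → Type} [Monad M] [LawfulMonad M] {σ X Y : Type}

theorem stateT_lift_bind (m : M X) (f : X → StateT σ M Y) (s : σ) :
    (liftM m >>= f : StateT σ M Y) s = m >>= fun a => f a s := by
  change ((m >>= fun a => pure (a, s)) >>= fun r => f r.1 r.2) = _
  simp only [bind_assoc, pure_bind]

theorem stateT_get_bind (f : σ → StateT σ M Y) (s : σ) :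
    (get >>= f : StateT σ M Y) s = f s s := by
  change (pure (s, s) >>= fun r => f r.1 r.2) = _
  simp

theorem stateT_modify_bind (u : σ → σ) (f : PUnit → StateT σ M Y) (s : σ) :
    (modify u >>= f : StateT σ M Y) s = f ⟨⟩ (u s) := by
  change (pure (_, u s) >>= fun r => f r.1 r.2) = _
  simp

theorem stateT_set_bind (s' : σ) (f : PUnit → StateT σ M Y) (s : σ) :
    (set s' >>= f : StateT σ M Y) s = f ⟨⟩ s' := by
  change (pure (_, s') >>= fun r => f r.1 r.2) = _
  simp

theorem stateT_bind {M : Type → Type} [Monad M] (m : StateT σ M X) (f : X → StateT σ M Y)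
    (s : σ) : (m >>= f) s = m s >>= fun r => f r.1 r.2 := rfl

theorem stateT_pure {M : Type → Type} [Monad M] (x : X) (s : σ) :
    (pure x : StateT σ M X) s = pure (x, s) := rfl

end StateT

/-! ### Execution, composition and size of circuits -/

namespace Circuit

variable {I J : Iface}

section Run

variable {M : Type → Type} [Monad M] [MonadLiftT PMF M] (h : ∀ i, I.Query i → M (I.Resp i))
  {X Y Z X' Y' : Type}

@[simp] theorem run_op (f : X → PMF Y) (x : X) : (op f : Circuit I X Y).run h x = liftM (f x) := rfl

@[simp] theorem run_ask (i : I.Idx) (x : I.Query i) : (ask i : Circuit I _ _).run h x = h i x := rfl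

@[simp] theorem run_seq (A : Circuit I X Y) (B : Circuit I Y Z) (x : X) :
    (seq A B).run h x = A.run h x >>= fun y => B.run h y := rfl

@[simp] theorem run_par (A : Circuit I X Y) (B : Circuit I X' Y') (x : X × X') :
    (par A B).run h x = A.run h x.1 >>= fun y => B.run h x.2 >>= fun y' => pure (y, y') := rfl

@[simp] theorem run_case_inl (A : Circuit I X Z) (B : Circuit I Y Z) (x : X) :
    (case A B).run h (.inl x) = A.run h x := rfl

@[simp] theorem run_case_inr (A : Circuit I X Z) (B : Circuit I Y Z) (y : Y) :
    (case A B).run h (.inr y) = B.run h y := rfl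

@[simp] theorem run_id (x : X) : (id : Circuit I X X).run h x = pure x := rfl

@[simp] theorem run_dup (x : X) : (dup : Circuit I X _).run h x = pure (x, x) := rfl

@[simp] theorem run_fst (x : X × Y) : (fst : Circuit I _ _).run h x = pure x.1 := rfl

@[simp] theorem run_snd (x : X × Y) : (snd : Circuit I _ _).run h x = pure x.2 := rfl

@[simp] theorem run_inl (x : X) : (inl : Circuit I X (X ⊕ Y)).run h x = pure (.inl x) := rfl

@[simp] theorem run_inr (y : Y) : (inr : Circuit I Y (X ⊕ Y)).run h y = pure (.inr y) := rfl

@[simp] theorem run_dist_inl (x : X) (z : Z) :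
    (dist : Circuit I ((X ⊕ Y) × Z) _).run h (.inl x, z) = pure (.inl (x, z)) := rfl

@[simp] theorem run_dist_inr (y : Y) (z : Z) :
    (dist : Circuit I ((X ⊕ Y) × Z) _).run h (.inr y, z) = pure (.inr (y, z)) := rfl

@[simp] theorem run_split (b : Bool) :
    (split : Circuit I _ _).run h b = pure (if b then .inl () else .inr ()) := rfl

@[simp] theorem run_bit (b : Bool) (x : X) : (bit b : Circuit I X _).run h x = pure b := rfl

@[simp] theorem run_drop (x : X) : (drop : Circuit I X _).run h x = pure () := rfl

end Run

/-- The fundamental lemma: executions in two monads are related by every relation that is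
compatible with the monad structure and relates the answers of the oracles. The relation is
indexed by a budget, of which a gate of the `i`-th oracle consumes `w i`. -/
theorem run_rel {M₁ M₂ : Type → Type} [Monad M₁] [MonadLiftT PMF M₁] [Monad M₂]
    [MonadLiftT PMF M₂] (h₁ : ∀ i, I.Query i → M₁ (I.Resp i)) (h₂ : ∀ i, I.Query i → M₂ (I.Resp i))
    (w : I.Idx → ℕ) (R : ℕ → ∀ Y : Type, M₁ Y → M₂ Y → Prop)
    (mono : ∀ {m n Y a b}, m ≤ n → R m Y a b → R n Y a b)
    (pure' : ∀ (Y : Type) (y : Y), R 0 Y (pure y) (pure y))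
    (bind' : ∀ {m n} {Y Z : Type} {a b} {f : Y → M₁ Z} {g : Y → M₂ Z}, R m Y a b →
      (∀ y, R n Z (f y) (g y)) → R (m + n) Z (a >>= f) (b >>= g))
    (lift' : ∀ (Y : Type) (e : PMF Y), R 0 Y (liftM e) (liftM e))
    (ask' : ∀ i q, R (w i) _ (h₁ i q) (h₂ i q)) :
    ∀ {X Y : Type} (A : Circuit I X Y) (x : X), R (A.gates w) Y (A.run h₁ x) (A.run h₂ x)
  | _, _, op f, x => lift' _ (f x)
  | _, _, ask i, x => ask' i x
  | _, _, seq A B, x => bind' (run_rel h₁ h₂ w R mono pure' bind' lift' ask' A x)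
      (run_rel h₁ h₂ w R mono pure' bind' lift' ask' B)
  | _, _, par A B, x => bind' (n := B.gates w) (run_rel h₁ h₂ w R mono pure' bind' lift' ask' A x.1)
      (fun y => bind' (n := 0) (run_rel h₁ h₂ w R mono pure' bind' lift' ask' B x.2)
        (fun y' => pure' _ (y, y')))
  -- `gates` charges both branches, while only one is executed; this is what monotonicity in the
  -- budget is for.
  | _, _, case A _, .inl x => mono (Nat.le_add_right _ _)
      (run_rel h₁ h₂ w R mono pure' bind' lift' ask' A x)
  | _, _, case _ B, .inr x => mono (Nat.le_add_left _ _)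
      (run_rel h₁ h₂ w R mono pure' bind' lift' ask' B x)
  | _, _, id, x => pure' _ x
  | _, _, dup, _ => pure' _ _
  | _, _, fst, _ => pure' _ _
  | _, _, snd, _ => pure' _ _
  | _, _, inl, _ => pure' _ _
  | _, _, inr, _ => pure' _ _
  | _, _, dist, (.inl _, _) => pure' _ _
  | _, _, dist, (.inr _, _) => pure' _ _
  | _, _, split, _ => pure' _ _
  | _, _, bit b, _ => pure' _ b
  | _, _, drop, _ => pure' _ ()

/-- `run_rel` for a relation without budget. -/
theorem run_rel₀ {M₁ M₂ : Type → Type} [Monad M₁] [MonadLiftT PMF M₁] [Monad M₂]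
    [MonadLiftT PMF M₂] (h₁ : ∀ i, I.Query i → M₁ (I.Resp i)) (h₂ : ∀ i, I.Query i → M₂ (I.Resp i))
    (R : ∀ Y : Type, M₁ Y → M₂ Y → Prop)
    (pure' : ∀ (Y : Type) (y : Y), R Y (pure y) (pure y))
    (bind' : ∀ {Y Z : Type} {a b} {f : Y → M₁ Z} {g : Y → M₂ Z}, R Y a b →
      (∀ y, R Z (f y) (g y)) → R Z (a >>= f) (b >>= g))
    (lift' : ∀ (Y : Type) (e : PMF Y), R Y (liftM e) (liftM e))
    (ask' : ∀ i q, R _ (h₁ i q) (h₂ i q))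
    {X Y : Type} (A : Circuit I X Y) (x : X) : R Y (A.run h₁ x) (A.run h₂ x) :=
  run_rel h₁ h₂ (fun _ => 0) (fun _ => R) (fun _ h => h) pure' (fun h h' => bind' h h') lift' ask'
    A x

/-! ### Wiring combinators -/

section Wiring

variable {X Y Z Γ X₁ X₂ X₃ : Type}

/-- Both results of two circuits with the same input. -/
def pair (A : Circuit I Γ X) (B : Circuit I Γ Y) : Circuit I Γ (X × Y) := seq dup (par A B)

/-- Extend the context by the result of `A`, and continue with `B`. -/
def lett (A : Circuit I Γ X) (B : Circuit I (Γ × X) Y) : Circuit I Γ Y := seq (pair id A) B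

/-- Branching on a bit. -/
def ite (C : Circuit I Γ Bool) (A B : Circuit I Γ Y) : Circuit I Γ Y :=
  seq (pair (seq C split) id) (seq dist (case (seq snd A) (seq snd B)))

/-- Branching on success or failure. -/
def opt (C : Circuit I Γ (Opt X)) (A : Circuit I (Γ × X) Y) (B : Circuit I Γ Y) :
    Circuit I Γ Y :=
  seq (pair C id) (seq dist (case (seq (pair snd fst) A) (seq snd B)))

/-- Apply an operation to one argument. -/
def ap (f : X → PMF Y) (A : Circuit I Γ X) : Circuit I Γ Y := seq A (op f)

/-- Failure. -/
def fail : Circuit I Γ (Opt X) := seq drop inr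

variable {M : Type → Type} [Monad M] [MonadLiftT PMF M] (h : ∀ i, I.Query i → M (I.Resp i))

@[simp] theorem run_ap (f : X → PMF Y) (A : Circuit I Γ X) (x : Γ) :
    (ap f A).run h x = A.run h x >>= fun y => liftM (f y) := rfl

theorem liftM_pmf_pure [LawfulMonadLiftT PMF M] (x : X) :
    (liftM (PMF.pure x) : M X) = pure x :=
  monadLift_pure (m := PMF) (n := M) x

@[simp] theorem liftM_det [LawfulMonadLiftT PMF M] (f : X → Y) (x : X) :
    (liftM (det f x) : M Y) = pure (f x) := liftM_pmf_pure _

variable [LawfulMonad M]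

@[simp] theorem run_pair (A : Circuit I Γ X) (B : Circuit I Γ Y) (x : Γ) :
    (pair A B).run h x = A.run h x >>= fun y => B.run h x >>= fun y' => pure (y, y') := by
  simp [pair]

@[simp] theorem run_lett (A : Circuit I Γ X) (B : Circuit I (Γ × X) Y) (x : Γ) :
    (lett A B).run h x = A.run h x >>= fun y => B.run h (x, y) := by
  simp [lett]

@[simp] theorem run_ite (C : Circuit I Γ Bool) (A B : Circuit I Γ Y) (x : Γ) :
    (ite C A B).run h x = C.run h x >>= fun b => if b then A.run h x else B.run h x := by
  simp only [ite, run_seq, run_pair, run_split, run_id, bind_assoc, pure_bind]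
  congr 1; funext b; cases b <;> simp

@[simp] theorem run_opt (C : Circuit I Γ (Opt X)) (A : Circuit I (Γ × X) Y) (B : Circuit I Γ Y)
    (x : Γ) : (opt C A B).run h x = C.run h x >>= fun o =>
      match o with
      | .inl y => A.run h (x, y)
      | .inr () => B.run h x := by
  simp only [opt, run_seq, run_pair, run_id, bind_assoc, pure_bind]
  congr 1; funext o; rcases o with y | ⟨⟩ <;> simp

@[simp] theorem run_fail (x : Γ) :
    (fail : Circuit I Γ (Opt X)).run h x = pure (.inr ()) := by simp [fail]

end Wiring

/-! ### Replacing oracle gates by circuits -/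

/-- Replace the oracle gates by circuits. -/
def relabel (H : ∀ i, Circuit J (I.Query i) (I.Resp i)) :
    ∀ {X Y : Type}, Circuit I X Y → Circuit J X Y
  | _, _, op f => op f
  | _, _, ask i => H i
  | _, _, seq A B => seq (A.relabel H) (B.relabel H)
  | _, _, par A B => par (A.relabel H) (B.relabel H)
  | _, _, case A B => case (A.relabel H) (B.relabel H)
  | _, _, id => id
  | _, _, dup => dup
  | _, _, fst => fst
  | _, _, snd => snd
  | _, _, inl => inl
  | _, _, inr => inr
  | _, _, dist => dist
  | _, _, split => split
  | _, _, bit b => bit b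
  | _, _, drop => drop

/-- Replace the oracle gates by circuits that share a state. -/
def subst {St : Type} (H : ∀ i, Circuit J (I.Query i × St) (I.Resp i × St)) :
    ∀ {X Y : Type}, Circuit I X Y → Circuit J (X × St) (Y × St)
  | _, _, op f => par (op f) id
  | _, _, ask i => H i
  | _, _, seq A B => seq (A.subst H) (B.subst H)
  -- The state passes through `A` and then through `B`, in the order in which `run` executes `par`.
  | _, _, par A B =>
      seq (pair (seq (pair (seq fst fst) snd) (A.subst H)) (seq fst snd))
        (seq (pair (seq fst fst) (seq (pair snd (seq fst snd)) (B.subst H)))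
          (pair (pair fst (seq snd fst)) (seq snd snd)))
  | _, _, case A B => seq dist (case (A.subst H) (B.subst H))
  | _, _, id => id
  | _, _, dup => par dup id
  | _, _, fst => par fst id
  | _, _, snd => par snd id
  | _, _, inl => par inl id
  | _, _, inr => par inr id
  | _, _, dist => par dist id
  | _, _, split => par split id
  | _, _, bit b => par (bit b) id
  | _, _, drop => par drop id

section Replace

variable {M : Type → Type} [Monad M] [MonadLiftT PMF M] (h : ∀ i, J.Query i → M (J.Resp i))

theorem run_relabel (H : ∀ i, Circuit J (I.Query i) (I.Resp i)) {X Y : Type}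
    (A : Circuit I X Y) (x : X) :
    (A.relabel H).run h x = A.run (fun i q => (H i).run h q) x := by
  induction A with
  | op | ask | id | dup | fst | snd | inl | inr | split | bit | drop => rfl
  | dist => rcases x with ⟨x | x, z⟩ <;> rfl
  | seq A B ihA ihB => simp [relabel, ihA, ihB]
  | par A B ihA ihB => simp [relabel, ihA, ihB]
  | case A B ihA ihB => rcases x with x | x <;> simp [relabel, ihA, ihB]

/-- An extra wire plays the part of `StateT`. Stateful oracles, such as the users' sessions or the
simulator, can therefore be implemented inside a circuit whose own oracles know nothing of that
state. -/
theorem run_subst [LawfulMonad M] {St : Type}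
    (H : ∀ i, Circuit J (I.Query i × St) (I.Resp i × St)) {X Y : Type}
    (A : Circuit I X Y) (x : X) (s : St) :
    (A.subst H).run h (x, s) =
      A.run (M := StateT St M) (fun i q => fun s => (H i).run h (q, s)) x s := by
  induction A generalizing s with
  | op f =>
    simp only [subst, run_par, run_op, run_id, pure_bind]
    rfl
  | ask => rfl
  | id | dup | fst | snd | inl | inr | split | bit | drop =>
    simp only [subst, run_par, run_id, run_dup, run_fst, run_snd, run_inl, run_inr, run_split,
      run_bit, run_drop, pure_bind]
    rfl
  | dist =>
    rcases x with ⟨x | x, z⟩ <;> simp only [subst, run_par, run_id, run_dist_inl, run_dist_inr,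
      pure_bind] <;> rfl
  | seq A B ihA ihB =>
    simp only [subst, run_seq, ihA]
    exact bind_congr fun r => ihB _ _
  | par A B ihA ihB =>
    simp only [subst, run_seq, run_pair, run_fst, run_snd, bind_assoc, pure_bind, ihA, ihB]
    rfl
  | case A B ihA ihB =>
    rcases x with x | x <;> simp [subst, ihA, ihB]

end Replace

/-! ### Size and time -/

section Size

variable {X Y Z Γ : Type}

/-- Number of operations and branchings. -/
def size : ∀ {X Y : Type}, Circuit I X Y → ℕ
  | _, _, op _ => 1
  | _, _, seq A B => A.size + B.size
  | _, _, par A B => A.size + B.size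
  | _, _, case A B => A.size + B.size + 1
  | _, _, _ => 0

/-- All operations satisfy `P`. -/
def AllOps (P : ∀ X Y : Type, (X → PMF Y) → Prop) : ∀ {X Y : Type}, Circuit I X Y → Prop
  | _, _, op f => P _ _ f
  | _, _, seq A B => A.AllOps P ∧ B.AllOps P
  | _, _, par A B => A.AllOps P ∧ B.AllOps P
  | _, _, case A B => A.AllOps P ∧ B.AllOps P
  | _, _, _ => True

/-- A branching costs one unit, so `1 ≤ T` lets it be charged like an operation. -/
theorem time_le_size {c : CostModel} {P : ∀ X Y : Type, (X → PMF Y) → Prop} {T : ℕ∞}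
    (hT : 1 ≤ T) (hP : ∀ (X Y : Type) (f : X → PMF Y), P X Y f → c X Y f ≤ T) (A : Circuit I X Y)
    (hA : A.AllOps P) : A.time c ≤ A.size * T := by
  induction A with
  | op f => simpa [time, size] using hP _ _ f hA
  | ask | id | dup | fst | snd | inl | inr | dist | split | bit | drop => simp [time, size]
  | seq A B ihA ihB | par A B ihA ihB =>
    refine (add_le_add (ihA hA.1) (ihB hA.2)).trans (le_of_eq ?_)
    simp only [size]; push_cast; ring
  | case A B ihA ihB =>
    refine (add_le_add (add_le_add (ihA hA.1) (ihB hA.2)) hT).trans (le_of_eq ?_)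
    simp only [size]; push_cast; ring

theorem gates_const (n : ℕ) (A : Circuit I X Y) : A.gates (fun _ => n) = A.queries * n := by
  unfold queries
  induction A with
  | ask i => simp [gates]
  | seq A B ihA ihB | par A B ihA ihB | case A B ihA ihB => simp only [gates, ihA, ihB]; ring
  | _ => simp [gates]

/-- Oracle gates and wiring are free, so only the inserted circuits add to the time. -/
theorem time_relabel_le {c : CostModel} {T : ℕ∞} (H : ∀ i, Circuit J (I.Query i) (I.Resp i))
    (hH : ∀ i, (H i).time c ≤ T) (A : Circuit I X Y) :
    (A.relabel H).time c ≤ A.time c + A.queries * T := by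
  unfold queries
  induction A with
  | ask i => simpa [relabel, time, gates] using hH i
  | seq A B ihA ihB | par A B ihA ihB =>
    simp only [relabel, time, gates]
    refine (add_le_add ihA ihB).trans (le_of_eq ?_)
    push_cast; ring
  | case A B ihA ihB =>
    simp only [relabel, time, gates]
    refine (add_le_add_left (add_le_add ihA ihB) 1).trans (le_of_eq ?_)
    push_cast; ring
  | _ => simp [relabel, time, gates]

theorem gates_relabel_le {v : J.Idx → ℕ} {w : I.Idx → ℕ}
    (H : ∀ i, Circuit J (I.Query i) (I.Resp i)) (hH : ∀ i, (H i).gates v ≤ w i)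
    (A : Circuit I X Y) : (A.relabel H).gates v ≤ A.gates w := by
  induction A with
  | ask i => exact hH i
  | seq A B ihA ihB | par A B ihA ihB | case A B ihA ihB => exact add_le_add ihA ihB
  | _ => simp [relabel, gates]

theorem time_subst_le {c : CostModel} {T : ℕ∞} {St : Type}
    (H : ∀ i, Circuit J (I.Query i × St) (I.Resp i × St))
    (hH : ∀ i, (H i).time c ≤ T) (A : Circuit I X Y) :
    (A.subst H).time c ≤ A.time c + A.queries * T := by
  unfold queries
  induction A with
  | ask i => simpa [subst, time, gates] using hH i
  | seq A B ihA ihB | par A B ihA ihB =>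
    simp only [subst, pair, time, gates, zero_add, add_zero]
    refine (add_le_add ihA ihB).trans (le_of_eq ?_)
    push_cast; ring
  | case A B ihA ihB =>
    simp only [subst, time, gates, zero_add]
    refine (add_le_add_left (add_le_add ihA ihB) 1).trans (le_of_eq ?_)
    push_cast; ring
  | _ => simp [subst, time, gates]

theorem gates_subst_le {v : J.Idx → ℕ} {w : I.Idx → ℕ} {St : Type}
    (H : ∀ i, Circuit J (I.Query i × St) (I.Resp i × St)) (hH : ∀ i, (H i).gates v ≤ w i)
    (A : Circuit I X Y) : (A.subst H).gates v ≤ A.gates w := by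
  induction A with
  | ask i => exact hH i
  | seq A B ihA ihB | par A B ihA ihB | case A B ihA ihB =>
    simpa [subst, pair, gates] using add_le_add ihA ihB
  | _ => simp [subst, gates]

end Size

end Circuit

namespace Scheme

variable {p lam : ℕ} [Fact p.Prime] {G : Type} [CommGroup G]

/-! ### The game relative to an abstract proof system and an abstract pseudorandom function -/

inductive GameOracle
  | hash
  | prove
  | verify
  | prf

/-- Interface through which the experiment uses the random oracle, the proof system and the
users' pseudorandom functions. -/
def gameIface (S : Scheme p lam G) : Iface where
  Idx := GameOracle
  Query
    | .hash => List Bool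
    | .prove => Stmt p G S.zsgn.PK × Wit p S.zsgn.Sig
    | .verify => Stmt p G S.zsgn.PK × S.nizk.Proof
    | .prf => ZMod p × ZMod p
  Resp
    | .hash => Bits lam
    | .prove => S.nizk.Proof
    | .verify => Bool
    | .prf => G

/-- An implementation of the oracles of `gameIface` in a monad. -/
structure Oracles (S : Scheme p lam G) (M : Type → Type) where
  hash : List Bool → M (Bits lam)
  prove : Stmt p G S.zsgn.PK × Wit p S.zsgn.Sig → M S.nizk.Proof
  verify : Stmt p G S.zsgn.PK × S.nizk.Proof → M Bool
  prf : ZMod p × ZMod p → M G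

def Oracles.handler {S : Scheme p lam G} {M : Type → Type} (O : S.Oracles M) :
    ∀ i, S.gameIface.Query i → M (S.gameIface.Resp i)
  | .hash, x => O.hash x
  | .prove, x => O.prove x
  | .verify, x => O.verify x
  | .prf, x => O.prf x

section Programs

variable (S : Scheme p lam G) {M : Type → Type} [Monad M] [MonadLiftT PMF M] (O : S.Oracles M)

/-- This and the following programs repeat the procedures of the scheme over abstract oracles in an
arbitrary monad, so that all hybrid games are instances of one program. -/
def withdrawG (B : S.BankKeys) (usr : S.UserKeys) : M (G × ZMod p × S.nizk.Proof) := do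
  let r ← (liftM (scalar p) : M (ZMod p))
  let π ← O.prove (.sig B.2.2.1.1 (comm S.pp (usr.1, usr.2.1) r),
    .sig (usr.1, usr.2.1) r usr.2.2.1)
  pure (comm S.pp (usr.1, usr.2.1) r, r, π)

/-- The tokens `X`, `Y` keep the concrete function: of the user they involve only `P`, so they need
no replacement. Only the user's token in `spendG` goes through `O.prf`. -/
def issueG (B : S.BankKeys) (atm : S.ATMKeys) (coin : S.StoredCoin) (P : G)
    (πsk : S.nizk.Proof) : M (Opt (S.Coin × S.Voucher)) := do
  let ok ← O.verify (.sig B.2.2.1.1 P, πsk)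
  if ok then do
    let X := dyPRF S.pp coin.1.1 (S.hashCom P + 1)
    let Y := gpow S.pp.g atm.1 * gpow (dyPRF S.pp coin.2.1.1 0) (S.hashCom P)
    let πatm ← O.prove (.sig B.2.2.2.1 coin.2.2.2.2.2.1, .sig (atm.1, 0) coin.2.2.1 atm.2.1)
    let πid ← O.prove
      (.voucher coin.2.2.2.1 coin.2.2.2.2.1 X Y coin.2.2.2.2.2.1 (S.hashCom P + 1) (S.hashCom P),
        .voucher coin.1.1 coin.1.2 coin.2.1.1 coin.2.1.2 atm.1 coin.2.2.1)
    pure (.inl (coin.2.2.2, (P, πsk, X, Y, πid, πatm, S.hashCom P)))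
  else pure (.inr ())

open Classical in
def linkedG (B : S.BankKeys) (C : S.Coin) (V : S.Voucher) : M Bool := do
  let b₁ ← O.verify (.sig B.2.2.1.1 V.1, V.2.1)
  let b₂ ← O.verify (.sig B.2.2.2.1 C.2.2.1, V.2.2.2.2.2.1)
  let b₃ ← O.verify
    (.voucher C.1 C.2.1 V.2.2.1 V.2.2.2.1 C.2.2.1 (V.2.2.2.2.2.2 + 1) V.2.2.2.2.2.2, V.2.2.2.2.1)
  pure (decide (V.2.2.2.2.2.2 = S.hashCom V.1) && b₁ && b₂ &&
    S.bsgn.verify (B.2.1.1, S.hashCoin (C.1, C.2.1, C.2.2.1), C.2.2.2) && b₃)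

def spendG (usr : S.UserKeys) (P : G) (r rc : ZMod p) (pkm : G) (rv : Bits lam) : M S.Tx := do
  let y ← O.prf (usr.2.1, rc + 1)
  let Z := gpow S.pp.g usr.1 * gpow y (S.hashTx (pkm, rv))
  let π ← O.prove (.spend P Z (rc + 1) (S.hashTx (pkm, rv)), .spend usr.1 r usr.2.1)
  pure (Z, π, rv, S.hashTx (pkm, rv))

def withdrawOracleG {η γ : ℕ} (ηH : ℕ) (K : S.Keys η γ) (i : Fin η) :
    StateT (List (Session p η G)) M (Opt (G × G × S.nizk.Proof)) :=
  if i.val < ηH then do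
    let x ← (liftM (S.withdrawG O K.1 (K.2.2 i)) :
      StateT (List (Session p η G)) M (G × ZMod p × S.nizk.Proof))
    modify (fun l => l ++ [(i, x.1, x.2.1, false)])
    pure (.inl (gpow S.pp.g (K.2.2 i).1, x.1, x.2.2))
  else pure (.inr ())

open Classical in
def spendOracleG {η γ : ℕ} (K : S.Keys η γ) (x : ℕ × S.Coin × S.Voucher × G × Bits lam) :
    StateT (List (Session p η G)) M (Opt S.Tx) := do
  let l ← get
  match l[x.1]? with
  | none => pure (.inr ())
  | some (i, P, r, spent) => do
      let ok ← (liftM (S.linkedG O K.1 x.2.1 x.2.2.1) : StateT (List (Session p η G)) M Bool)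
      if ok = true ∧ x.2.2.1.1 = P ∧ spent = false then do
        let T ← (liftM (S.spendG O (K.2.2 i) P r x.2.2.1.2.2.2.2.2.2 x.2.2.2.1 x.2.2.2.2) :
          StateT (List (Session p η G)) M S.Tx)
        set (l.set x.1 (i, P, r, true))
        pure (.inl T)
      else pure (.inr ())

def oracleG {η γ : ℕ} (ηH : ℕ) (K : S.Keys η γ) :
    ∀ i, (S.anonIface η).Query i → StateT (List (Session p η G)) M ((S.anonIface η).Resp i)
  | .hash, x => (liftM (O.hash x) : StateT (List (Session p η G)) M (Bits lam))
  | .withdraw, i => S.withdrawOracleG O ηH K i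
  | .spend, x => S.spendOracleG O K x

def challengeG {η γ : ℕ} (K : S.Keys η γ) (i : Fin η) (j : Fin γ) (m : Fin η) :
    M (Opt (S.Coin × S.Voucher × S.Tx)) := do
  let x ← S.withdrawG O K.1 (K.2.2 i)
  let coin ← (liftM (S.reqCoin (K.1, K.2.1 j)) : M S.StoredCoin)
  let CV ← S.issueG O K.1 (K.2.1 j) coin x.1 x.2.2
  match CV with
  | .inr () => pure (.inr ())
  | .inl (C, V) => do
      let ok ← S.linkedG O K.1 C V
      if ok then do
        let rv ← (liftM (PMF.uniformOfFintype (Bits lam)) : M (Bits lam))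
        let T ← S.spendG O (K.2.2 i) x.1 x.2.1 V.2.2.2.2.2.2 (gpow S.pp.g (K.2.2 m).1) rv
        pure (.inl (C, V, T))
      else pure (.inr ())

def gameG {η γ : ℕ} (ηH : ℕ) (b : Bool) (A : S.AnonAdversary η γ) (K : S.Keys η γ) :
    StateT (List (Session p η G)) M Bool := do
  let (i₀, i₁, j, m, φ) ← A.A₁.run (S.oracleG O ηH K) (S.advInput ηH K)
  if i₀.val < ηH ∧ i₁.val < ηH ∧ i₀ ≠ i₁ then
    let CVT ← (liftM (S.challengeG O K (if b then i₁ else i₀) j m) :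
      StateT (List (Session p η G)) M (Opt (S.Coin × S.Voucher × S.Tx)))
    match CVT with
    | .inr () => pure false
    | .inl (C, V, T) => A.A₂.run (S.oracleG O ηH K) (C, V, T, K.1, φ)
  else
    pure false

def expG {η γ : ℕ} (ηH : ℕ) (b : Bool) (A : S.AnonAdversary η γ) : M Bool := do
  let K ← (liftM (S.setup η γ) : M (S.Keys η γ))
  let r ← S.gameG O ηH b A K []
  pure r.1

end Programs

/-- The oracles of the real experiment. -/
def realOracles (S : Scheme p lam G) : S.Oracles (RO lam) where
  hash := hashRO
  prove := runRO S.nizk.prove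
  verify := runRO S.nizk.verify
  prf x := pure (dyPRF S.pp x.1 x.2)

/-- The programs agree by unfolding, except that evaluating the user's function has become a monadic
call, which for `realOracles` is a `pure`. -/
theorem anonExp_eq (S : Scheme p lam G) {η γ : ℕ} (ηH : ℕ) (b : Bool) (A : S.AnonAdversary η γ) :
    S.anonExp ηH b A = (do
      let r ← S.expG S.realOracles ηH b A (emptyTable lam)
      pure r.1) := by
  have hsp : ∀ (usr : S.UserKeys) (P : G) (r rc : ZMod p) (pkm : G) (rv : Bits lam),
      S.spendCoin usr P r rc pkm rv = S.spendG S.realOracles usr P r rc pkm rv := by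
    intros
    simp only [spendG, realOracles, pure_bind]
    rfl
  have hch : ∀ (K : S.Keys η γ) i j m, S.challenge K i j m = S.challengeG S.realOracles K i j m := by
    intro K i j m
    unfold challengeG challenge
    simp only [← hsp]
    rfl
  have hor : ∀ K : S.Keys η γ, S.anonOracle ηH K = S.oracleG S.realOracles ηH K := by
    intro K
    funext i q
    cases i with
    | hash => rfl
    | withdraw => rfl
    | spend =>
      obtain ⟨s, C, V, pkm, rv⟩ := q
      simp only [anonOracle, oracleG, spendOracleG, ← hsp]
      rfl
  have hg : ∀ K : S.Keys η γ, S.anonGame ηH b A K = S.gameG S.realOracles ηH b A K := by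
    intro K
    unfold anonGame gameG
    simp only [hch, hor]
  unfold anonExp
  simp only [hg]
  unfold expG
  change _ = ((S.setup η γ >>= fun a => pure (a, emptyTable lam)) >>= fun a =>
      (S.gameG S.realOracles ηH b A a.1 [] a.2 >>= fun r => pure (r.1.1, r.2))) >>= fun r => pure r.1
  simp

open Circuit

/-! ### The circuit of the game -/

local infixr:80 " ⊳ " => Circuit.seq

section Circuits

variable (S : Scheme p lam G) {Γ : Type}

def askHash : Circuit S.gameIface (List Bool) (Bits lam) := ask (I := S.gameIface) GameOracle.hash

def askProve : Circuit S.gameIface (Stmt p G S.zsgn.PK × Wit p S.zsgn.Sig) S.nizk.Proof :=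
  ask (I := S.gameIface) GameOracle.prove

def askVerify : Circuit S.gameIface (Stmt p G S.zsgn.PK × S.nizk.Proof) Bool :=
  ask (I := S.gameIface) GameOracle.verify

def askPrf : Circuit S.gameIface (ZMod p × ZMod p) G := ask (I := S.gameIface) GameOracle.prf

abbrev opMul (G : Type) [CommGroup G] := det fun x : G × G => x.1 * x.2
abbrev opPow (p : ℕ) (G : Type) [CommGroup G] := det fun x : G × ZMod p => gpow x.1 x.2
abbrev opAdd (p : ℕ) := det fun x : ZMod p × ZMod p => x.1 + x.2
abbrev opZero (p : ℕ) := det fun _ : Unit => (0 : ZMod p)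
abbrev opOne (p : ℕ) := det fun _ : Unit => (1 : ZMod p)
abbrev opGen := det fun _ : Unit => S.pp.g
abbrev opCommit := det fun x : (ZMod p × ZMod p) × ZMod p => comm S.pp x.1 x.2
abbrev opPrf := det fun x : ZMod p × ZMod p => dyPRF S.pp x.1 x.2
open Classical in
abbrev opEqGroup (G : Type) := det fun x : G × G => decide (x.1 = x.2)
open Classical in
abbrev opEqScalar (p : ℕ) := det fun x : ZMod p × ZMod p => decide (x.1 = x.2)
open Classical in
abbrev opEqUser (η : ℕ) := det fun x : Fin η × Fin η => decide (x.1 = x.2)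
open Classical in
abbrev opHonest (η ηH : ℕ) := det fun i : Fin η => decide (i.val < ηH)
abbrev opStmtSig := det fun x : S.zsgn.PK × G => (Stmt.sig x.1 x.2 : Stmt p G S.zsgn.PK)
abbrev opStmtVoucher := det fun x : G × G × G × G × G × ZMod p × ZMod p =>
  (Stmt.voucher x.1 x.2.1 x.2.2.1 x.2.2.2.1 x.2.2.2.2.1 x.2.2.2.2.2.1 x.2.2.2.2.2.2 :
    Stmt p G S.zsgn.PK)
abbrev opStmtSpend := det fun x : G × G × ZMod p × ZMod p =>
  (Stmt.spend x.1 x.2.1 x.2.2.1 x.2.2.2 : Stmt p G S.zsgn.PK)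
abbrev opWitSig := det fun x : (ZMod p × ZMod p) × ZMod p × S.zsgn.Sig =>
  (Wit.sig x.1 x.2.1 x.2.2 : Wit p S.zsgn.Sig)
abbrev opWitVoucher := det fun x : ZMod p × ZMod p × ZMod p × ZMod p × ZMod p × ZMod p =>
  (Wit.voucher x.1 x.2.1 x.2.2.1 x.2.2.2.1 x.2.2.2.2.1 x.2.2.2.2.2 : Wit p S.zsgn.Sig)
abbrev opWitSpend := det fun x : ZMod p × ZMod p × ZMod p =>
  (Wit.spend x.1 x.2.1 x.2.2 : Wit p S.zsgn.Sig)

/-- On input the bank's keys and the user's keys. -/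
def withdrawC : Circuit S.gameIface (S.BankKeys × S.UserKeys) (G × ZMod p × S.nizk.Proof) :=
  -- Each `lett` appends its result on the right of the context: `snd` reads the latest binding, and
  -- every `fst` steps back over one.
  lett (ap (fun _ : Unit => scalar p) drop) <|
  lett (ap S.opCommit (pair (pair (fst ⊳ snd ⊳ fst) (fst ⊳ snd ⊳ snd ⊳ fst)) snd)) <|
  lett (pair (ap S.opStmtSig (pair (fst ⊳ fst ⊳ fst ⊳ snd ⊳ snd ⊳ fst ⊳ fst) snd))
    (ap S.opWitSig (pair (pair (fst ⊳ fst ⊳ snd ⊳ fst) (fst ⊳ fst ⊳ snd ⊳ snd ⊳ fst))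
      (pair (fst ⊳ snd) (fst ⊳ fst ⊳ snd ⊳ snd ⊳ snd ⊳ fst)))) ⊳ S.askProve) <|
  pair (fst ⊳ snd) (pair (fst ⊳ fst ⊳ snd) snd)

/-- On input the bank's keys, the ATM's keys, the stored coin, and the user's commitment and
proof. -/
def issueC : Circuit S.gameIface
    (S.BankKeys × S.ATMKeys × S.StoredCoin × G × S.nizk.Proof) (Opt (S.Coin × S.Voucher)) :=
  ite (pair (ap S.opStmtSig (pair (fst ⊳ snd ⊳ snd ⊳ fst ⊳ fst)
      (snd ⊳ snd ⊳ snd ⊳ fst))) (snd ⊳ snd ⊳ snd ⊳ snd) ⊳ S.askVerify)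
    (lett (ap (det S.hashCom) (snd ⊳ snd ⊳ snd ⊳ fst)) <|
    lett (ap (opAdd p) (pair snd (ap (opOne p) drop))) <|
    lett (ap S.opPrf (pair (fst ⊳ fst ⊳ snd ⊳ snd ⊳ fst ⊳ fst ⊳ fst) snd)) <|
    lett (ap (opMul G) (pair
      (ap (opPow p G) (pair (ap S.opGen drop) (fst ⊳ fst ⊳ fst ⊳ snd ⊳ fst ⊳ fst)))
      (ap (opPow p G) (pair
        (ap S.opPrf (pair (fst ⊳ fst ⊳ fst ⊳ snd ⊳ snd ⊳ fst ⊳ snd ⊳ fst ⊳ fst)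
          (ap (opZero p) drop)))
        (fst ⊳ fst ⊳ snd))))) <|
    lett (pair
      (ap S.opStmtSig (pair
        (fst ⊳ fst ⊳ fst ⊳ fst ⊳ fst ⊳ snd ⊳ snd ⊳ snd ⊳ fst)
        (fst ⊳ fst ⊳ fst ⊳ fst ⊳ snd ⊳ snd ⊳ fst ⊳ snd ⊳ snd ⊳ snd ⊳ snd ⊳ snd ⊳ fst)))
      (ap S.opWitSig (pair
        (pair (fst ⊳ fst ⊳ fst ⊳ fst ⊳ snd ⊳ fst ⊳ fst) (ap (opZero p) drop))
        (pair (fst ⊳ fst ⊳ fst ⊳ fst ⊳ snd ⊳ snd ⊳ fst ⊳ snd ⊳ snd ⊳ fst)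
          (fst ⊳ fst ⊳ fst ⊳ fst ⊳ snd ⊳ fst ⊳ snd ⊳ fst)))) ⊳ S.askProve) <|
    lett (lett (fst ⊳ fst ⊳ fst ⊳ fst ⊳ fst ⊳ snd ⊳ snd ⊳ fst) <| pair
      (ap S.opStmtVoucher (pair (snd ⊳ snd ⊳ snd ⊳ snd ⊳ fst)
        (pair (snd ⊳ snd ⊳ snd ⊳ snd ⊳ snd ⊳ fst)
        (pair (fst ⊳ fst ⊳ fst ⊳ snd)
        (pair (fst ⊳ fst ⊳ snd)
        (pair (snd ⊳ snd ⊳ snd ⊳ snd ⊳ snd ⊳ snd ⊳ fst)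
        (pair (fst ⊳ fst ⊳ fst ⊳ fst ⊳ snd) (fst ⊳ fst ⊳ fst ⊳ fst ⊳ fst ⊳ snd))))))))
      (ap S.opWitVoucher (pair (snd ⊳ fst ⊳ fst)
        (pair (snd ⊳ fst ⊳ snd)
        (pair (snd ⊳ snd ⊳ fst ⊳ fst)
        (pair (snd ⊳ snd ⊳ fst ⊳ snd)
        (pair (fst ⊳ fst ⊳ fst ⊳ fst ⊳ fst ⊳ fst ⊳ snd ⊳ fst ⊳ fst)
          (snd ⊳ snd ⊳ snd ⊳ fst))))))) ⊳ S.askProve) <|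
    (pair
      (fst ⊳ fst ⊳ fst ⊳ fst ⊳ fst ⊳ fst ⊳ snd ⊳ snd ⊳ fst ⊳ snd ⊳ snd ⊳ snd)
      (pair (fst ⊳ fst ⊳ fst ⊳ fst ⊳ fst ⊳ fst ⊳ snd ⊳ snd ⊳ snd ⊳ fst)
      (pair (fst ⊳ fst ⊳ fst ⊳ fst ⊳ fst ⊳ fst ⊳ snd ⊳ snd ⊳ snd ⊳ snd)
      (pair (fst ⊳ fst ⊳ fst ⊳ snd)
      (pair (fst ⊳ fst ⊳ snd)
      (pair snd (pair (fst ⊳ snd) (fst ⊳ fst ⊳ fst ⊳ fst ⊳ fst ⊳ snd))))))) ⊳ Circuit.inl))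
    fail

/-- On input the bank's keys, a coin and a voucher. -/
def linkedC : Circuit S.gameIface (S.BankKeys × S.Coin × S.Voucher) Bool :=
  lett (pair (ap S.opStmtSig (pair (fst ⊳ snd ⊳ snd ⊳ fst ⊳ fst) (snd ⊳ snd ⊳ fst)))
    (snd ⊳ snd ⊳ snd ⊳ fst) ⊳ S.askVerify) <|
  lett (fst ⊳ pair (ap S.opStmtSig (pair (fst ⊳ snd ⊳ snd ⊳ snd ⊳ fst)
    (snd ⊳ fst ⊳ snd ⊳ snd ⊳ fst)))
    (snd ⊳ snd ⊳ snd ⊳ snd ⊳ snd ⊳ snd ⊳ snd ⊳ fst) ⊳ S.askVerify) <|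
  lett (fst ⊳ fst ⊳ snd ⊳ pair (ap S.opStmtVoucher
      (pair (fst ⊳ fst) (pair (fst ⊳ snd ⊳ fst)
      (pair (snd ⊳ snd ⊳ snd ⊳ fst)
      (pair (snd ⊳ snd ⊳ snd ⊳ snd ⊳ fst)
      (pair (fst ⊳ snd ⊳ snd ⊳ fst)
      (pair (ap (opAdd p) (pair (snd ⊳ snd ⊳ snd ⊳ snd ⊳ snd ⊳ snd ⊳ snd)
        (ap (opOne p) drop)))
        (snd ⊳ snd ⊳ snd ⊳ snd ⊳ snd ⊳ snd ⊳ snd))))))))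
    (snd ⊳ snd ⊳ snd ⊳ snd ⊳ snd ⊳ fst) ⊳ S.askVerify) <|
  ite (fst ⊳ fst ⊳ fst ⊳ snd ⊳ snd ⊳ ap (opEqScalar p)
      (pair (snd ⊳ snd ⊳ snd ⊳ snd ⊳ snd ⊳ snd) (ap (det S.hashCom) fst)))
    (ite (fst ⊳ fst ⊳ snd)
      (ite (fst ⊳ snd)
        (ite (fst ⊳ fst ⊳ fst ⊳ ap (det S.bsgn.verify) (pair (fst ⊳ snd ⊳ fst ⊳ fst)
            (pair (snd ⊳ fst ⊳ ap (det S.hashCoin)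
              (pair fst (pair (snd ⊳ fst) (snd ⊳ snd ⊳ fst)))) (snd ⊳ fst ⊳ snd ⊳ snd ⊳ snd))))
          snd (bit false)) (bit false)) (bit false)) (bit false)

/-- On input the user's keys, the commitment, its randomness, the voucher randomness, the merchant's
public key and the transaction randomness. -/
def spendC : Circuit S.gameIface (S.UserKeys × G × ZMod p × ZMod p × G × Bits lam) S.Tx :=
  lett (ap (det S.hashTx) (snd ⊳ snd ⊳ snd ⊳ snd)) <|
  lett (ap (opAdd p) (pair (fst ⊳ snd ⊳ snd ⊳ snd ⊳ fst) (ap (opOne p) drop))) <|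
  lett (pair (fst ⊳ fst ⊳ fst ⊳ snd ⊳ fst) snd ⊳ S.askPrf) <|
  lett (ap (opMul G) (pair
    (ap (opPow p G) (pair (ap S.opGen drop) (fst ⊳ fst ⊳ fst ⊳ fst ⊳ fst)))
    (ap (opPow p G) (pair snd (fst ⊳ fst ⊳ snd))))) <|
  lett (pair
    (ap S.opStmtSpend (pair (fst ⊳ fst ⊳ fst ⊳ fst ⊳ snd ⊳ fst) (pair snd
      (pair (fst ⊳ fst ⊳ snd) (fst ⊳ fst ⊳ fst ⊳ snd)))))
    (ap S.opWitSpend (pair (fst ⊳ fst ⊳ fst ⊳ fst ⊳ fst ⊳ fst)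
      (pair (fst ⊳ fst ⊳ fst ⊳ fst ⊳ snd ⊳ snd ⊳ fst)
        (fst ⊳ fst ⊳ fst ⊳ fst ⊳ fst ⊳ snd ⊳ fst)))) ⊳ S.askProve) <|
  pair (fst ⊳ snd) (pair snd (pair (fst ⊳ fst ⊳ fst ⊳ fst ⊳ fst ⊳ snd ⊳ snd ⊳ snd ⊳ snd ⊳ snd)
    (fst ⊳ fst ⊳ fst ⊳ fst ⊳ snd)))

variable {M : Type → Type} [Monad M] [MonadLiftT PMF M] (O : S.Oracles M)

@[simp] theorem run_askHash (x) : S.askHash.run O.handler x = O.hash x := rfl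
@[simp] theorem run_askProve (x) : S.askProve.run O.handler x = O.prove x := rfl
@[simp] theorem run_askVerify (x) : S.askVerify.run O.handler x = O.verify x := rfl
@[simp] theorem run_askPrf (x) : S.askPrf.run O.handler x = O.prf x := rfl

variable [LawfulMonad M] [LawfulMonadLiftT PMF M]

theorem run_withdrawC (x) : S.withdrawC.run O.handler x = S.withdrawG O x.1 x.2 := by
  simp [withdrawC, withdrawG]

theorem run_issueC (x) :
    S.issueC.run O.handler x = S.issueG O x.1 x.2.1 x.2.2.1 x.2.2.2.1 x.2.2.2.2 := by
  simp [issueC, issueG]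

theorem run_linkedC (x) : S.linkedC.run O.handler x = S.linkedG O x.1 x.2.1 x.2.2 := by
  simp only [linkedC, linkedG, run_lett, run_pair, run_seq, run_ap, run_fst, run_snd, liftM_det,
    pure_bind, run_askVerify, run_drop, run_ite, run_bit]
  congr 1; funext b₁
  congr 1; funext b₂
  congr 1; funext b₃
  -- All three verifications are queried before any branching, so only a Boolean identity is left.
  rw [← apply_ite pure, ← apply_ite pure, ← apply_ite pure, ← apply_ite pure]
  congr 1
  cases b₁ <;> cases b₂ <;> cases b₃ <;> simp

theorem run_spendC (x) : S.spendC.run O.handler x =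
    S.spendG O x.1 x.2.1 x.2.2.1 x.2.2.2.1 x.2.2.2.2.1 x.2.2.2.2.2 := by
  simp [spendC, spendG]

end Circuits

/-! ### The adversary's oracles, the challenge and the whole game as circuits -/

section OracleCircuits

variable (S : Scheme p lam G) {η γ : ℕ} (ηH : ℕ)

/-- The state of the oracles: the keys and the list of withdrawals. -/
abbrev GameState (S : Scheme p lam G) (η γ : ℕ) : Type := S.Keys η γ × List (Session p η G)

def withdrawOracleC : Circuit S.gameIface (Fin η × S.GameState η γ)
    (Opt (G × G × S.nizk.Proof) × S.GameState η γ) :=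
  ite (ap (opHonest η ηH) fst)
    (lett (ap (det fun x : (Fin η → S.UserKeys) × Fin η => x.1 x.2)
      (pair (snd ⊳ fst ⊳ snd ⊳ snd) fst)) <|
    lett (pair (fst ⊳ snd ⊳ fst ⊳ fst) snd ⊳ S.withdrawC) <|
    pair (pair (ap (opPow p G) (pair (ap S.opGen drop) (fst ⊳ snd ⊳ fst)))
        (pair (snd ⊳ fst) (snd ⊳ snd ⊳ snd)) ⊳ Circuit.inl)
      (pair (fst ⊳ fst ⊳ snd ⊳ fst)
        (ap (det fun x : List (Session p η G) × Session p η G => x.1 ++ [x.2])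
          (pair (fst ⊳ fst ⊳ snd ⊳ snd) (pair (fst ⊳ fst ⊳ fst)
            (pair (snd ⊳ fst) (pair (snd ⊳ snd ⊳ fst) (bit false))))))))
    (pair fail snd)

abbrev opGetSession (p η : ℕ) (G : Type) := det fun x : List (Session p η G) × ℕ =>
  (match x.1[x.2]? with
    | none => .inr ()
    | some s => .inl s : Opt (Session p η G))

def spendOracleC : Circuit S.gameIface
    ((ℕ × S.Coin × S.Voucher × G × Bits lam) × S.GameState η γ)
    (Opt S.Tx × S.GameState η γ) :=
  opt (ap (opGetSession p η G) (pair (snd ⊳ snd) (fst ⊳ fst)))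
    (lett (pair (fst ⊳ snd ⊳ fst ⊳ fst) (fst ⊳ fst ⊳ snd ⊳ pair fst (snd ⊳ fst)) ⊳ S.linkedC) <|
    ite (ite snd (ite (ap (opEqGroup G) (pair (fst ⊳ fst ⊳ fst ⊳ snd ⊳ snd ⊳ fst ⊳ fst)
          (fst ⊳ snd ⊳ snd ⊳ fst)))
        (ite (fst ⊳ snd ⊳ snd ⊳ snd ⊳ snd) (bit false) (bit true)) (bit false)) (bit false))
      (lett (ap (det fun x : (Fin η → S.UserKeys) × Fin η => x.1 x.2)
        (pair (fst ⊳ fst ⊳ snd ⊳ fst ⊳ snd ⊳ snd) (fst ⊳ snd ⊳ fst))) <|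
      lett (pair snd (pair (fst ⊳ fst ⊳ snd ⊳ snd ⊳ fst)
        (pair (fst ⊳ fst ⊳ snd ⊳ snd ⊳ snd ⊳ fst)
        (pair (fst ⊳ fst ⊳ fst ⊳ fst ⊳ snd ⊳ snd ⊳ fst ⊳ snd ⊳ snd ⊳ snd ⊳ snd ⊳ snd ⊳ snd)
          (fst ⊳ fst ⊳ fst ⊳ fst ⊳ snd ⊳ snd ⊳ snd)))) ⊳ S.spendC) <|
      pair (snd ⊳ Circuit.inl)
        (pair (fst ⊳ fst ⊳ fst ⊳ fst ⊳ snd ⊳ fst)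
          (ap (det fun x : List (Session p η G) × ℕ × Session p η G => x.1.set x.2.1 x.2.2)
            (pair (fst ⊳ fst ⊳ fst ⊳ fst ⊳ snd ⊳ snd)
            (pair (fst ⊳ fst ⊳ fst ⊳ fst ⊳ fst ⊳ fst)
            (fst ⊳ fst ⊳ fst ⊳ snd ⊳ pair fst (pair (snd ⊳ fst) (pair (snd ⊳ snd ⊳ fst)
              (bit true)))))))))
      (pair fail (fst ⊳ fst ⊳ snd)))
    (pair fail snd)

def oracleC : ∀ i, Circuit S.gameIface ((S.anonIface η).Query i × S.GameState η γ)
    ((S.anonIface η).Resp i × S.GameState η γ)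
  | .hash => par S.askHash Circuit.id
  | .withdraw => S.withdrawOracleC ηH
  | .spend => S.spendOracleC

def challengeC : Circuit S.gameIface (S.Keys η γ × Fin η × Fin γ × Fin η)
    (Opt (S.Coin × S.Voucher × S.Tx)) :=
  lett (ap (det fun x : (Fin η → S.UserKeys) × Fin η => x.1 x.2)
    (pair (fst ⊳ snd ⊳ snd) (snd ⊳ fst))) <|
  lett (pair (fst ⊳ fst ⊳ fst) snd ⊳ S.withdrawC) <|
  lett (ap (det fun x : (Fin γ → S.ATMKeys) × Fin γ => x.1 x.2)
    (fst ⊳ fst ⊳ pair (fst ⊳ snd ⊳ fst) (snd ⊳ snd ⊳ fst))) <|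
  lett (ap S.reqCoin (pair (fst ⊳ fst ⊳ fst ⊳ fst ⊳ fst) snd)) <|
  opt (pair (fst ⊳ fst ⊳ fst ⊳ fst ⊳ fst ⊳ fst) (pair (fst ⊳ snd) (pair snd
      (fst ⊳ fst ⊳ snd ⊳ pair fst (snd ⊳ snd)))) ⊳ S.issueC)
    (Circuit.ite (pair (fst ⊳ fst ⊳ fst ⊳ fst ⊳ fst ⊳ fst ⊳ fst) snd ⊳ S.linkedC)
      (lett (ap (fun _ : Unit => PMF.uniformOfFintype (Bits lam)) drop) <|
      lett (pair (fst ⊳ fst ⊳ fst ⊳ fst ⊳ fst ⊳ snd)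
        (pair (fst ⊳ fst ⊳ fst ⊳ fst ⊳ snd ⊳ fst)
        (pair (fst ⊳ fst ⊳ fst ⊳ fst ⊳ snd ⊳ snd ⊳ fst)
        (pair (fst ⊳ snd ⊳ snd ⊳ snd ⊳ snd ⊳ snd ⊳ snd ⊳ snd ⊳ snd)
        (pair (ap (opPow p G) (pair (ap S.opGen drop)
          (ap (det fun x : (Fin η → S.UserKeys) × Fin η => x.1 x.2)
            (fst ⊳ fst ⊳ fst ⊳ fst ⊳ fst ⊳ fst ⊳ pair (fst ⊳ snd ⊳ snd) (snd ⊳ snd ⊳ snd))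
              ⊳ fst)))
          snd)))) ⊳ S.spendC) <|
      pair (fst ⊳ fst ⊳ snd ⊳ fst) (pair (fst ⊳ fst ⊳ snd ⊳ snd) snd) ⊳ Circuit.inl)
      fail)
    fail

/-- Set-up, adversary and challenge form one closed circuit. Different oracles turn it into the
hybrids, and replacing its gates turns it into the reductions, whose time and queries can then be
counted. -/
def gameC (b : Bool) (A : S.AnonAdversary η γ) : Circuit S.gameIface Unit Bool :=
  lett (ap (fun _ : Unit => S.setup η γ) drop) <|
  lett (pair (ap (det fun K : S.Keys η γ => S.advInput ηH K) snd)
      (pair snd (ap (det fun _ : Unit => ([] : List (Session p η G))) drop)) ⊳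
    A.A₁.subst (S.oracleC ηH)) <|
  ite (ite (ap (opHonest η ηH) (snd ⊳ fst ⊳ fst))
      (ite (ap (opHonest η ηH) (snd ⊳ fst ⊳ snd ⊳ fst))
        (ite (ap (opEqUser η) (snd ⊳ fst ⊳ pair fst (snd ⊳ fst))) (bit false) (bit true))
        (bit false)) (bit false))
    (opt (pair (fst ⊳ snd) (snd ⊳ fst ⊳ pair (if b then snd ⊳ fst else fst)
        (snd ⊳ snd ⊳ pair fst (snd ⊳ fst))) ⊳ S.challengeC)
      (pair (pair (snd ⊳ fst) (pair (snd ⊳ snd ⊳ fst) (pair (snd ⊳ snd ⊳ snd)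
          (pair (fst ⊳ fst ⊳ snd ⊳ fst) (fst ⊳ snd ⊳ fst ⊳ snd ⊳ snd ⊳ snd ⊳ snd)))))
          (fst ⊳ snd ⊳ snd) ⊳
        A.A₂.subst (S.oracleC ηH) ⊳ fst)
      (bit false))
    (bit false)

variable {M : Type → Type} [Monad M] [LawfulMonad M] [MonadLiftT PMF M] [LawfulMonadLiftT PMF M]
  (O : S.Oracles M)

theorem run_withdrawOracleC (i : Fin η) (K : S.Keys η γ) (l : List (Session p η G)) :
    (S.withdrawOracleC ηH).run O.handler (i, (K, l)) =
      (S.withdrawOracleG O ηH K i l >>= fun r => pure (r.1, (K, r.2))) := by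
  simp only [withdrawOracleC, run_lett, run_pair, run_seq, run_ap, run_fst, run_snd,
    liftM_det, pure_bind, run_drop, run_ite, run_bit, run_fail, run_withdrawC, run_inl,
    decide_eq_true_eq, withdrawOracleG]
  split_ifs
  · simp only [stateT_lift_bind, stateT_modify_bind, stateT_pure, bind_assoc, pure_bind]
  · simp only [stateT_pure, pure_bind]

theorem run_spendOracleC (x : ℕ × S.Coin × S.Voucher × G × Bits lam) (K : S.Keys η γ)
    (l : List (Session p η G)) : S.spendOracleC.run O.handler (x, (K, l)) =
      (S.spendOracleG O K x l >>= fun r => pure (r.1, (K, r.2))) := by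
  simp only [spendOracleC, run_lett, run_pair, run_seq, run_ap, run_fst, run_snd,
    liftM_det, pure_bind, run_ite, run_bit, run_fail, run_linkedC, run_spendC, run_inl,
    decide_eq_true_eq, run_opt, spendOracleG]
  rw [stateT_get_bind]
  rcases l[x.1]? with _ | ⟨i, P, r, spent⟩
  · simp only [stateT_pure, pure_bind]
  · dsimp only
    rw [stateT_lift_bind]
    simp only [bind_assoc]
    congr 1; funext ok
    by_cases h : ok = true ∧ x.2.2.1.1 = P ∧ spent = false
    · obtain ⟨rfl, rfl, rfl⟩ := h
      simp only [if_true, and_self, pure_bind, Bool.false_eq_true, if_false, stateT_lift_bind,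
        stateT_set_bind, stateT_pure, bind_assoc, decide_true]
    · rw [if_neg h]
      simp only [stateT_pure, pure_bind, ← apply_ite pure]
      rw [if_neg]
      simpa using h

theorem run_oracleC (i) (q : (S.anonIface η).Query i) (K : S.Keys η γ)
    (l : List (Session p η G)) : (S.oracleC ηH i).run O.handler (q, (K, l)) =
      (S.oracleG O ηH K i q l >>= fun r => pure (r.1, (K, r.2))) := by
  cases i with
  | hash =>
    change (O.hash q >>= fun y => pure (K, l) >>= fun y' => pure (y, y')) =
      (O.hash q >>= fun a => pure (a, l)) >>= fun r => pure (r.1, (K, r.2))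
    simp only [bind_assoc, pure_bind]
  | withdraw => exact S.run_withdrawOracleC ηH O q K l
  | spend => exact S.run_spendOracleC O q K l

/-- Execution of an adversary with the keys as part of the state. -/
theorem run_oracleC_subst {X Y : Type} (A : Circuit (S.anonIface η) X Y) (x : X) (K : S.Keys η γ)
    (l : List (Session p η G)) : (A.subst (S.oracleC ηH)).run O.handler (x, (K, l)) =
      (A.run (S.oracleG O ηH K) x l >>= fun r => pure (r.1, (K, r.2))) := by
  rw [run_subst]
  refine run_rel₀ (M₁ := StateT (S.GameState η γ) M) (M₂ := StateT (List (Session p η G)) M) _ _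
    (fun Y m₁ m₂ => ∀ l, m₁ (K, l) = m₂ l >>= fun r => pure (r.1, (K, r.2))) ?_ ?_ ?_ ?_ A x l
  · intro Y y l
    change pure _ = pure _ >>= _
    simp
  · intro Y Z a b f g hab hfg l
    change (a (K, l) >>= fun r => f r.1 r.2) = (b l >>= fun r => g r.1 r.2) >>= _
    simp only [hab, bind_assoc, pure_bind]
    exact bind_congr fun r => hfg _ _
  · intro Y e l
    change (liftM e >>= fun a => pure (a, (K, l))) = (liftM e >>= fun a => pure (a, l)) >>= _
    simp
  · intro i q l
    exact S.run_oracleC ηH O i q K l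

theorem run_challengeC (x : S.Keys η γ × Fin η × Fin γ × Fin η) :
    S.challengeC.run O.handler x = S.challengeG O x.1 x.2.1 x.2.2.1 x.2.2.2 := by
  simp only [challengeC, challengeG, run_lett, run_pair, run_seq, run_ap, run_fst, run_snd,
      liftM_det, pure_bind, run_drop, run_ite, run_fail, run_linkedC, run_spendC, run_withdrawC,
      run_issueC, run_inl, run_opt]
  congr 1; funext y
  congr 1; funext coin
  congr 1; funext CV
  rcases CV with ⟨C, V⟩ | ⟨⟩ <;> rfl

theorem run_gameC (b : Bool) (A : S.AnonAdversary η γ) :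
    (S.gameC ηH b A).run O.handler () = S.expG O ηH b A := by
  have hb : ∀ x : Fin η × Fin η × Fin γ × Fin η × A.State,
      (if b then snd ⊳ fst else fst : Circuit S.gameIface
        (Fin η × Fin η × Fin γ × Fin η × A.State) (Fin η)).run O.handler x =
        pure (if b then x.2.1 else x.1) := by
    intro x; cases b <;> simp
  simp only [gameC, run_lett, run_pair, run_seq, run_ap, run_fst, run_snd,
      liftM_det, pure_bind, run_drop, run_ite, run_bit, run_challengeC,
      run_opt, bind_assoc, run_oracleC_subst, expG, hb]
  congr 1; funext K
  change _ = (A.A₁.run (S.oracleG O ηH K) (S.advInput ηH K) [] >>= fun x =>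
    ((if x.1.1.val < ηH ∧ x.1.2.1.val < ηH ∧ x.1.1 ≠ x.1.2.1 then do
      let CVT ← (liftM (S.challengeG O K (if b then x.1.2.1 else x.1.1) x.1.2.2.1 x.1.2.2.2.1) :
        StateT (List (Session p η G)) M (Opt (S.Coin × S.Voucher × S.Tx)))
      match CVT with
      | .inr () => pure false
      | .inl (C, V, T) => A.A₂.run (S.oracleG O ηH K) (C, V, T, K.1, x.1.2.2.2.2)
    else pure false : StateT (List (Session p η G)) M Bool) x.2)) >>= fun r => pure r.1
  rw [bind_assoc]
  congr 1; funext x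
  obtain ⟨⟨i₀, i₁, j, m, φ⟩, l⟩ := x
  dsimp only
  by_cases h : i₀.val < ηH ∧ i₁.val < ηH ∧ i₀ ≠ i₁
  · rw [if_pos h]
    simp only [h.1, h.2.1, h.2.2, decide_true, decide_false, if_true, Bool.false_eq_true, if_false,
      pure_bind]
    rw [stateT_lift_bind]
    simp only [bind_assoc]
    congr 1; funext o
    rcases o with ⟨C, V, T⟩ | ⟨⟩
    · rfl
    · change _ = pure (false, l) >>= fun r => pure r.1
      simp
  · rw [if_neg h]
    change _ = pure (false, l) >>= fun r => pure r.1
    simp only [pure_bind]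
    split_ifs <;> simp_all

end OracleCircuits

end Scheme

namespace Scheme

open Circuit

variable {p lam : ℕ} [Fact p.Prime] {G : Type} [CommGroup G]

/-! ### Size of the circuits -/

section Size

variable (S : Scheme p lam G) {η γ : ℕ} (ηH : ℕ)

/-- All operations of the circuit are basic operations of the scheme. -/
def IsBasic (S : Scheme p lam G) (η ηH γ : ℕ) {I : Iface} {X Y : Type} (A : Circuit I X Y) :
    Prop :=
  A.AllOps (fun _ _ f => S.BasicOp η ηH γ f)

theorem isBasic_withdrawC : S.IsBasic η ηH γ S.withdrawC := by
  simp only [IsBasic, withdrawC, lett, pair, ap, AllOps, askProve, true_and, and_true]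
  exact ⟨.scalar, .commit, .stmtSig, .witSig⟩

theorem isBasic_issueC : S.IsBasic η ηH γ S.issueC := by
  simp only [IsBasic, issueC, lett, pair, ap, Circuit.ite, fail, AllOps, askProve, askVerify, true_and,
    and_true]
  exact ⟨.stmtSig, .hashCom, ⟨.one, .add⟩, .prf, ⟨⟨⟨.gen, .pow⟩, ⟨⟨.zero, .prf⟩, .pow⟩⟩, .mul⟩,
    ⟨.stmtSig, ⟨.zero, .witSig⟩⟩, .stmtVoucher, .witVoucher⟩

theorem isBasic_linkedC : S.IsBasic η ηH γ S.linkedC := by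
  simp only [IsBasic, linkedC, lett, pair, ap, Circuit.ite, AllOps, askVerify, true_and, and_true]
  exact ⟨.stmtSig, .stmtSig, ⟨⟨.one, .add⟩, .stmtVoucher⟩, ⟨.hashCom, .eqScalar⟩,
    .hashCoin, .blindVerify⟩

theorem isBasic_spendC : S.IsBasic η ηH γ S.spendC := by
  simp only [IsBasic, spendC, lett, pair, ap, AllOps, askProve, askPrf, true_and, and_true]
  exact ⟨.hashTx, ⟨.one, .add⟩, ⟨⟨⟨.gen, .pow⟩, .pow⟩, .mul⟩, .stmtSpend, .witSpend⟩

theorem basicOp_opGetSession : S.BasicOp η ηH γ (opGetSession p η G) := by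
  convert BasicOp.getSession (S := S) (η := η) (ηH := ηH) (γ := γ) using 1
  funext x
  change PMF.pure _ = PMF.pure _
  congr 1
  dsimp only
  rcases x.1[x.2]? <;> rfl

theorem isBasic_oracleC (i) : S.IsBasic η ηH γ (S.oracleC (η := η) (γ := γ) ηH i) := by
  have h₁ := S.isBasic_withdrawC (η := η) (γ := γ) ηH
  have h₂ := S.isBasic_linkedC (η := η) (γ := γ) ηH
  have h₃ := S.isBasic_spendC (η := η) (γ := γ) ηH
  unfold IsBasic at *
  cases i with
  | hash => exact ⟨trivial, trivial⟩
  | withdraw =>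
    simp only [oracleC, withdrawOracleC, lett, pair, ap, Circuit.ite, fail, AllOps, true_and, and_true]
    exact ⟨.honest, .user, h₁, ⟨.gen, .pow⟩, .addSession⟩
  | spend =>
    simp only [oracleC, spendOracleC, lett, pair, ap, Circuit.ite, opt, fail, AllOps, true_and, and_true]
    exact ⟨S.basicOp_opGetSession ηH, h₂, .eqGroup, .user, h₃, .setSession⟩

theorem isBasic_challengeC : S.IsBasic η ηH γ (S.challengeC (η := η) (γ := γ)) := by
  have h₁ := S.isBasic_withdrawC (η := η) (γ := γ) ηH
  have h₂ := S.isBasic_linkedC (η := η) (γ := γ) ηH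
  have h₃ := S.isBasic_spendC (η := η) (γ := γ) ηH
  have h₄ := S.isBasic_issueC (η := η) (γ := γ) ηH
  unfold IsBasic at *
  simp only [challengeC, lett, pair, ap, Circuit.ite, opt, fail, AllOps, true_and, and_true]
  exact ⟨.user, h₁, .atm, .reqCoin, h₄, h₂, .bits, ⟨⟨.gen, .user⟩, .pow⟩, h₃⟩

/-- This and the next constants are generous; what matters is that they do not depend on the scheme,
which makes the constant of the theorem absolute. -/
theorem size_oracleC_le (i) : (S.oracleC (η := η) (γ := γ) ηH i).size ≤ 50 := by
  cases i with
  | hash => simp [oracleC, askHash, size]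
  | withdraw =>
    simp [oracleC, withdrawOracleC, withdrawC, lett, pair, ap, Circuit.ite, fail, size, askProve]
  | spend =>
    simp [oracleC, spendOracleC, linkedC, spendC, lett, pair, ap, Circuit.ite, opt, fail, size, askProve,
      askVerify, askPrf]

theorem size_challengeC_le : (S.challengeC (η := η) (γ := γ)).size ≤ 100 := by
  simp [challengeC, withdrawC, issueC, linkedC, spendC, lett, pair, ap, Circuit.ite, opt, fail, size,
    askProve, askVerify, askPrf]

theorem queries_oracleC_le (i) : (S.oracleC (η := η) (γ := γ) ηH i).queries ≤ 5 := by
  cases i with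
  | hash => simp [queries, oracleC, askHash, gates]
  | withdraw =>
    simp [queries, oracleC, withdrawOracleC, withdrawC, lett, pair, ap, Circuit.ite, fail, gates, askProve]
  | spend =>
    simp [queries, oracleC, spendOracleC, linkedC, spendC, lett, pair, ap, Circuit.ite, opt, fail, gates,
      askProve, askVerify, askPrf]

theorem queries_challengeC_le : (S.challengeC (η := η) (γ := γ)).queries ≤ 20 := by
  simp [queries, challengeC, withdrawC, issueC, linkedC, spendC, lett, pair, ap, Circuit.ite, opt, fail,
    gates, askProve, askVerify, askPrf]

/-- Weight of the queries to the pseudorandom function. -/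
def GameOracle.isPrf : GameOracle → ℕ
  | .prf => 1
  | _ => 0

/-- Only a spend evaluates the user's function, and only once. With one more evaluation in the
challenge, this yields the exact count `q + 1` in the PRF advantage. -/
theorem prfGates_oracleC_le (i) :
    (S.oracleC (η := η) (γ := γ) ηH i).gates GameOracle.isPrf ≤ 1 := by
  cases i with
  | hash => simp [oracleC, askHash, gates, GameOracle.isPrf]
  | withdraw =>
    simp [oracleC, withdrawOracleC, withdrawC, lett, pair, ap, Circuit.ite, fail, gates, askProve,
      GameOracle.isPrf]
  | spend =>
    simp [oracleC, spendOracleC, linkedC, spendC, lett, pair, ap, Circuit.ite, opt, fail, gates,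
      askProve, askVerify, askPrf, GameOracle.isPrf]

theorem prfGates_challengeC_le :
    (S.challengeC (η := η) (γ := γ)).gates GameOracle.isPrf ≤ 1 := by
  simp [challengeC, withdrawC, issueC, linkedC, spendC, lett, pair, ap, Circuit.ite, opt, fail,
    gates, askProve, askVerify, askPrf, GameOracle.isPrf]

variable {c : CostModel} {τ : ℕ∞} {ρ : ℕ}

theorem IsBasic.time_le {S : Scheme p lam G} {ηH : ℕ} (hc : S.CostBound η ηH γ c τ ρ) {I : Iface}
    {X Y : Type} {A : Circuit I X Y} (hA : S.IsBasic η ηH γ A) {n : ℕ} (hn : A.size ≤ n) :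
    A.time c ≤ n * (τ + 1) := by
  refine (time_le_size le_add_self (P := fun _ _ f => S.BasicOp η ηH γ f) ?_ A hA).trans
    (mul_le_mul_left (by exact_mod_cast hn) _)
  intro X Y f hf
  exact (hc.basic X Y f hf).trans le_self_add

theorem time_gameC_le (hc : S.CostBound η ηH γ c τ ρ) (b : Bool) (A : S.AnonAdversary η γ) :
    (S.gameC ηH b A).time c ≤ A.time c + (50 * A.queries + 150) * (τ + 1) := by
  have hb : ∀ f ∈ ({c _ _ (fun _ : Unit => S.setup η γ),
      c _ _ (det fun K : S.Keys η γ => S.advInput ηH K),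
      c _ _ (det fun _ : Unit => ([] : List (Session p η G))), c _ _ (opHonest η ηH),
      c _ _ (opEqUser η), 1} : Set ℕ∞), f ≤ τ + 1 := by
    have h := hc.basic
    simp only [Set.mem_insert_iff, Set.mem_singleton_iff, forall_eq_or_imp, forall_eq]
    refine ⟨(h _ _ _ .setup).trans le_self_add, (h _ _ _ .input).trans le_self_add,
      (h _ _ _ .noSession).trans le_self_add, (h _ _ _ .honest).trans le_self_add,
      (h _ _ _ .eqUser).trans le_self_add, le_add_self⟩
  simp only [Set.mem_insert_iff, Set.mem_singleton_iff, forall_eq_or_imp, forall_eq] at hb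
  obtain ⟨h₁, h₂, h₃, h₄, h₅, h₆⟩ := hb
  have hor : ∀ i, (S.oracleC (η := η) (γ := γ) ηH i).time c ≤ 50 * (τ + 1) :=
    fun i => (S.isBasic_oracleC ηH i).time_le hc (S.size_oracleC_le ηH i)
  have hch : (S.challengeC (η := η) (γ := γ)).time c ≤ 100 * (τ + 1) :=
    (S.isBasic_challengeC ηH).time_le hc S.size_challengeC_le
  have hA₁ := time_subst_le (c := c) _ hor A.A₁
  have hA₂ := time_subst_le (c := c) _ hor A.A₂
  generalize τ + 1 = T at *
  have : (S.gameC ηH b A).time c ≤ T + (T + T + (A.A₁.time c + A.A₁.queries * (50 * T)) +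
      (T + (T + (T + T + T) + T) +
        (100 * T + (A.A₂.time c + A.A₂.queries * (50 * T) + T) + T))) := by
    cases b <;>
    simp only [gameC, lett, pair, ap, Circuit.ite, opt, time, add_zero, zero_add, if_true, if_false,
      Bool.false_eq_true] <;>
    gcongr
  refine this.trans ?_
  -- 111 is 100 for the challenge and 11 for the three initial operations, the three tests of the
  -- adversary's choice and the five branchings.
  calc _ = A.A₁.time c + A.A₂.time c + (50 * (A.A₁.queries + A.A₂.queries) + 111) * T := by ring
    _ ≤ A.A₁.time c + A.A₂.time c + (50 * (A.A₁.queries + A.A₂.queries) + 150) * T := by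
      gcongr; norm_num
    _ = _ := by unfold AnonAdversary.time AnonAdversary.queries; push_cast; rfl

theorem queries_gameC_le (b : Bool) (A : S.AnonAdversary η γ) :
    (S.gameC ηH b A).queries ≤ 5 * A.queries + 20 := by
  have h₁ := gates_subst_le _ (v := fun _ => 1) (S.queries_oracleC_le (η := η) (γ := γ) ηH) A.A₁
  have h₂ := gates_subst_le _ (v := fun _ => 1) (S.queries_oracleC_le (η := η) (γ := γ) ηH) A.A₂
  have e₁ := gates_const 5 A.A₁
  have e₂ := gates_const 5 A.A₂
  have h₃ := S.queries_challengeC_le (η := η) (γ := γ)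
  unfold AnonAdversary.queries queries at *
  cases b <;> simp [gameC, lett, pair, ap, Circuit.ite, opt, gates] <;> omega

theorem prfGates_gameC_le (b : Bool) (A : S.AnonAdversary η γ) :
    (S.gameC ηH b A).gates GameOracle.isPrf ≤ A.queries + 1 := by
  have h₁ := gates_subst_le _ (S.prfGates_oracleC_le (η := η) (γ := γ) ηH) A.A₁
  have h₂ := gates_subst_le _ (S.prfGates_oracleC_le (η := η) (γ := γ) ηH) A.A₂
  have h₃ := S.prfGates_challengeC_le (η := η) (γ := γ)
  unfold AnonAdversary.queries queries at *
  cases b <;> simp [gameC, lett, pair, ap, Circuit.ite, opt, gates] <;> omega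

end Size

end Scheme

/-! ### Elementary properties of the advantages -/

theorem prTrue_nonneg (e : PMF Bool) : 0 ≤ prTrue e := ENNReal.toReal_nonneg

theorem prTrue_le_one (e : PMF Bool) : prTrue e ≤ 1 :=
  ENNReal.toReal_le_of_le_ofReal zero_le_one (by simpa using e.coe_le_one true)

theorem prTrue_not (e : PMF Bool) : prTrue (e >>= fun b => pure (!b)) = 1 - prTrue e := by
  have h : e true + e false = 1 := by
    have := e.tsum_coe
    rwa [tsum_bool, add_comm] at this
  have h' : (e >>= fun b => pure (!b) : PMF Bool) true = e false := by
    change (e.bind fun b => PMF.pure (!b)) true = _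
    rw [PMF.bind_apply, tsum_bool]
    simp
  unfold prTrue
  rw [h', eq_sub_iff_add_eq, ← ENNReal.toReal_add (e.apply_ne_top _) (e.apply_ne_top _), add_comm, h,
    ENNReal.toReal_one]

theorem abs_prTrue_sub_le (e e' : PMF Bool) : |prTrue e - prTrue e'| ≤ 1 := by
  rw [abs_le]
  constructor <;> linarith [prTrue_nonneg e, prTrue_nonneg e', prTrue_le_one e, prTrue_le_one e']

theorem hidingAdv_nonneg {Msg Rnd Com : Type} [Fintype Rnd] [Nonempty Rnd] (comm : Msg → Rnd → Com)
    (c : CostModel) (t : ℕ∞) (q : ℕ) : 0 ≤ hidingAdv comm c t q :=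
  Real.sSup_nonneg (by rintro _ ⟨A, -, -, rfl⟩; exact abs_nonneg _)

theorem le_prfAdv {K D R : Type} [Fintype K] [Nonempty K] [Fintype D] [DecidableEq D] [Fintype R]
    [Nonempty R] (F : K → D → R) {c : CostModel} {t : ℕ∞} {q : ℕ}
    (A : Circuit (oneIface D R) Unit Bool) (ht : A.time c ≤ t) (hq : A.queries ≤ q) :
    |prTrue (prfExp F true A) - prTrue (prfExp F false A)| ≤ prfAdv F c t q :=
  le_csSup ⟨1, by rintro _ ⟨A, -, -, rfl⟩; exact abs_prTrue_sub_le _ _⟩ ⟨A, ht, hq, rfl⟩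

/-! ### The zero-knowledge advantage -/

section ZK

variable {lam : ℕ} {Stmt Wit : Type} {Rel : Stmt → Wit → Prop} (N : NIZK lam Stmt Wit Rel)

theorem le_zkAdv {c : CostModel} {t : ℕ∞} {q : ℕ}
    (D : Circuit (zkIface lam Stmt Wit N.Proof) Unit Bool) (ht : D.time c ≤ t)
    (hq : D.queries ≤ q) :
    prTrue (zkExp N true D) - prTrue (zkExp N false D) ≤ zkAdv N c t q :=
  le_csSup ⟨1, by rintro _ ⟨A, -, -, rfl⟩; exact (le_abs_self _).trans (abs_prTrue_sub_le _ _)⟩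
    ⟨D, ht, hq, rfl⟩

/-- The supremum is over signed differences, so a witness is needed: the constant distinguisher is
free and has difference 0. -/
theorem zkAdv_nonneg (c : CostModel) (t : ℕ∞) (q : ℕ) : 0 ≤ zkAdv N c t q := by
  refine le_trans (le_of_eq ?_) (le_zkAdv N (c := c) (.bit true) (zero_le) (Nat.zero_le _))
  have h : ∀ b, zkExp N b (.bit true) = PMF.pure true := by
    intro b
    cases b
    · change (pure (true, emptyTable lam) >>= fun r => pure r.1 : PMF Bool) = _
      rw [pure_bind]; rfl
    · change (N.simInit >>= fun s => pure (true, s) >>= fun r => pure r.1 : PMF Bool) = _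
      simp only [pure_bind]
      exact PMF.bind_const _ _
  rw [h, h, sub_self]

-- Negating the output of a distinguisher exchanges the two signs; it costs one branching, whence
-- the `+ 1` in the time.
open Circuit in
theorem abs_le_zkAdv {c : CostModel} {t : ℕ∞} {q : ℕ}
    (D : Circuit (zkIface lam Stmt Wit N.Proof) Unit Bool) (ht : D.time c + 1 ≤ t)
    (hq : D.queries ≤ q) :
    |prTrue (zkExp N true D) - prTrue (zkExp N false D)| ≤ zkAdv N c t q := by
  have h : ∀ b, zkExp N b (D.seq (Circuit.ite .id (.bit false) (.bit true))) =
      zkExp N b D >>= fun x => pure (!x) := by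
    intro b
    have aux : ∀ {σ : Type} (h : ∀ i, (zkIface lam Stmt Wit N.Proof).Query i →
        StateT σ PMF ((zkIface lam Stmt Wit N.Proof).Resp i)),
        (D.seq (Circuit.ite .id (.bit false) (.bit true))).run h () =
          D.run h () >>= fun x => pure (!x) := by
      intro σ h
      rw [run_seq]
      refine bind_congr fun x => ?_
      cases x <;> simp
    cases b
    · change ((D.seq _).run (M := StateT _ PMF) _ () (emptyTable lam) >>= fun r => pure r.1 : PMF Bool)
        = (D.run (M := StateT _ PMF) _ () (emptyTable lam) >>= fun r => pure r.1) >>= _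
      rw [aux]
      change ((D.run (M := StateT _ PMF) _ () (emptyTable lam) >>= fun r => pure (!r.1, r.2)) >>=
        fun r => pure r.1 : PMF Bool) = _
      simp only [bind_assoc, pure_bind]
    · change (N.simInit >>= fun s => ((D.seq _).run (M := StateT _ PMF) _ () s >>=
          fun r => pure r.1) : PMF Bool)
        = (N.simInit >>= fun s => (D.run (M := StateT _ PMF) _ () s >>= fun r => pure r.1)) >>= _
      rw [aux]
      change (N.simInit >>= fun s => ((D.run (M := StateT _ PMF) _ () s >>=
        fun r => pure (!r.1, r.2)) >>= fun r => pure r.1) : PMF Bool) = _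
      simp only [bind_assoc, pure_bind]
  rw [abs_le]
  constructor
  · have := le_zkAdv N (c := c) (t := t) (q := q) (D.seq (Circuit.ite .id (.bit false) (.bit true)))
      (by simpa [time, Circuit.ite, pair] using ht)
      (by simpa [queries, gates, Circuit.ite, pair] using hq)
    rw [h, h, prTrue_not, prTrue_not] at this
    linarith
  · exact le_zkAdv N D (le_self_add.trans ht) hq

end ZK

namespace Scheme

open Circuit

variable {p lam : ℕ} [Fact p.Prime] {G : Type} [CommGroup G]

local infixr:80 " ⊳ " => Circuit.seq

/-! ### The zero-knowledge and PRF reductions -/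

section Reductions

variable (S : Scheme p lam G) {η γ : ℕ} (ηH : ℕ)

abbrev ZKI (S : Scheme p lam G) : Iface :=
  zkIface lam (Stmt p G S.zsgn.PK) (Wit p S.zsgn.Sig) S.nizk.Proof

/-- The random oracle gate of the zero-knowledge experiment. -/
def zkAskHash : Circuit S.ZKI (List Bool) (Bits lam) := ask (I := S.ZKI) ZKOracle.hash

def zkAskProve : Circuit S.ZKI (Stmt p G S.zsgn.PK × Wit p S.zsgn.Sig) (Opt S.nizk.Proof) :=
  ask (I := S.ZKI) ZKOracle.prove

/-- A simulated proof with a fresh state of the simulator. -/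
def freshProofC : Circuit S.ZKI (Stmt p G S.zsgn.PK × Wit p S.zsgn.Sig) S.nizk.Proof :=
  pair (ap (fun _ : Unit => S.nizk.simInit) drop) fst ⊳ op S.nizk.simGo ⊳ fst

/-- A refusal has to be turned into some proof, and `Proof` is not assumed to be inhabited, so a
freshly simulated one serves as default. The game never reaches this case, since it only asks for
proofs of true statements. -/
def zkProveC : Circuit S.ZKI (Stmt p G S.zsgn.PK × Wit p S.zsgn.Sig) S.nizk.Proof :=
  opt S.zkAskProve snd S.freshProofC

def zkVerifyC : Circuit S.ZKI (Stmt p G S.zsgn.PK × S.nizk.Proof) Bool :=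
  S.nizk.verify.relabel (I := roIface lam) (fun _ => S.zkAskHash)

/-- The oracles of the game in terms of those of the zero-knowledge experiment. -/
def zkOracleC : ∀ i, Circuit S.ZKI (S.gameIface.Query i) (S.gameIface.Resp i)
  | .hash => S.zkAskHash
  | .prove => S.zkProveC
  | .verify => S.zkVerifyC
  | .prf => op S.opPrf

abbrev PRFI (p : ℕ) (G : Type) : Iface := oneIface (ZMod p) G

def prfHashC : Circuit (PRFI p G) (List Bool × S.nizk.SimState) (Bits lam × S.nizk.SimState) :=
  pair snd fst ⊳ op S.nizk.simHash

def prfAsk (p : ℕ) (G : Type) : Circuit (PRFI p G) (ZMod p) G := ask (I := PRFI p G) OneOracle.it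

def prfProveC : Circuit (PRFI p G)
    ((Stmt p G S.zsgn.PK × Wit p S.zsgn.Sig) × S.nizk.SimState)
    (S.nizk.Proof × S.nizk.SimState) :=
  pair snd (fst ⊳ fst) ⊳ op S.nizk.simGo

def prfVerifyC : Circuit (PRFI p G) ((Stmt p G S.zsgn.PK × S.nizk.Proof) × S.nizk.SimState)
    (Bool × S.nizk.SimState) :=
  S.nizk.verify.subst (I := roIface lam) (fun _ => S.prfHashC)

def prfEvalC : Circuit (PRFI p G) ((ZMod p × ZMod p) × S.nizk.SimState) (G × S.nizk.SimState) :=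
  pair (fst ⊳ pair snd fst ⊳ op (opAdd p) ⊳ prfAsk p G) snd

/-- The oracles of the game in terms of a simulator and a keyed function, to whose argument the
user's key is added. -/
def prfOracleC : ∀ i, Circuit (PRFI p G) (S.gameIface.Query i × S.nizk.SimState)
    (S.gameIface.Resp i × S.nizk.SimState)
  | .hash => S.prfHashC
  | .prove => S.prfProveC
  | .verify => S.prfVerifyC
  | .prf => S.prfEvalC

def zkReduction (b : Bool) (A : S.AnonAdversary η γ) : Circuit S.ZKI Unit Bool :=
  (S.gameC ηH b A).relabel S.zkOracleC

/-- The reduction runs set-up and simulator itself and serves all users with one PRF instance: it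
knows each key `u` and queries the oracle at `x + u`. -/
def prfReduction (b : Bool) (A : S.AnonAdversary η γ) : Circuit (PRFI p G) Unit Bool :=
  lett (ap (fun _ : Unit => S.nizk.simInit) drop) ((S.gameC ηH b A).subst S.prfOracleC ⊳ fst)

variable {c : CostModel} {τ : ℕ∞} {ρ : ℕ}

theorem time_zkReduction_le (hc : S.CostBound η ηH γ c τ ρ) (b : Bool) (A : S.AnonAdversary η γ) :
    (S.zkReduction ηH b A).time c ≤ A.time c + (70 * A.queries + 230) * (τ + 1) := by
  have h : ∀ i, (S.zkOracleC i).time c ≤ 4 * (τ + 1) := by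
    intro i
    cases i with
    | hash => exact zero_le
    | prove =>
      have h₁ : c _ _ (fun _ : Unit => S.nizk.simInit) ≤ τ + 1 :=
        (hc.basic _ _ _ .simInit).trans le_self_add
      have h₂ : c _ _ S.nizk.simGo ≤ τ + 1 := (hc.basic _ _ _ .simGo).trans le_self_add
      simp only [zkOracleC, zkProveC, opt, freshProofC, pair, ap, time, zkAskProve, zero_add, add_zero]
      calc _ ≤ (τ + 1) + (τ + 1) + (τ + 1) := by gcongr; exact le_add_self
        _ = 3 * (τ + 1) := by ring
        _ ≤ _ := by gcongr; norm_num
    | verify =>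
      -- The verifier's hash gates become gates again, which take no time.
      refine (time_relabel_le (T := 0) _ (fun _ => zero_le) _).trans ?_
      rw [mul_zero, add_zero]
      refine hc.verify_time.trans ?_
      calc τ ≤ 1 * (τ + 1) := by rw [one_mul]; exact le_self_add
        _ ≤ _ := by gcongr; norm_num
    | prf =>
      refine (hc.basic _ _ _ .prf).trans ?_
      calc τ ≤ 1 * (τ + 1) := by rw [one_mul]; exact le_self_add
        _ ≤ _ := by gcongr; norm_num
  refine (time_relabel_le _ h _).trans ?_
  have h₁ := S.time_gameC_le ηH hc b A
  have h₂ : ((S.gameC ηH b A).queries : ℕ∞) ≤ 5 * A.queries + 20 := by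
    exact_mod_cast S.queries_gameC_le ηH b A
  -- 70 = 50 + 4 · 5 and 230 = 150 + 4 · 20.
  calc _ ≤ A.time c + (50 * A.queries + 150) * (τ + 1) + (5 * A.queries + 20) * (4 * (τ + 1)) := by
        gcongr
    _ = _ := by ring

theorem queries_zkReduction_le (hc : S.CostBound η ηH γ c τ ρ) (b : Bool)
    (A : S.AnonAdversary η γ) :
    (S.zkReduction ηH b A).queries ≤ (5 * A.queries + 20) * (ρ + 1) := by
  have h : ∀ i, (S.zkOracleC i).gates (fun _ => 1) ≤ ρ + 1 := by
    intro i
    cases i with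
    | hash => simp [zkOracleC, zkAskHash, gates]
    | prove => simp [zkOracleC, zkProveC, zkAskProve, freshProofC, opt, pair, ap, gates]
    | verify =>
      refine (gates_relabel_le (w := fun _ => 1) _ (fun _ => le_rfl) _).trans ?_
      exact hc.verify_queries.trans (Nat.le_succ _)
    | prf => simp [zkOracleC, gates]
  refine (gates_relabel_le _ h _).trans ?_
  rw [gates_const]
  exact Nat.mul_le_mul_right _ (S.queries_gameC_le ηH b A)

/-- Here the random oracle is simulated by the reduction, so each of the at most `ρ` hash queries of
a verification costs a run of `simHash`. This is the source of the factor `ρ + 1` in the time. -/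
theorem time_prfReduction_le (hc : S.CostBound η ηH γ c τ ρ) (b : Bool)
    (A : S.AnonAdversary η γ) : (S.prfReduction ηH b A).time c ≤
      A.time c + (70 * A.queries + 231) * (ρ + 1) * (τ + 1) := by
  have hle : τ ≤ 2 * ((ρ + 1) * (τ + 1)) := by
    calc τ ≤ 1 * (1 * (τ + 1)) := by rw [one_mul, one_mul]; exact le_self_add
      _ ≤ _ := by gcongr; · norm_num
                  · exact le_add_self
  have hh : S.prfHashC.time c ≤ τ := by
    simpa [prfHashC, pair, time] using hc.basic _ _ _ .simHash
  have h : ∀ i, (S.prfOracleC i).time c ≤ 2 * ((ρ + 1) * (τ + 1)) := by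
    intro i
    cases i with
    | hash => exact hh.trans hle
    | prove =>
      refine le_trans ?_ hle
      exact le_of_eq_of_le (by simp [prfOracleC, prfProveC, pair, time]; rfl) (hc.basic _ _ _ .simGo)
    | verify =>
      refine (time_subst_le _ (fun _ => hh) _).trans ?_
      calc _ ≤ τ + ρ * τ := by
            gcongr
            · exact hc.verify_time
            · exact_mod_cast hc.verify_queries
        _ = 1 * ((ρ + 1) * τ) := by ring
        _ ≤ _ := by gcongr; · norm_num
                    · exact le_self_add
    | prf =>
      refine le_trans ?_ hle
      simpa [prfOracleC, prfEvalC, prfAsk, pair, time] using hc.basic _ _ _ .add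
  have h₀ : c _ _ (fun _ : Unit => S.nizk.simInit) ≤ τ := hc.basic _ _ _ .simInit
  have h₁ := S.time_gameC_le ηH hc b A
  have h₂ : ((S.gameC ηH b A).queries : ℕ∞) ≤ 5 * A.queries + 20 := by
    exact_mod_cast S.queries_gameC_le ηH b A
  have h₃ := time_subst_le _ h (S.gameC ηH b A)
  simp only [prfReduction, lett, pair, ap, time, zero_add, add_zero]
  calc _ ≤ 1 * (τ + 1) + (A.time c + (50 * A.queries + 150) * (τ + 1) +
        (5 * A.queries + 20) * (2 * ((ρ + 1) * (τ + 1)))) := by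
        refine add_le_add (h₀.trans (by rw [one_mul]; exact le_self_add)) (h₃.trans ?_)
        gcongr
    _ = A.time c + ((50 * A.queries + 151) * (1 * (τ + 1)) + (10 * A.queries + 40) * (ρ + 1) *
        (τ + 1)) := by ring
    _ ≤ A.time c + ((50 * A.queries + 151) * ((ρ + 1) * (τ + 1)) + (10 * A.queries + 40) * (ρ + 1) *
        (τ + 1)) := by gcongr; exact le_add_self
    _ = A.time c + (60 * A.queries + 191) * (ρ + 1) * (τ + 1) := by ring
    -- 60 and 191 are enlarged to 70 and 231 so that the same time budget also covers `zkReduction`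
    -- with the extra unit of `abs_le_zkAdv`.
    _ ≤ _ := by gcongr <;> norm_num

/-- Hashes, proofs and verifications are simulated internally; only `prf` gates reach the oracle. -/
theorem queries_prfReduction_le (b : Bool) (A : S.AnonAdversary η γ) :
    (S.prfReduction ηH b A).queries ≤ A.queries + 1 := by
  have h : ∀ i, (S.prfOracleC i).gates (fun _ => 1) ≤ GameOracle.isPrf i := by
    intro i
    cases i with
    | hash => simp [prfOracleC, prfHashC, pair, gates]
    | prove => simp [prfOracleC, prfProveC, pair, gates]
    | verify =>
      refine (gates_subst_le (w := fun _ => 0) _ (fun _ => ?_) _).trans ?_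
      · simp [prfHashC, pair, gates]
      · rw [gates_const, mul_zero]; exact Nat.zero_le _
    | prf => simp [prfOracleC, prfEvalC, prfAsk, pair, gates, GameOracle.isPrf]
  have := (gates_subst_le _ h (S.gameC ηH b A)).trans (S.prfGates_gameC_le ηH b A)
  simpa [prfReduction, queries, lett, pair, ap, gates] using this

/-- The oracles of the game in terms of answers `hash` and `prove` of the zero-knowledge
experiment. -/
def zkOracles {M : Type → Type} [Monad M] [MonadLiftT PMF M]
    (h : ∀ i, S.ZKI.Query i → M (S.ZKI.Resp i)) : S.Oracles M where
  hash x := h ZKOracle.hash x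
  prove x := do
    let o ← (h ZKOracle.prove x : M (Opt S.nizk.Proof))
    match o with
    | .inl π => pure π
    | .inr () => S.freshProofC.run h x
  verify x := S.nizk.verify.run (M := M) (fun _ z => h ZKOracle.hash z) x
  prf x := pure (dyPRF S.pp x.1 x.2)

theorem run_zkProveC {M : Type → Type} [Monad M] [LawfulMonad M] [MonadLiftT PMF M]
    (h : ∀ i, S.ZKI.Query i → M (S.ZKI.Resp i)) (x) :
    S.zkProveC.run h x = (S.zkOracles h).prove x := by
  rw [zkProveC, run_opt]
  refine bind_congr fun o => ?_
  rcases o with π | ⟨⟩ <;> rfl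

theorem run_zkVerifyC {M : Type → Type} [Monad M] [MonadLiftT PMF M]
    (h : ∀ i, S.ZKI.Query i → M (S.ZKI.Resp i)) (x) :
    S.zkVerifyC.run h x = (S.zkOracles h).verify x :=
  run_relabel _ _ _ _

theorem run_zkReduction {M : Type → Type} [Monad M] [LawfulMonad M] [MonadLiftT PMF M]
    [LawfulMonadLiftT PMF M] (h : ∀ i, S.ZKI.Query i → M (S.ZKI.Resp i)) (b : Bool)
    (A : S.AnonAdversary η γ) :
    (S.zkReduction ηH b A).run h () = S.expG (S.zkOracles h) ηH b A := by
  rw [zkReduction, run_relabel, ← S.run_gameC]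
  congr 1
  funext i q
  cases i with
  | hash => rfl
  | prove => exact S.run_zkProveC h q
  | verify => exact S.run_zkVerifyC h q
  | prf => exact liftM_det _ _

/-- The oracles of the game with simulated proofs and the users' functions `f`. -/
def simOracles (f : ZMod p → ZMod p → G) : S.Oracles (StateT S.nizk.SimState PMF) where
  hash x s := S.nizk.simHash (s, x)
  prove x s := S.nizk.simGo (s, x.1)
  verify x := S.nizk.verify.run (M := StateT S.nizk.SimState PMF)
    (fun _ z s => S.nizk.simHash (s, z)) x
  prf x := pure (f x.1 x.2)

section PrfOracles

variable (h : ∀ i, (PRFI p G).Query i → PMF ((PRFI p G).Resp i))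

theorem run_prfHashC (x) (s : S.nizk.SimState) :
    S.prfHashC.run h (x, s) = S.nizk.simHash (s, x) := by
  simp only [prfHashC, run_seq, run_pair, run_snd, run_fst, pure_bind]
  rfl

theorem run_prfProveC (x) (s : S.nizk.SimState) :
    S.prfProveC.run h (x, s) = S.nizk.simGo (s, x.1) := by
  simp only [prfProveC, run_seq, run_pair, run_snd, run_fst, pure_bind]
  rfl

theorem run_prfVerifyC (x) (s : S.nizk.SimState) :
    S.prfVerifyC.run h (x, s) = S.nizk.verify.run (M := StateT S.nizk.SimState PMF)
      (fun _ z s => S.nizk.simHash (s, z)) x s := by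
  have hh : (fun (_ : OneOracle) (z : List Bool) (s : S.nizk.SimState) => S.prfHashC.run h (z, s)) =
      fun _ z s => S.nizk.simHash (s, z) := by
    funext _ z s
    exact S.run_prfHashC h z s
  exact (run_subst (I := roIface lam) h _ _ _ _).trans
    (congrArg (fun H => S.nizk.verify.run (M := StateT S.nizk.SimState PMF) H x s) hh)

theorem run_prfEvalC (F : ZMod p → G) (x) (s : S.nizk.SimState) :
    S.prfEvalC.run (M := PMF) (fun _ x => PMF.pure (F x)) (x, s) =
      PMF.pure (F (x.2 + x.1), s) := by
  simp only [prfEvalC, run_seq, run_pair, run_snd, run_fst, pure_bind, run_op, liftM_det]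
  change (pure (F (x.2 + x.1)) >>= fun y => pure (y, s) : PMF _) = _
  rw [pure_bind]
  rfl

end PrfOracles

theorem run_prfReduction (F : ZMod p → G) (b : Bool) (A : S.AnonAdversary η γ) :
    (S.prfReduction ηH b A).run (M := PMF) (fun _ x => PMF.pure (F x)) () =
      S.nizk.simInit >>= fun s =>
        S.expG (S.simOracles fun u x => F (x + u)) ηH b A s >>= fun r => pure r.1 := by
  have hO : (fun (i : GameOracle) (q : S.gameIface.Query i) (s : S.nizk.SimState) =>
      (S.prfOracleC i).run (M := PMF) (fun _ x => PMF.pure (F x)) (q, s)) =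
      (S.simOracles fun u x => F (x + u)).handler := by
    funext i q s
    cases i with
    | hash => exact S.run_prfHashC _ q s
    | prove => exact S.run_prfProveC _ q s
    | verify => exact S.run_prfVerifyC _ q s
    | prf => exact S.run_prfEvalC F q s
  simp only [prfReduction, run_lett, run_ap, run_drop, pure_bind, run_seq, run_fst]
  change (S.nizk.simInit >>= _) = _
  refine bind_congr fun s => ?_
  rw [run_subst, ← S.run_gameC, ← hO]
  rfl

end Reductions

end Scheme

/-! ### Supports and properties that hold with certainty -/

theorem pmf_bind_congr {X Y : Type} (e : PMF X) {f g : X → PMF Y}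
    (h : ∀ x ∈ e.support, f x = g x) : (e >>= f) = (e >>= g) := by
  change e.bind f = e.bind g
  ext y
  rw [PMF.bind_apply, PMF.bind_apply]
  refine tsum_congr fun x => ?_
  by_cases hx : x ∈ e.support
  · rw [h x hx]
  · rw [(PMF.apply_eq_zero_iff e x).2 hx, zero_mul, zero_mul]

theorem mem_support_bind {X Y : Type} {e : PMF X} {f : X → PMF Y} {y : Y} :
    y ∈ (e >>= f).support ↔ ∃ x ∈ e.support, y ∈ (f x).support :=
  PMF.mem_support_bind_iff e f y

theorem mem_support_pure {X : Type} {x y : X} : y ∈ (pure x : PMF X).support ↔ y = x :=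
  PMF.mem_support_pure_iff x y

theorem mem_support_iid {X : Type} (e : PMF X) : ∀ (n : ℕ) (xs : Fin n → X),
    xs ∈ (iid e n).support → ∀ i, xs i ∈ e.support
  | 0, _, _, i => i.elim0
  | n + 1, xs, h, i => by
    unfold iid at h
    simp only [mem_support_bind, mem_support_pure] at h
    obtain ⟨x, hx, ys, hys, rfl⟩ := h
    refine Fin.cases hx (fun j => ?_) i
    exact mem_support_iid e n ys hys j

/-- Every possible value of `m` satisfies `Q`. -/
def Ensures {W Y : Type} (Q : Y → Prop) (m : StateT W PMF Y) : Prop :=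
  ∀ w, ∀ r ∈ (m w).support, Q r.1

namespace Ensures

variable {W X Y : Type} {Q : Y → Prop}

theorem pure {y : Y} (h : Q y) : Ensures Q (Pure.pure y : StateT W PMF Y) := by
  intro w r hr
  have : r = (y, w) := mem_support_pure.1 hr
  rw [this]; exact h

theorem bind' {R : X → Prop} {m : StateT W PMF X} {f : X → StateT W PMF Y} (hm : Ensures R m)
    (hf : ∀ x, R x → Ensures Q (f x)) : Ensures Q (m >>= f) := by
  intro w r hr
  obtain ⟨a, ha, hr⟩ := mem_support_bind.1 (show r ∈ (m w >>= fun a => f a.1 a.2).support from hr)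
  exact hf a.1 (hm w a ha) a.2 r hr

theorem bind {m : StateT W PMF X} {f : X → StateT W PMF Y}
    (hf : ∀ x, Ensures Q (f x)) : Ensures Q (m >>= f) :=
  bind' (R := fun _ => True) (fun _ _ _ => trivial) fun x _ => hf x

theorem bind_congr {R : X → Prop} {m : StateT W PMF X} {f g : X → StateT W PMF Y}
    (hm : Ensures R m) (h : ∀ x, R x → f x = g x) : (m >>= f) = (m >>= g) := by
  funext w
  refine pmf_bind_congr (m w) ?_
  rintro ⟨a, w'⟩ ha
  exact congrFun (h a (hm w _ ha)) w'

end Ensures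

namespace Scheme

open Circuit

variable {p lam : ℕ} [Fact p.Prime] {G : Type} [CommGroup G]

/-! ### All statements proved in the game are true -/

section Invariant

variable (S : Scheme p lam G) {η γ : ℕ} (ηH : ℕ)

/-- The signatures of the users and of the ATMs are valid. -/
def ValidKeys (K : S.Keys η γ) : Prop :=
  (∀ i, S.zsgn.check (K.1.2.2.1.1, ((K.2.2 i).1, (K.2.2 i).2.1), (K.2.2 i).2.2.1) = true) ∧
    ∀ j, S.zsgn.check (K.1.2.2.2.1, ((K.2.1 j).1, 0), (K.2.1 j).2.1) = true

/-- Correctness of `zsgn` provides the witnesses for the statements of type `sig`. -/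
theorem validKeys_of_mem_support (K : S.Keys η γ) (h : K ∈ (S.setup η γ).support) :
    S.ValidKeys K := by
  unfold setup at h
  simp only [mem_support_bind, mem_support_pure] at h
  obtain ⟨B, hB, atms, hatms, users, husers, rfl⟩ := h
  unfold initBank at hB
  simp only [mem_support_bind, mem_support_pure] at hB
  obtain ⟨k, -, kb, -, kz, hkz, kz', hkz', rfl⟩ := hB
  refine ⟨fun i => ?_, fun j => ?_⟩
  · have := mem_support_iid _ _ _ husers i
    unfold initUser at this
    simp only [mem_support_bind, mem_support_pure] at this
    obtain ⟨sk, -, u, -, r, -, σ, hσ, k, -, h⟩ := this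
    dsimp only
    rw [h]
    exact S.zsgn.correct kz hkz (sk, u) r σ hσ
  · have := mem_support_iid _ _ _ hatms j
    unfold initATM at this
    simp only [mem_support_bind, mem_support_pure] at this
    obtain ⟨sk, -, r, -, σ, hσ, k, -, h⟩ := this
    dsimp only
    rw [h]
    exact S.zsgn.correct kz' hkz' (sk, 0) r σ hσ

variable {W : Type} (O₁ O₂ : S.Oracles (StateT W PMF))

/-- Two implementations of the oracles with the same random oracle, verifier and users' functions,
and the same proofs of true statements. -/
structure Oracles.Agree {S : Scheme p lam G} (O₁ O₂ : S.Oracles (StateT W PMF)) : Prop where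
  hash : O₁.hash = O₂.hash
  verify : O₁.verify = O₂.verify
  prf₁ : ∀ x, O₁.prf x = pure (dyPRF S.pp x.1 x.2)
  prf₂ : ∀ x, O₂.prf x = pure (dyPRF S.pp x.1 x.2)
  prove : ∀ x w, Rel S.pp S.zsgn x w → O₁.prove (x, w) = O₂.prove (x, w)

variable {S} {O₁ O₂}

theorem Oracles.Agree.prove_sig (hO : O₁.Agree O₂) {pk P m r σ} (h₁ : comm S.pp m r = P)
    (h₂ : S.zsgn.check (pk, m, σ) = true) :
    O₁.prove (.sig pk P, .sig m r σ) = O₂.prove (.sig pk P, .sig m r σ) :=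
  hO.prove _ _ ⟨h₁, h₂⟩

theorem Oracles.Agree.prove_voucher (hO : O₁.Agree O₂) {κ₁ κ₂ X Y Q id rc α₁ β₁ α₂ β₂ γ δ}
    (h₁ : κ₁ = comm₁ S.pp α₁ β₁) (h₂ : κ₂ = comm₁ S.pp α₂ β₂) (h₃ : Q = comm₁ S.pp γ δ)
    (hX : X = dyPRF S.pp α₁ id) (hY : Y = gpow S.pp.g γ * gpow (dyPRF S.pp α₂ 0) rc) :
    O₁.prove (.voucher κ₁ κ₂ X Y Q id rc, .voucher α₁ β₁ α₂ β₂ γ δ) =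
      O₂.prove (.voucher κ₁ κ₂ X Y Q id rc, .voucher α₁ β₁ α₂ β₂ γ δ) :=
  hO.prove _ _ ⟨h₁, h₂, h₃, hX, hY⟩

theorem Oracles.Agree.prove_spend (hO : O₁.Agree O₂) {P Z id rt α β γ}
    (h₁ : comm S.pp (α, γ) β = P) (h₂ : Z = gpow S.pp.g α * gpow (dyPRF S.pp γ id) rt) :
    O₁.prove (.spend P Z id rt, .spend α β γ) = O₂.prove (.spend P Z id rt, .spend α β γ) :=
  hO.prove _ _ ⟨h₁, h₂⟩

theorem withdrawG_congr (hO : O₁.Agree O₂) {K : S.Keys η γ} (hK : S.ValidKeys K) (i : Fin η) :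
    S.withdrawG O₁ K.1 (K.2.2 i) = S.withdrawG O₂ K.1 (K.2.2 i) := by
  unfold withdrawG
  refine bind_congr fun r => ?_
  rw [hO.prove_sig rfl (hK.1 i)]

theorem linkedG_congr (hO : O₁.Agree O₂) : S.linkedG O₁ = S.linkedG O₂ := by
  unfold linkedG
  rw [hO.verify]

theorem spendG_congr (hO : O₁.Agree O₂) (usr : S.UserKeys) {P : G} {r : ZMod p}
    (hP : comm S.pp (usr.1, usr.2.1) r = P) (rc : ZMod p) (pkm : G) (rv : Bits lam) :
    S.spendG O₁ usr P r rc pkm rv = S.spendG O₂ usr P r rc pkm rv := by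
  unfold spendG
  rw [hO.prf₁, hO.prf₂]
  simp only [pure_bind]
  rw [hO.prove_spend hP rfl]

theorem ensures_reqCoin (x : S.BankKeys × S.ATMKeys) :
    Ensures (fun coin => coin.2.2.2.1 = comm₁ S.pp coin.1.1 coin.1.2 ∧
        coin.2.2.2.2.1 = comm₁ S.pp coin.2.1.1 coin.2.1.2 ∧
        coin.2.2.2.2.2.1 = comm₁ S.pp x.2.1 coin.2.2.1)
      (liftM (S.reqCoin x) : StateT W PMF S.StoredCoin) := by
  intro w r hr
  obtain ⟨coin, hcoin, hr⟩ := mem_support_bind.1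
    (show r ∈ (S.reqCoin x >>= fun a => pure (a, w)).support from hr)
  rw [mem_support_pure] at hr
  subst hr
  unfold reqCoin at hcoin
  simp only [mem_support_bind, mem_support_pure] at hcoin
  obtain ⟨k₁, -, r₁, -, k₂, -, r₂, -, rQ, -, rb, -, σ, -, rfl⟩ := hcoin
  exact ⟨rfl, rfl, rfl⟩

theorem challengeG_congr (hO : O₁.Agree O₂) {K : S.Keys η γ} (hK : S.ValidKeys K) (i : Fin η)
    (j : Fin γ) (m : Fin η) : S.challengeG O₁ K i j m = S.challengeG O₂ K i j m := by
  unfold challengeG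
  rw [withdrawG_congr hO hK, linkedG_congr hO]
  have hw : Ensures (fun x : G × ZMod p × S.nizk.Proof =>
      comm S.pp ((K.2.2 i).1, (K.2.2 i).2.1) x.2.1 = x.1) (S.withdrawG O₂ K.1 (K.2.2 i)) :=
    Ensures.bind fun r => Ensures.bind fun π => Ensures.pure rfl
  refine hw.bind_congr fun x hx => ?_
  refine (ensures_reqCoin _).bind_congr fun coin hcoin => ?_
  dsimp only at hcoin
  have hi : S.issueG O₁ K.1 (K.2.1 j) coin x.1 x.2.2 = S.issueG O₂ K.1 (K.2.1 j) coin x.1 x.2.2 := by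
    unfold issueG
    dsimp only
    rw [hO.verify, hO.prove_sig hcoin.2.2.symm (hK.2 j),
      hO.prove_voucher hcoin.1 hcoin.2.1 hcoin.2.2 rfl rfl]
  rw [hi]
  refine bind_congr fun CV => ?_
  rcases CV with ⟨C, V⟩ | ⟨⟩
  · dsimp only
    simp only [spendG_congr hO _ hx]
  · rfl

/-- The stored commitments have the stored openings. -/
def SessionsOpen (K : S.Keys η γ) (l : List (Session p η G)) : Prop :=
  ∀ s ∈ l, comm S.pp ((K.2.2 s.1).1, (K.2.2 s.1).2.1) s.2.2.1 = s.2.1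

theorem withdrawOracleG_congr (hO : O₁.Agree O₂) {K : S.Keys η γ} (hK : S.ValidKeys K)
    (i : Fin η) (l : List (Session p η G)) (hl : SessionsOpen K l) :
    S.withdrawOracleG O₁ ηH K i l = S.withdrawOracleG O₂ ηH K i l ∧
      Ensures (fun r => SessionsOpen K r.2) (S.withdrawOracleG O₁ ηH K i l) := by
  unfold withdrawOracleG
  rw [withdrawG_congr hO hK]
  refine ⟨rfl, ?_⟩
  split_ifs
  · rw [stateT_lift_bind]
    simp only [stateT_modify_bind, stateT_pure]
    unfold withdrawG
    simp only [bind_assoc, pure_bind]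
    refine Ensures.bind fun r => Ensures.bind fun π => Ensures.pure ?_
    intro s hs
    rw [List.mem_append, List.mem_singleton] at hs
    rcases hs with hs | rfl
    · exact hl s hs
    · rfl
  · exact Ensures.pure hl

theorem spendOracleG_congr (hO : O₁.Agree O₂) (K : S.Keys η γ)
    (q : ℕ × S.Coin × S.Voucher × G × Bits lam) (l : List (Session p η G))
    (hl : SessionsOpen K l) :
    S.spendOracleG O₁ K q l = S.spendOracleG O₂ K q l ∧
      Ensures (fun r => SessionsOpen K r.2) (S.spendOracleG O₁ K q l) := by
  unfold spendOracleG
  rw [stateT_get_bind, stateT_get_bind]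
  rcases hs : l[q.1]? with _ | ⟨i, P, r, spent⟩
  · exact ⟨rfl, Ensures.pure hl⟩
  · have hP := hl _ (List.mem_of_getElem? hs)
    dsimp only at hP ⊢
    simp only [spendG_congr hO _ hP, linkedG_congr hO, true_and]
    rw [stateT_lift_bind]
    refine Ensures.bind fun ok => ?_
    split_ifs
    · simp only [stateT_lift_bind, stateT_set_bind, stateT_pure]
      refine Ensures.bind fun T => Ensures.pure ?_
      intro s hs
      rcases List.mem_or_eq_of_mem_set hs with hs | rfl
      · exact hl s hs
      · exact hP
    · exact Ensures.pure hl

theorem oracleG_congr (hO : O₁.Agree O₂) {K : S.Keys η γ} (hK : S.ValidKeys K)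
    (i) (q : (S.anonIface η).Query i) (l : List (Session p η G)) (hl : SessionsOpen K l) :
    S.oracleG O₁ ηH K i q l = S.oracleG O₂ ηH K i q l ∧
      Ensures (fun r => SessionsOpen K r.2) (S.oracleG O₁ ηH K i q l) := by
  cases i with
  | hash =>
    refine ⟨?_, ?_⟩
    · change (O₁.hash q >>= fun a => pure (a, l)) = (O₂.hash q >>= fun a => pure (a, l))
      rw [hO.hash]
    · change Ensures _ (O₁.hash q >>= fun a => pure (a, l))
      exact Ensures.bind fun _ => Ensures.pure hl
  | withdraw => exact withdrawOracleG_congr ηH hO hK q l hl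
  | spend => exact spendOracleG_congr hO K q l hl

theorem gameG_congr (hO : O₁.Agree O₂) {K : S.Keys η γ} (hK : S.ValidKeys K) (b : Bool)
    (A : S.AnonAdversary η γ) : S.gameG O₁ ηH b A K [] = S.gameG O₂ ηH b A K [] := by
  have hrun : ∀ {X Y : Type} (A : Circuit (S.anonIface η) X Y) (x : X) (l : List (Session p η G)),
      SessionsOpen K l → A.run (S.oracleG O₁ ηH K) x l = A.run (S.oracleG O₂ ηH K) x l ∧
        Ensures (fun r => SessionsOpen K r.2) (A.run (S.oracleG O₁ ηH K) x l) := by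
    intro X Y A x
    -- Preservation of the invariant is part of the relation, because the continuation after a
    -- `bind` is only known to agree on lists that satisfy it.
    refine run_rel₀ (M₁ := StateT (List (Session p η G)) (StateT W PMF))
      (M₂ := StateT (List (Session p η G)) (StateT W PMF)) _ _
      (fun Y m₁ m₂ => ∀ l, SessionsOpen K l → m₁ l = m₂ l ∧
        Ensures (fun r => SessionsOpen K r.2) (m₁ l)) ?_ ?_ ?_ ?_ A x
    · exact fun Y y l hl => ⟨rfl, Ensures.pure hl⟩
    · intro Y Z m₁ m₂ f g hm hf l hl
      refine ⟨?_, ?_⟩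
      · change (m₁ l >>= fun r => f r.1 r.2) = (m₂ l >>= fun r => g r.1 r.2)
        rw [← (hm l hl).1]
        exact (hm l hl).2.bind_congr fun r hr => (hf r.1 r.2 hr).1
      · change Ensures _ (m₁ l >>= fun r => f r.1 r.2)
        exact (hm l hl).2.bind' fun r hr => (hf r.1 r.2 hr).2
    · intro Y e l hl
      refine ⟨rfl, ?_⟩
      change Ensures _ ((liftM e : StateT W PMF Y) >>= fun a => pure (a, l))
      exact Ensures.bind fun _ => Ensures.pure hl
    · exact fun i q l hl => oracleG_congr ηH hO hK i q l hl
  unfold gameG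
  have h₀ : SessionsOpen K [] := by intro s hs; simp at hs
  rw [stateT_bind, stateT_bind, ← (hrun A.A₁ _ _ h₀).1]
  refine (hrun A.A₁ _ _ h₀).2.bind_congr ?_
  rintro ⟨⟨i₀, i₁, j, m, φ⟩, l⟩ hl
  dsimp only at hl ⊢
  by_cases h : i₀.val < ηH ∧ i₁.val < ηH ∧ i₀ ≠ i₁
  · rw [if_pos h, if_pos h, stateT_lift_bind, stateT_lift_bind, challengeG_congr hO hK]
    refine bind_congr fun o => ?_
    rcases o with ⟨C, V, T⟩ | ⟨⟩
    · exact (hrun A.A₂ _ _ hl).1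
    · rfl
  · rw [if_neg h, if_neg h]

/-- Oracles that differ only in their proofs of false statements cannot be told apart, since keys
from `setup` are valid and from then on a witness is always at hand. -/
theorem expG_congr (hO : O₁.Agree O₂) (b : Bool) (A : S.AnonAdversary η γ) :
    S.expG O₁ ηH b A = S.expG O₂ ηH b A := by
  unfold expG
  have h : Ensures (fun K => S.ValidKeys K) (liftM (S.setup η γ) : StateT W PMF (S.Keys η γ)) := by
    intro w r hr
    obtain ⟨K, hK, hr⟩ := mem_support_bind.1
      (show r ∈ (S.setup η γ >>= fun a => pure (a, w)).support from hr)
    rw [mem_support_pure] at hr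
    subst hr
    exact S.validKeys_of_mem_support K hK
  refine h.bind_congr fun K hK => ?_
  rw [gameG_congr ηH hO hK]

end Invariant

/-! ### Both sides of the zero-knowledge and PRF experiments as games -/

section ZK

variable (S : Scheme p lam G) {η γ : ℕ} (ηH : ℕ)

theorem zkOracles_prove {M : Type → Type} [Monad M] [LawfulMonad M] [MonadLiftT PMF M]
    (h : ∀ i, S.ZKI.Query i → M (S.ZKI.Resp i)) (x) (m : M S.nizk.Proof)
    (hm : h ZKOracle.prove x = (m >>= fun π => pure (.inl π) : M (Opt S.nizk.Proof))) :
    (S.zkOracles h).prove x = m := by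
  have key : ∀ k : Opt S.nizk.Proof → M S.nizk.Proof, (∀ π, k (.inl π) = pure π) →
      ((m >>= fun π => pure (.inl π) : M (Opt S.nizk.Proof)) >>= k) = m := by
    intro k hk
    rw [bind_assoc]
    simp only [pure_bind, hk, bind_pure]
  exact (congrArg (fun z : M (Opt S.nizk.Proof) => z >>= fun o => match o with
    | .inl π => pure π
    | .inr () => S.freshProofC.run h x) hm).trans (key _ fun _ => rfl)

open Classical in
theorem zkExp_false (b : Bool) (A : S.AnonAdversary η γ) :
    zkExp S.nizk false (S.zkReduction ηH b A) = S.anonExp ηH b A := by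
  have hO : Oracles.Agree (S.zkOracles (M := RO lam) (zkReal S.nizk)) S.realOracles := by
    refine ⟨rfl, rfl, fun _ => rfl, fun _ => rfl, fun x w h => ?_⟩
    exact S.zkOracles_prove (M := RO lam) (zkReal S.nizk) (x, w) (runRO S.nizk.prove (x, w)) (if_pos h)
  rw [anonExp_eq, ← expG_congr ηH hO]
  change (S.zkReduction ηH b A).run (M := RO lam) (zkReal S.nizk) () (emptyTable lam) >>= _ = _
  rw [run_zkReduction]
  rfl

/-- The experiment with simulated proofs and the users' functions `f`. -/
def simExp (f : ZMod p → ZMod p → G) (b : Bool) (A : S.AnonAdversary η γ) : PMF Bool := do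
  let s ← S.nizk.simInit
  let r ← S.expG (S.simOracles f) ηH b A s
  pure r.1

open Classical in
theorem zkExp_true (b : Bool) (A : S.AnonAdversary η γ) :
    zkExp S.nizk true (S.zkReduction ηH b A) = S.simExp ηH (dyPRF S.pp) b A := by
  have hO : Oracles.Agree (S.zkOracles (M := StateT S.nizk.SimState PMF) (zkSim S.nizk))
      (S.simOracles (dyPRF S.pp)) := by
    refine ⟨rfl, rfl, fun _ => rfl, fun _ => rfl, fun x w h => ?_⟩
    exact S.zkOracles_prove (M := StateT S.nizk.SimState PMF) (zkSim S.nizk) (x, w)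
      (fun s => S.nizk.simGo (s, x)) (if_pos h)
  unfold simExp
  rw [← expG_congr ηH hO]
  change S.nizk.simInit >>= (fun s =>
    (S.zkReduction ηH b A).run (M := StateT S.nizk.SimState PMF) (zkSim S.nizk) () s >>= _) = _
  simp only [run_zkReduction]
  rfl

theorem prfExp_true [Fintype G] (b : Bool) (A : S.AnonAdversary η γ) :
    prfExp (dyPRF S.pp) true (S.prfReduction ηH b A) = (do
      let k ← PMF.uniformOfFintype (ZMod p)
      S.simExp ηH (fun u x => dyPRF S.pp (u + k) x) b A) := by
  change (PMF.uniformOfFintype (ZMod p) >>= fun k => _) = _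
  refine bind_congr fun k => ?_
  rw [run_prfReduction]
  -- Key and argument enter only through `1 + k + x`, so shifting the argument by `u` is shifting
  -- the key by `u`.
  have : (fun u x => dyPRF S.pp k (x + u)) = fun u x => dyPRF S.pp (u + k) x := by
    funext u x
    unfold dyPRF
    congr 2
    ring
  rw [this]
  rfl

theorem prfExp_false [Fintype G] (b : Bool) (A : S.AnonAdversary η γ) :
    prfExp (dyPRF S.pp) false (S.prfReduction ηH b A) = (do
      let F ← PMF.uniformOfFintype (ZMod p → G)
      S.simExp ηH (fun u x => F (x + u)) b A) := by
  change (PMF.uniformOfFintype (ZMod p → G) >>= fun F => _) = _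
  refine bind_congr fun F => ?_
  rw [run_prfReduction]
  rfl

end ZK

end Scheme

/-! ### Uniform distributions in the group -/

theorem pmf_apply_pure_bind {X Y : Type} [DecidableEq Y] (e : PMF X) (f : X → Y) (y : Y) :
    (e >>= fun x => pure (f x) : PMF Y) y = ∑' x, if y = f x then e x else 0 := by
  change (e.bind fun x => PMF.pure (f x)) y = _
  rw [PMF.bind_apply]
  refine tsum_congr fun x => ?_
  rw [PMF.pure_apply]
  split_ifs <;> simp

theorem uniform_bind_pure {X Y : Type} [Fintype X] [Nonempty X] [Fintype Y] [Nonempty Y]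
    {f : X → Y} (hf : Function.Bijective f) :
    (PMF.uniformOfFintype X >>= fun x => pure (f x) : PMF Y) = PMF.uniformOfFintype Y := by
  classical
  ext y
  rw [pmf_apply_pure_bind]
  obtain ⟨x, rfl⟩ := hf.2 y
  rw [tsum_eq_single x]
  · rw [if_pos rfl, PMF.uniformOfFintype_apply, PMF.uniformOfFintype_apply,
      Fintype.card_of_bijective hf]
  · intro x' hx'
    rw [if_neg fun h => hx' (hf.1 h).symm]

section Group

variable {p : ℕ} [Fact p.Prime] {G : Type} [CommGroup G]

/-- A nonzero exponent is coprime to the group order `p`. This makes the spending token uniform when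
`r_t ≠ 0`. -/
theorem gpow_left_bijective (pp : GroupParams p G) {a : ZMod p} (ha : a ≠ 0) :
    Function.Bijective fun x : G => gpow x a := by
  have h : (Nat.card G).Coprime a.val := by
    rw [pp.card_eq, Nat.Prime.coprime_iff_not_dvd Fact.out]
    intro hd
    have := Nat.eq_zero_of_dvd_of_lt hd (ZMod.val_lt a)
    exact ha ((ZMod.val_eq_zero a).1 this)
  exact (powCoprime h).bijective

variable [Fintype G]

theorem gpow_bijective (pp : GroupParams p G) {x : G} (hx : x ≠ 1) :
    Function.Bijective fun r : ZMod p => gpow x r := by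
  have hc : Fintype.card G = p := by rw [← Nat.card_eq_fintype_card, pp.card_eq]
  rw [Fintype.bijective_iff_injective_and_card]
  refine ⟨fun a b h => ?_, by rw [hc, ZMod.card]⟩
  have ho : orderOf x = p := orderOf_eq_prime (by rw [← hc, pow_card_eq_one]) hx
  refine ZMod.val_injective p (pow_injOn_Iio_orderOf ?_ ?_ h)
  · rw [Set.mem_Iio, ho]; exact ZMod.val_lt a
  · rw [Set.mem_Iio, ho]; exact ZMod.val_lt b

/-- Perfect hiding: `h ^ r` is uniform because `h` generates the group, and the message part acts by
a translation. -/
theorem scalar_comm (pp : GroupParams p G) (m : ZMod p × ZMod p) :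
    (Scheme.scalar p >>= fun r => pure (comm pp m r) : PMF G) = PMF.uniformOfFintype G :=
  uniform_bind_pure (Function.Bijective.comp
    (Group.mulLeft_bijective (gpow pp.g₁ m.1 * gpow pp.g₂ m.2)) (gpow_bijective pp pp.h_ne))

end Group

namespace Scheme

open Circuit

variable {p lam : ℕ} [Fact p.Prime] {G : Type} [CommGroup G]

/-- Computations with the simulated random oracle. -/
abbrev SimM (S : Scheme p lam G) : Type → Type := StateT S.nizk.SimState PMF

/-- A withdrawal of an honest user, without the randomness of the commitment. -/
abbrev ESession (η : ℕ) (G : Type) : Type := Fin η × G × Bool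

/-- The keys without the honest users' pseudorandom function keys. -/
abbrev PublicView (S : Scheme p lam G) (η γ : ℕ) : Type :=
  S.BankKeys × (Fin γ → S.ATMKeys) × (Fin η → ZMod p × S.SigKeys × Opt S.UserKeys)

def userView (S : Scheme p lam G) {η : ℕ} (ηH : ℕ) (i : Fin η) (usr : S.UserKeys) :
    ZMod p × S.SigKeys × Opt S.UserKeys :=
  (usr.1, usr.2.2.2, if i.val < ηH then .inr () else .inl usr)

def publicView (S : Scheme p lam G) {η γ : ℕ} (ηH : ℕ) (K : S.Keys η γ) : S.PublicView η γ :=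
  (K.1, K.2.1, fun i => S.userView ηH i (K.2.2 i))

/-! ### The game without the honest users' PRF keys -/

section Ideal

variable (S : Scheme p lam G) [Fintype G] {η γ : ℕ} (ηH : ℕ)

/-- The oracles with simulated proofs, where the users' functions are not used. -/
def baseOracles : S.Oracles S.SimM := S.simOracles fun _ _ => 1

/-- A simulated proof. -/
def simProve (x : Stmt p G S.zsgn.PK) : S.SimM S.nizk.Proof := fun s => S.nizk.simGo (s, x)

/-- Neither the user's PRF key nor the randomness of the commitment occurs: `P` is drawn directly
from `G`, and the proof is simulated. -/
def withdrawE (E : S.PublicView η γ) (i : Fin η) :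
    StateT (List (ESession η G)) S.SimM (Opt (G × G × S.nizk.Proof)) :=
  if i.val < ηH then do
    let P ← (liftM (liftM (PMF.uniformOfFintype G) : S.SimM G) :
      StateT (List (ESession η G)) S.SimM G)
    let π ← (liftM (S.simProve (.sig E.1.2.2.1.1 P)) :
      StateT (List (ESession η G)) S.SimM S.nizk.Proof)
    modify (fun l => l ++ [(i, P, false)])
    pure (.inl (gpow S.pp.g (E.2.2 i).1, P, π))
  else pure (.inr ())

def spendE (sk : ZMod p) (P y : G) (rc : ZMod p) (pkm : G) (rv : Bits lam) : S.SimM S.Tx := do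
  let π ← S.simProve (.spend P (gpow S.pp.g sk * gpow y (S.hashTx (pkm, rv))) (rc + 1)
    (S.hashTx (pkm, rv)))
  pure (gpow S.pp.g sk * gpow y (S.hashTx (pkm, rv)), π, rv, S.hashTx (pkm, rv))

-- The function is evaluated at `H(P) + 1` instead of the voucher's `rc + 1`. The two agree for
-- accepted vouchers, and in this form the point is fixed by the session, before the adversary
-- supplies a voucher.
open Classical in
def spendOracleE (E : S.PublicView η γ) (F : Fin η → ZMod p → G)
    (x : ℕ × S.Coin × S.Voucher × G × Bits lam) :
    StateT (List (ESession η G)) S.SimM (Opt S.Tx) := do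
  let l ← get
  match l[x.1]? with
  | none => pure (.inr ())
  | some (i, P, spent) => do
      let ok ← (liftM (S.linkedG S.baseOracles E.1 x.2.1 x.2.2.1) :
        StateT (List (ESession η G)) S.SimM Bool)
      if ok = true ∧ x.2.2.1.1 = P ∧ spent = false then do
        let T ← (liftM (S.spendE (E.2.2 i).1 P (F i (S.hashCom P + 1)) x.2.2.1.2.2.2.2.2.2
          x.2.2.2.1 x.2.2.2.2) : StateT (List (ESession η G)) S.SimM S.Tx)
        set (l.set x.1 (i, P, true))
        pure (.inl T)
      else pure (.inr ())

def oracleE (E : S.PublicView η γ) (F : Fin η → ZMod p → G) :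
    ∀ i, (S.anonIface η).Query i → StateT (List (ESession η G)) S.SimM ((S.anonIface η).Resp i)
  | .hash, x => (liftM (S.baseOracles.hash x) : StateT (List (ESession η G)) S.SimM (Bits lam))
  | .withdraw, i => S.withdrawE ηH E i
  | .spend, x => S.spendOracleE E F x

/-- The part of the challenge that does not depend on the user: coin, voucher and the
merchant's randomness for the commitment `P`. -/
def issueE (E : S.PublicView η γ) (j : Fin γ) (P : G) :
    S.SimM (Opt ((S.Coin × S.Voucher) × Bits lam)) := do
  let π ← S.simProve (.sig E.1.2.2.1.1 P)
  let coin ← (liftM (S.reqCoin (E.1, E.2.1 j)) : S.SimM S.StoredCoin)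
  let CV ← S.issueG S.baseOracles E.1 (E.2.1 j) coin P π
  match CV with
  | .inr () => pure (.inr ())
  | .inl CV => do
      let ok ← S.linkedG S.baseOracles E.1 CV.1 CV.2
      if ok then do
        let rv ← (liftM (PMF.uniformOfFintype (Bits lam)) : S.SimM (Bits lam))
        pure (.inl (CV, rv))
      else pure (.inr ())

/-- The challenge for the user `i` with commitment `P`, where `y` is the value of the
user's function. -/
def challengeE (E : S.PublicView η γ) (i : Fin η) (j : Fin γ) (m : Fin η) (P y : G) :
    S.SimM (Opt (S.Coin × S.Voucher × S.Tx)) := do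
  let o ← S.issueE E j P
  match o with
  | .inr () => pure (.inr ())
  | .inl x => do
      let T ← S.spendE (E.2.2 i).1 P y x.1.2.2.2.2.2.2.2 (gpow S.pp.g (E.2.2 m).1) x.2
      pure (.inl (x.1.1, x.1.2, T))

/-- The input of the adversary. -/
def PublicView.input {S : Scheme p lam G} {η γ : ℕ} (E : S.PublicView η γ) : S.AdvInput η γ :=
  (E.1, E.2.1, fun i => (gpow S.pp.g (E.2.2 i).1, (E.2.2 i).2.1, (E.2.2 i).2.2))

/-- The game after the first stage of the adversary and the choice of the commitment `P`. -/
def restE (b : Bool) (A : S.AnonAdversary η γ) (E : S.PublicView η γ) (F : Fin η → ZMod p → G)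
    (x : Fin η × Fin η × Fin γ × Fin η × A.State) (P y : G) :
    StateT (List (ESession η G)) S.SimM Bool :=
  if x.1.val < ηH ∧ x.2.1.val < ηH ∧ x.1 ≠ x.2.1 then do
    let CVT ← (liftM (S.challengeE E (if b then x.2.1 else x.1) x.2.2.1 x.2.2.2.1 P y) :
      StateT (List (ESession η G)) S.SimM (Opt (S.Coin × S.Voucher × S.Tx)))
    match CVT with
    | .inr () => pure false
    | .inl (C, V, T) => A.A₂.run (S.oracleE ηH E F) (C, V, T, E.1, x.2.2.2.2)
  else pure false

/-- The game with simulated proofs, where the challenge uses the values `y`. It also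
returns the user of the challenge and the commitment. -/
def gameE (b : Bool) (A : S.AnonAdversary η γ) (E : S.PublicView η γ) (F : Fin η → ZMod p → G)
    (y : Fin η → G → G) : StateT (List (ESession η G)) S.SimM ((Fin η × G) × Bool) := do
  let x ← A.A₁.run (S.oracleE ηH E F) E.input
  -- `P` is drawn even for invalid choices, so that the point of the challenge is always defined.
  let P ← (liftM (liftM (PMF.uniformOfFintype G) : S.SimM G) :
      StateT (List (ESession η G)) S.SimM G)
  let r ← S.restE ηH b A E F x P (y (if b then x.2.1 else x.1) P)
  pure ((if b then x.2.1 else x.1, P), r)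

end Ideal

/-! ### Erasing the openings of the commitments -/

section Erase

variable {S : Scheme p lam G} {η γ : ℕ} (ηH : ℕ)

def eraseRnd (s : Session p η G) : ESession η G := (s.1, s.2.1, s.2.2.2)

/-- Since only honest users have sessions, the family `F` need agree with the users' functions for
honest users only. -/
def Honest (l : List (Session p η G)) : Prop := ∀ s ∈ l, s.1.val < ηH

/-- `m₂` is `m₁` without the randomness of the commitments. -/
def Erases {Y : Type} (m₁ : StateT (List (Session p η G)) S.SimM Y)
    (m₂ : StateT (List (ESession η G)) S.SimM Y) : Prop :=
  ∀ l, Honest ηH l → (m₁ l >>= fun r => pure (r.1, r.2.map eraseRnd)) = m₂ (l.map eraseRnd) ∧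
    Ensures (fun r => Honest ηH r.2) (m₁ l)

theorem erases_pure {Y : Type} (y : Y) :
    Erases ηH (pure y : StateT (List (Session p η G)) S.SimM Y) (pure y) := by
  intro l hl
  refine ⟨?_, Ensures.pure hl⟩
  rw [stateT_pure, stateT_pure, pure_bind]

theorem ensures_linkedG (O : S.Oracles S.SimM) (B : S.BankKeys) (C : S.Coin) (V : S.Voucher) :
    Ensures (fun ok => ok = true → V.2.2.2.2.2.2 = S.hashCom V.1) (S.linkedG O B C V) := by
  unfold linkedG
  refine Ensures.bind fun _ => Ensures.bind fun _ => Ensures.bind fun _ => Ensures.pure ?_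
  intro h
  simp only [Bool.and_eq_true, decide_eq_true_eq] at h
  exact h.1.1.1.1

theorem ensures_issueG (O : S.Oracles S.SimM) (B : S.BankKeys) (atm : S.ATMKeys)
    (coin : S.StoredCoin) (P : G) (π : S.nizk.Proof) :
    Ensures (fun o => ∀ x, o = .inl x → x.2.2.2.2.2.2.2 = S.hashCom P)
      (S.issueG O B atm coin P π) := by
  unfold issueG
  refine Ensures.bind fun ok => ?_
  cases ok
  · exact Ensures.pure fun x hx => by simp at hx
  · refine Ensures.bind fun _ => Ensures.bind fun _ => Ensures.pure fun x hx => ?_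
    rw [← Sum.inl.inj hx]

variable (f : ZMod p → ZMod p → G) (K : S.Keys η γ) (F : Fin η → ZMod p → G)

theorem spendG_eq (usr : S.UserKeys) (P : G) (r rc : ZMod p) (pkm : G) (rv : Bits lam) :
    S.spendG (S.simOracles f) usr P r rc pkm rv =
      S.spendE usr.1 P (f usr.2.1 (rc + 1)) rc pkm rv := by
  unfold spendG spendE
  simp only [simOracles, pure_bind]
  rfl

theorem erases_hash (x : List Bool) :
    Erases ηH (liftM ((S.simOracles f).hash x) : StateT (List (Session p η G)) S.SimM (Bits lam))
      (liftM (S.baseOracles.hash x) : StateT (List (ESession η G)) S.SimM (Bits lam)) := by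
  intro l hl
  refine ⟨?_, ?_⟩
  · change (((S.simOracles f).hash x >>= fun a => pure (a, l)) >>= _) =
      (S.baseOracles.hash x >>= fun a => pure (a, _))
    simp only [bind_assoc, pure_bind]
    rfl
  · change Ensures _ ((S.simOracles f).hash x >>= fun a => pure (a, l))
    exact Ensures.bind fun _ => Ensures.pure hl

variable {F}

theorem erases_spend (hF : ∀ i : Fin η, i.val < ηH → F i = f (K.2.2 i).2.1)
    (q : ℕ × S.Coin × S.Voucher × G × Bits lam) :
    Erases ηH (S.spendOracleG (S.simOracles f) K q)
      (S.spendOracleE (S.publicView ηH K) F q) := by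
  intro l hl
  unfold spendOracleG spendOracleE
  rw [stateT_get_bind, stateT_get_bind, List.getElem?_map]
  rcases hs : l[q.1]? with _ | ⟨i, P, r, spent⟩
  · exact erases_pure ηH _ l hl
  · have hi : i.val < ηH := hl _ (List.mem_of_getElem? hs)
    dsimp only [Option.map_some, eraseRnd]
    rw [stateT_lift_bind, stateT_lift_bind]
    refine ⟨?_, ?_⟩
    · rw [bind_assoc]
      refine (ensures_linkedG (S.simOracles f) K.1 q.2.1 q.2.2.1).bind_congr fun ok hok => ?_
      by_cases h : ok = true ∧ q.2.2.1.1 = P ∧ spent = false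
      · rw [if_pos h, if_pos h]
        simp only [stateT_lift_bind, stateT_set_bind, stateT_pure, bind_assoc, pure_bind,
          List.map_set]
        -- The link check gives `rc = H(V.1)` and the user's test gives `V.1 = P`, so the two
        -- evaluation points coincide.
        rw [spendG_eq, hok h.1, h.2.1, hF i hi]
        rfl
      · rw [if_neg h, if_neg h]
        exact (erases_pure ηH _ l hl).1
    · refine Ensures.bind fun ok => ?_
      split_ifs
      · simp only [stateT_lift_bind, stateT_set_bind, stateT_pure]
        refine Ensures.bind fun T => Ensures.pure ?_
        intro s hs
        rcases List.mem_or_eq_of_mem_set hs with hs | rfl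
        · exact hl s hs
        · exact hi
      · exact Ensures.pure hl

/-- The challenge after the choice of the commitment. -/
def challengeRest (usr : S.UserKeys) (j : Fin γ) (m : Fin η) (x : G × S.nizk.Proof) :
    S.SimM (Opt (S.Coin × S.Voucher × S.Tx)) := do
  let coin ← (liftM (S.reqCoin (K.1, K.2.1 j)) : S.SimM S.StoredCoin)
  let CV ← S.issueG S.baseOracles K.1 (K.2.1 j) coin x.1 x.2
  match CV with
  | .inr () => pure (.inr ())
  | .inl (C, V) => do
      let ok ← S.linkedG S.baseOracles K.1 C V
      if ok then do
        let rv ← (liftM (PMF.uniformOfFintype (Bits lam)) : S.SimM (Bits lam))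
        let T ← S.spendE usr.1 x.1 (f usr.2.1 (V.2.2.2.2.2.2 + 1)) V.2.2.2.2.2.2
          (gpow S.pp.g (K.2.2 m).1) rv
        pure (.inl (C, V, T))
      else pure (.inr ())

theorem challengeG_eq_bind (i : Fin η) (j : Fin γ) (m : Fin η) :
    S.challengeG (S.simOracles f) K i j m =
      S.withdrawG (S.simOracles f) K.1 (K.2.2 i) >>= fun x =>
        challengeRest f K (K.2.2 i) j m (x.1, x.2.2) := by
  unfold challengeG challengeRest
  refine bind_congr fun x => ?_
  simp only [spendG_eq]
  rfl

theorem challengeRest_bind (hF : ∀ i : Fin η, i.val < ηH → F i = f (K.2.2 i).2.1) (i : Fin η)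
    (hi : i.val < ηH) (j : Fin γ) (m : Fin η) (P : G) :
    (S.simProve (.sig K.1.2.2.1.1 P) >>= fun π => challengeRest f K (K.2.2 i) j m (P, π)) =
      S.challengeE (S.publicView ηH K) i j m P (F i (S.hashCom P + 1)) := by
  unfold challengeE issueE challengeRest
  rw [bind_assoc]
  refine bind_congr fun π => ?_
  rw [bind_assoc]
  refine bind_congr fun coin => ?_
  rw [bind_assoc]
  refine (ensures_issueG _ _ _ _ _ _).bind_congr fun CV hCV => ?_
  rcases CV with ⟨C, V⟩ | ⟨⟩
  · have hV : V.2.2.2.2.2.2 = S.hashCom P := hCV _ rfl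
    dsimp only
    rw [bind_assoc]
    refine bind_congr fun ok => ?_
    cases ok
    · rw [if_neg Bool.false_ne_true, if_neg Bool.false_ne_true, pure_bind]
    · rw [if_pos rfl, if_pos rfl, bind_assoc]
      refine bind_congr fun rv => ?_
      rw [pure_bind, hF i hi]
      dsimp only
      rw [hV]
      rfl
  · rw [pure_bind]

variable [Fintype G]

theorem bind_scalar_comm {W X : Type} (pp : GroupParams p G) (m : ZMod p × ZMod p)
    (f : G → StateT W PMF X) :
    ((liftM (scalar p) : StateT W PMF (ZMod p)) >>= fun r => f (comm pp m r)) =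
      (liftM (PMF.uniformOfFintype G) : StateT W PMF G) >>= f := by
  rw [← scalar_comm pp m]
  funext w
  change ((scalar p >>= fun a => pure (a, w)) >>= fun r => f (comm pp m r.1) r.2) =
    (((scalar p >>= fun r => pure (comm pp m r)) >>= fun a => pure (a, w)) >>= fun r => f r.1 r.2)
  simp only [bind_assoc, pure_bind]

/-- The simulated proof ignores its witness and `k` does not see the randomness of the commitment,
so only `P` matters, which is uniform by `scalar_comm`. -/
theorem withdrawG_bind {X : Type} (i : Fin η) (k : G × S.nizk.Proof → S.SimM X) :
    (S.withdrawG (S.simOracles f) K.1 (K.2.2 i) >>= fun x => k (x.1, x.2.2)) =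
      (liftM (PMF.uniformOfFintype G) : S.SimM G) >>= fun P =>
        S.simProve (.sig K.1.2.2.1.1 P) >>= fun π => k (P, π) := by
  rw [← bind_scalar_comm S.pp ((K.2.2 i).1, (K.2.2 i).2.1)]
  unfold withdrawG
  simp only [bind_assoc, pure_bind]
  rfl

theorem erases_withdraw (i : Fin η) :
    Erases ηH (S.withdrawOracleG (S.simOracles f) ηH K i)
      (S.withdrawE ηH (S.publicView ηH K) i) := by
  intro l hl
  unfold withdrawOracleG withdrawE
  by_cases hi : i.val < ηH
  · rw [if_pos hi, if_pos hi]
    simp only [stateT_lift_bind, stateT_modify_bind, stateT_pure, bind_assoc, pure_bind]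
    refine ⟨?_, ?_⟩
    · refine (withdrawG_bind f K i fun y =>
        (pure (.inl (gpow S.pp.g (K.2.2 i).1, y.1, y.2), l.map eraseRnd ++ [(i, y.1, false)]) :
          S.SimM (Opt (G × G × S.nizk.Proof) × List (ESession η G)))).symm.trans ?_ |>.symm
      refine bind_congr fun r => ?_
      simp only [List.map_append, List.map_cons, List.map_nil]
      rfl
    · refine Ensures.bind fun r => Ensures.pure ?_
      intro s hs
      rw [List.mem_append, List.mem_singleton] at hs
      rcases hs with hs | rfl
      · exact hl s hs
      · exact hi
  · rw [if_neg hi, if_neg hi]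
    exact erases_pure ηH _ l hl

theorem erases_run (hF : ∀ i : Fin η, i.val < ηH → F i = f (K.2.2 i).2.1) {X Y : Type}
    (A : Circuit (S.anonIface η) X Y) (x : X) :
    Erases ηH (A.run (S.oracleG (S.simOracles f) ηH K) x)
      (A.run (S.oracleE ηH (S.publicView ηH K) F) x) := by
  refine run_rel₀ (M₁ := StateT (List (Session p η G)) S.SimM)
    (M₂ := StateT (List (ESession η G)) S.SimM) _ _
    (fun Y m₁ m₂ => Erases ηH m₁ m₂) ?_ ?_ ?_ ?_ A x
  · exact fun Y y => erases_pure ηH y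
  · intro Y Z m₁ m₂ f g hm hf l hl
    refine ⟨?_, ?_⟩
    · change ((m₁ l >>= fun r => f r.1 r.2) >>= _) = (m₂ (l.map eraseRnd) >>= fun r => g r.1 r.2)
      rw [← (hm l hl).1, bind_assoc, bind_assoc]
      simp only [pure_bind]
      exact (hm l hl).2.bind_congr fun r hr => (hf r.1 r.2 hr).1
    · change Ensures _ (m₁ l >>= fun r => f r.1 r.2)
      exact (hm l hl).2.bind' fun r hr => (hf r.1 r.2 hr).2
  · intro Y e l hl
    refine ⟨?_, ?_⟩
    · change (((liftM e : S.SimM Y) >>= fun a => pure (a, l)) >>= _) =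
        ((liftM e : S.SimM Y) >>= fun a => pure (a, _))
      simp only [bind_assoc, pure_bind]
    · change Ensures _ ((liftM e : S.SimM Y) >>= fun a => pure (a, l))
      exact Ensures.bind fun _ => Ensures.pure hl
  · intro i q
    cases i with
    | hash => exact erases_hash ηH f q
    | withdraw => exact erases_withdraw ηH f K q
    | spend => exact erases_spend ηH f K hF q

theorem challengeG_eq (hF : ∀ i : Fin η, i.val < ηH → F i = f (K.2.2 i).2.1) (i : Fin η)
    (hi : i.val < ηH) (j : Fin γ) (m : Fin η) :
    S.challengeG (S.simOracles f) K i j m =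
      (liftM (PMF.uniformOfFintype G) : S.SimM G) >>= fun P =>
        S.challengeE (S.publicView ηH K) i j m P (F i (S.hashCom P + 1)) := by
  rw [challengeG_eq_bind, withdrawG_bind f K i (challengeRest f K (K.2.2 i) j m)]
  exact bind_congr fun P => challengeRest_bind ηH f K hF i hi j m P

theorem liftM_bind_const {W X Y : Type} (e : PMF X) (m : StateT W PMF Y) :
    ((liftM e : StateT W PMF X) >>= fun _ => m) = m := by
  funext w
  change ((e >>= fun a => pure (a, w)) >>= fun r => m r.2) = m w
  simp only [bind_assoc, pure_bind]
  exact PMF.bind_const e (m w)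

theorem gameG_eq (hF : ∀ i : Fin η, i.val < ηH → F i = f (K.2.2 i).2.1) (b : Bool)
    (A : S.AnonAdversary η γ) :
    (S.gameG (S.simOracles f) ηH b A K [] >>= fun r => pure r.1) =
      S.gameE ηH b A (S.publicView ηH K) F (fun i P => F i (S.hashCom P + 1)) [] >>= fun r =>
        pure r.1.2 := by
  have h₀ : Honest ηH ([] : List (Session p η G)) := by intro s hs; simp at hs
  have h₁ := erases_run ηH f K hF A.A₁ (S.advInput ηH K) [] h₀
  unfold gameG gameE
  rw [stateT_bind, stateT_bind, bind_assoc, bind_assoc]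
  have h₂ : A.A₁.run (S.oracleE ηH (S.publicView ηH K) F) (S.publicView ηH K).input [] = _ :=
    h₁.1.symm
  rw [h₂, bind_assoc]
  refine h₁.2.bind_congr ?_
  rintro ⟨⟨i₀, i₁, j, m, φ⟩, l⟩ hl
  rw [pure_bind]
  unfold restE
  dsimp only at hl ⊢
  by_cases h : i₀.val < ηH ∧ i₁.val < ηH ∧ i₀ ≠ i₁
  · have hi : (if b then i₁ else i₀).val < ηH := by split_ifs; exacts [h.2.1, h.1]
    simp only [if_pos h]
    rw [stateT_lift_bind, stateT_lift_bind, challengeG_eq ηH f K hF _ hi, bind_assoc, bind_assoc,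
      bind_assoc]
    refine bind_congr fun P => ?_
    rw [stateT_bind, stateT_lift_bind, bind_assoc, bind_assoc]
    refine bind_congr fun o => ?_
    rcases o with ⟨C, V, T⟩ | ⟨⟩
    · have h₃ := erases_run ηH f K hF A.A₂ (C, V, T, K.1, φ) l hl
      have h₄ : A.A₂.run (S.oracleE ηH (S.publicView ηH K) F)
        (C, V, T, (S.publicView ηH K).1, φ) (l.map eraseRnd) = _ := h₃.1.symm
      dsimp only
      rw [h₄]
      simp only [bind_assoc, pure_bind, stateT_pure]
    · simp only [stateT_pure, pure_bind]
  · simp only [if_neg h]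
    -- For invalid choices the commitment drawn by `gameE` is discarded.
    rw [stateT_lift_bind, bind_assoc]
    simp only [pure_bind, stateT_pure]
    rw [liftM_bind_const]

/-- The values of `F` for dishonest users are free. `simExp_shift` makes them constant, to remove
any dependence on those keys; `prfExp_false_apply` takes `shifts` for all users. -/
theorem simExp_eq (F : S.Keys η γ → Fin η → ZMod p → G)
    (hF : ∀ K (i : Fin η), i.val < ηH → F K i = f (K.2.2 i).2.1) (b : Bool)
    (A : S.AnonAdversary η γ) :
    S.simExp ηH f b A = (do
      let s ← S.nizk.simInit
      let K ← S.setup η γ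
      let r ← S.gameE ηH b A (S.publicView ηH K) (F K) (fun i P => F K i (S.hashCom P + 1)) [] s
      pure r.1.1.2) := by
  unfold simExp
  refine bind_congr fun s => ?_
  unfold expG
  rw [stateT_bind]
  change (((S.setup η γ >>= fun K => pure (K, s)) >>= fun r =>
    (S.gameG (S.simOracles f) ηH b A r.1 [] >>= fun r => pure r.1) r.2) >>= fun r => pure r.1) = _
  simp only [bind_assoc, pure_bind]
  refine bind_congr fun K => ?_
  rw [gameG_eq ηH f K (hF K)]
  rw [stateT_bind, bind_assoc]
  simp only [stateT_pure, pure_bind]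

end Erase

end Scheme

/-- The joint law of independent variables is determined by their marginals. -/
theorem iid_bind_congr {X Y : Type} (e : PMF X) : ∀ {n : ℕ} (g g' : Fin n → X → Y),
    (∀ i, (e >>= fun x => pure (g i x) : PMF Y) = e >>= fun x => pure (g' i x)) →
    (iid e n >>= fun xs => pure (fun i => g i (xs i)) : PMF (Fin n → Y)) =
      iid e n >>= fun xs => pure (fun i => g' i (xs i))
  | 0, g, g', _ => by
    congr 1
    funext xs
    congr 1
    funext i
    exact i.elim0
  | n + 1, g, g', h => by
    have key : ∀ g : Fin (n + 1) → X → Y,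
        (iid e (n + 1) >>= fun xs => pure (fun i => g i (xs i)) : PMF (Fin (n + 1) → Y)) =
          (e >>= fun x => pure (g 0 x)) >>= fun y =>
            (iid e n >>= fun xs => pure (fun i => g i.succ (xs i))) >>= fun ys =>
              pure (Fin.cons y ys) := by
      intro g
      have hi : iid e (n + 1) = e >>= fun x => iid e n >>= fun xs => pure (Fin.cons x xs) := rfl
      rw [hi]
      simp only [bind_assoc, pure_bind]
      refine bind_congr fun x => bind_congr fun xs => ?_
      congr 1
      funext i
      refine Fin.cases rfl (fun j => ?_) i
      simp
    rw [key, key, h 0, iid_bind_congr e (fun i => g i.succ) (fun i => g' i.succ) fun i => h i.succ]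

theorem pmf_bind_const {X Y : Type} (e : PMF X) (m : PMF Y) : (e >>= fun _ => m) = m :=
  PMF.bind_const e m

namespace Scheme

open Circuit

variable {p lam : ℕ} [Fact p.Prime] {G : Type} [CommGroup G]

/-! ### Shifting all PRF keys by a common amount -/

section Shift

variable (S : Scheme p lam G) {η γ : ℕ} (ηH : ℕ)

theorem scalar_add_bind {X : Type} (k : ZMod p) (f : ZMod p → PMF X) :
    (scalar p >>= fun u => f (u + k)) = scalar p >>= f := by
  have h : (scalar p >>= fun u => pure (u + k) : PMF (ZMod p)) = scalar p :=
    uniform_bind_pure (Equiv.addRight k).bijective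
  conv_rhs => rw [← h, bind_assoc]
  simp only [pure_bind]

/-- The view of a user's keys and the user's function. -/
def keyView (f : ZMod p → ZMod p → G) (i : Fin η) (usr : S.UserKeys) :
    (ZMod p × S.SigKeys × Opt S.UserKeys) × (ZMod p → G) :=
  (S.userView ηH i usr, if i.val < ηH then f usr.2.1 else fun _ => 1)

/-- For an honest user, `u` enters only through the function, and `u + k` is as uniform as `u`. For
a dishonest user, whose key is visible, the function is constant. -/
theorem keyView_shift (f : ZMod p → ZMod p → G) (k : ZMod p) (B : S.BankKeys) (i : Fin η) :
    (S.initUser B >>= fun usr => pure (S.keyView ηH (fun u => f (u + k)) i usr)) =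
      S.initUser B >>= fun usr => pure (S.keyView ηH f i usr) := by
  unfold keyView userView
  by_cases hi : i.val < ηH
  · simp only [if_pos hi]
    unfold initUser
    -- The signature on `(sk, u)` and the randomness it was issued for are not in an honest user's
    -- view and integrate out.
    simp only [bind_assoc, pure_bind, pmf_bind_const]
    refine bind_congr fun sk => ?_
    exact scalar_add_bind k fun u => S.sgn.keyGen >>= fun a => pure
      (((sk, a, .inr ()), f u) : (ZMod p × S.SigKeys × Opt S.UserKeys) × (ZMod p → G))
  · simp only [if_neg hi]

variable [Fintype G]

/-- Given the bank's keys, the users' keys are independent and the game sees them through `keyView`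
only, so a shift by the same `k` for all users is harmless. -/
theorem simExp_shift (f : ZMod p → ZMod p → G) (k : ZMod p) (b : Bool) (A : S.AnonAdversary η γ) :
    S.simExp ηH (fun u => f (u + k)) b A = S.simExp ηH f b A := by
  have key : ∀ f : ZMod p → ZMod p → G, S.simExp ηH f b A = (do
      let s ← S.nizk.simInit
      let B ← S.initBank
      let atms ← iid (S.initATM B) γ
      let w ← iid (S.initUser B) η >>= fun users => pure (fun i => S.keyView ηH f i (users i))
      let r ← S.gameE ηH b A (B, atms, fun i => (w i).1) (fun i => (w i).2)
        (fun i P => (w i).2 (S.hashCom P + 1)) [] s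
      pure r.1.1.2) := by
    intro f
    rw [simExp_eq ηH f (fun K i => if i.val < ηH then f (K.2.2 i).2.1 else fun _ => 1)
      fun K i hi => if_pos hi]
    unfold setup
    simp only [bind_assoc, pure_bind]
    rfl
  rw [key, key]
  refine bind_congr fun s => bind_congr fun B => bind_congr fun atms => ?_
  rw [iid_bind_congr _ _ _ fun i => S.keyView_shift ηH f k B i]

/-- For every fixed `k` the game with keys `u_i + k` equals the one with keys `u_i`; hence the PRF
step loses no factor in the number of users. -/
theorem prfExp_true_eq (b : Bool) (A : S.AnonAdversary η γ) :
    prfExp (dyPRF S.pp) true (S.prfReduction ηH b A) = S.simExp ηH (dyPRF S.pp) b A := by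
  rw [prfExp_true]
  have h : ∀ k, S.simExp ηH (fun u x => dyPRF S.pp (u + k) x) b A =
      S.simExp ηH (dyPRF S.pp) b A := fun k => S.simExp_shift ηH (dyPRF S.pp) k b A
  simp only [h, pmf_bind_const]

end Shift

end Scheme

/-- Expectation. -/
def ev {X : Type} (m : PMF X) (g : X → ℝ≥0∞) : ℝ≥0∞ := ∑' x, m x * g x

/-! ### Calculus of expectations -/

section Expectation

variable {X Y W σ : Type}

theorem ev_pure (x : X) (g : X → ℝ≥0∞) : ev (pure x) g = g x := by
  classical
  change ∑' y, PMF.pure x y * g y = g x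
  rw [tsum_eq_single x]
  · rw [PMF.pure_apply, if_pos rfl, one_mul]
  · intro y hy
    rw [PMF.pure_apply, if_neg hy, zero_mul]

theorem ev_bind (m : PMF X) (k : X → PMF Y) (g : Y → ℝ≥0∞) :
    ev (m >>= k) g = ev m fun x => ev (k x) g := by
  change ∑' y, (m.bind k) y * g y = _
  unfold ev
  simp only [PMF.bind_apply, ← ENNReal.tsum_mul_right, ← ENNReal.tsum_mul_left]
  rw [ENNReal.tsum_comm]
  simp only [mul_assoc]

theorem ev_mono (m : PMF X) {g g' : X → ℝ≥0∞} (h : ∀ x, g x ≤ g' x) : ev m g ≤ ev m g' :=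
  ENNReal.tsum_le_tsum fun x => mul_le_mul_right (h x) _

theorem ev_add (m : PMF X) (g g' : X → ℝ≥0∞) :
    (ev m fun x => g x + g' x) = ev m g + ev m g' := by
  unfold ev
  simp only [mul_add]
  exact ENNReal.tsum_add

theorem ev_sum {ι : Type} (s : Finset ι) (m : PMF X) (g : ι → X → ℝ≥0∞) :
    (ev m fun x => ∑ i ∈ s, g i x) = ∑ i ∈ s, ev m (g i) := by
  unfold ev
  simp only [Finset.mul_sum]
  exact Summable.tsum_finsetSum fun _ _ => ENNReal.summable

theorem ev_mul_right (m : PMF X) (g : X → ℝ≥0∞) (c : ℝ≥0∞) :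
    (ev m fun x => g x * c) = ev m g * c := by
  unfold ev
  simp only [← mul_assoc]
  exact ENNReal.tsum_mul_right

theorem ev_const (m : PMF X) (c : ℝ≥0∞) : (ev m fun _ => c) = c := by
  unfold ev
  rw [ENNReal.tsum_mul_right, m.tsum_coe, one_mul]

theorem ev_le_of_le (m : PMF X) {g : X → ℝ≥0∞} {c : ℝ≥0∞} (h : ∀ x, g x ≤ c) : ev m g ≤ c :=
  (ev_mono m h).trans_eq (ev_const m c)

theorem ev_le_ev_add (m : PMF X) {g g' : X → ℝ≥0∞} {c : ℝ≥0∞} (h : ∀ x, g x ≤ g' x + c) :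
    ev m g ≤ ev m g' + c :=
  (ev_mono m h).trans_eq (by rw [ev_add, ev_const])

theorem ev_comm (m : PMF X) (m' : PMF Y) (g : X → Y → ℝ≥0∞) :
    (ev m fun x => ev m' (g x)) = ev m' fun y => ev m fun x => g x y := by
  unfold ev
  simp only [← ENNReal.tsum_mul_left]
  rw [ENNReal.tsum_comm]
  refine tsum_congr fun y => tsum_congr fun x => ?_
  ring

theorem ev_eq_zero {m : PMF X} {g : X → ℝ≥0∞} (h : ∀ x ∈ m.support, g x = 0) : ev m g = 0 := by
  unfold ev
  rw [ENNReal.tsum_eq_zero]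
  intro x
  by_cases hx : x ∈ m.support
  · rw [h x hx, mul_zero]
  · rw [(PMF.apply_eq_zero_iff m x).2 hx, zero_mul]

theorem ev_uniform [Fintype X] [Nonempty X] (g : X → ℝ≥0∞) :
    ev (PMF.uniformOfFintype X) g = (Fintype.card X : ℝ≥0∞)⁻¹ * ∑ x, g x := by
  unfold ev
  rw [tsum_fintype, Finset.mul_sum]
  simp only [PMF.uniformOfFintype_apply]

theorem ev_uniform_comp [Fintype X] [Nonempty X] {f : X → X} (hf : Function.Bijective f)
    (g : X → ℝ≥0∞) :
    (ev (PMF.uniformOfFintype X) fun x => g (f x)) = ev (PMF.uniformOfFintype X) g := by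
  rw [ev_uniform, ev_uniform, hf.sum_comp g]

theorem ev_uniform_indicator [Fintype X] [Nonempty X] (q : X → Prop) [DecidablePred q] :
    (ev (PMF.uniformOfFintype X) fun x => if q x then 1 else 0) =
      ENNReal.ofReal ((Nat.card {x // q x} : ℝ) / Fintype.card X) := by
  rw [ev_uniform, Finset.sum_boole, Nat.card_eq_fintype_card, Fintype.card_subtype,
    ENNReal.ofReal_div_of_pos (by exact_mod_cast Fintype.card_pos), ENNReal.ofReal_natCast,
    ENNReal.ofReal_natCast, mul_comm, div_eq_mul_inv]

theorem ev_bool (e : PMF Bool) : (ev e fun b => if b then 1 else 0) = e true := by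
  unfold ev
  rw [tsum_fintype, Fintype.sum_bool]
  simp

theorem ev_liftM (e : PMF X) (w : W) (g : X × W → ℝ≥0∞) :
    ev ((liftM e : StateT W PMF X) w) g = ev e fun x => g (x, w) := by
  change ev (e >>= fun x => pure (x, w)) g = _
  rw [ev_bind]
  simp only [ev_pure]

theorem ev_bind₁ (m : StateT W PMF X) (k : X → StateT W PMF Y) (w : W) (g : Y × W → ℝ≥0∞) :
    ev ((m >>= k) w) g = ev (m w) fun r => ev (k r.1 r.2) g :=
  ev_bind (m w) _ g

theorem ev_pure₁ (x : X) (w : W) (g : X × W → ℝ≥0∞) :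
    ev ((pure x : StateT W PMF X) w) g = g (x, w) := ev_pure (x, w) g

theorem ev_lift (e : StateT W PMF X) (l : σ) (w : W) (g : (X × σ) × W → ℝ≥0∞) :
    ev ((liftM e : StateT σ (StateT W PMF) X) l w) g = ev (e w) fun r => g ((r.1, l), r.2) := by
  change ev (e w >>= fun r => pure ((r.1, l), r.2)) g = _
  rw [ev_bind]
  simp only [ev_pure]

theorem ev_bind₂ (m : StateT σ (StateT W PMF) X) (k : X → StateT σ (StateT W PMF) Y) (l : σ) (w : W)
    (g : (Y × σ) × W → ℝ≥0∞) :
    ev ((m >>= k) l w) g = ev (m l w) fun r => ev (k r.1.1 r.1.2 r.2) g :=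
  ev_bind (m l w) _ g

theorem ev_pure₂ (x : X) (l : σ) (w : W) (g : (X × σ) × W → ℝ≥0∞) :
    ev ((pure x : StateT σ (StateT W PMF) X) l w) g = g ((x, l), w) := ev_pure ((x, l), w) g

theorem ev_eq_zero_of_ensures {m : StateT W PMF X} {Q : X → Prop} (h : Ensures Q m) (w : W)
    {g : X × W → ℝ≥0∞} (hg : ∀ r, Q r.1 → g r = 0) : ev (m w) g = 0 :=
  ev_eq_zero fun r hr => hg r (h w r hr)

/-- A random function and a random value: exchanging the value at `x` with the random value. -/
theorem ev_uniform_swap [Fintype X] [DecidableEq X] [Fintype Y] [Nonempty Y] (x : X)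
    (H : (X → Y) → Y → ℝ≥0∞) (hH : ∀ f y z, H (Function.update f x z) y = H f y) :
    (ev (PMF.uniformOfFintype (X → Y)) fun f => H f (f x)) =
      ev (PMF.uniformOfFintype (X → Y)) fun f => ev (PMF.uniformOfFintype Y) fun y => H f y := by
  -- As `H` ignores the value at `x`, that value may be overwritten by an unused `y`. Exchanging `f
  -- x` and `y` is then an involution of pairs, which preserves the uniform sum.
  have h₁ : (ev (PMF.uniformOfFintype (X → Y)) fun f => H f (f x)) =
      ev (PMF.uniformOfFintype (X → Y)) fun f => ev (PMF.uniformOfFintype Y) fun y =>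
        H (Function.update f x y) (f x) := by
    simp only [hH, ev_const]
  rw [h₁]
  simp only [ev_uniform, ← Finset.mul_sum]
  congr 2
  simp only [← Fintype.sum_prod_type']
  have hinv : Function.Involutive fun z : (X → Y) × Y => (Function.update z.1 x z.2, z.1 x) := by
    intro z
    simp
  exact hinv.bijective.sum_comp fun z : (X → Y) × Y => H z.1 z.2

end Expectation

attribute [irreducible] ev

namespace Scheme

open Circuit

variable {p lam : ℕ} [Fact p.Prime] {G : Type} [CommGroup G]

/-! ### Changing the random function at an unused point -/

section Bad

variable (S : Scheme p lam G) {η γ : ℕ} (ηH : ℕ) (u : Fin η → ZMod p)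

/-- The point at which the random function is used for a withdrawal by the user `i` with
commitment `P`. -/
def point (i : Fin η) (P : G) : ZMod p := S.hashCom P + 1 + u i

/-- The point `x` is used for a withdrawal in the list. -/
def Hit (x : ZMod p) (l : List (ESession η G)) : Prop := ∃ s ∈ l, S.point u s.1 s.2.1 = x

/-- The users' functions, derived from a single function. -/
def shifts (f : ZMod p → G) (i : Fin η) (q : ZMod p) : G := f (q + u i)

variable {S u}

theorem Hit.append {x : ZMod p} {l : List (ESession η G)} (h : S.Hit u x l) (l') :
    S.Hit u x (l ++ l') := by
  obtain ⟨s, hs, hx⟩ := h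
  exact ⟨s, List.mem_append_left _ hs, hx⟩

/-- The point of a session depends on its user and commitment only, not on whether it has been
spent. -/
theorem hit_set_iff {x : ZMod p} {l : List (ESession η G)} {n : ℕ} {i : Fin η} {P : G} {b : Bool}
    (hn : l[n]? = some (i, P, b)) (b' : Bool) :
    S.Hit u x (l.set n (i, P, b')) ↔ S.Hit u x l := by
  have key : ∀ m : List (ESession η G), S.Hit u x m ↔
      ∃ z ∈ m.map (fun s => (s.1, s.2.1)), S.point u z.1 z.2 = x := by
    intro m
    simp [Hit]
  rw [key, key, List.map_set]
  have : (l.map fun s => (s.1, s.2.1)).set n (i, P) = l.map fun s => (s.1, s.2.1) := by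
    apply List.ext_getElem?
    intro k
    rw [List.getElem?_set]
    split_ifs with h₁ h₂
    · subst h₁
      simp [hn]
    · subst h₁
      rw [List.length_map] at h₂
      simp [List.getElem?_eq_none (Nat.le_of_not_lt h₂)] at hn
    · rfl
  rw [this]

variable (S u)

/-- The executions agree as long as `x` is not used. -/
def AgreeOff (x : ZMod p) {Y : Type} (m m' : StateT (List (ESession η G)) S.SimM Y) : Prop :=
  ∀ l, (∀ w (g : (Y × List (ESession η G)) × S.nizk.SimState → ℝ≥0∞),
      (∀ r, S.Hit u x r.1.2 → g r = 0) → ev (m l w) g = ev (m' l w) g) ∧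
    (S.Hit u x l → Ensures (fun r => S.Hit u x r.2) (m l))

variable {S u} {x : ZMod p}

theorem AgreeOff.pure {Y : Type} (y : Y) : S.AgreeOff u x (Pure.pure y) (Pure.pure y) :=
  fun _ => ⟨fun _ _ _ => rfl, fun hl => Ensures.pure hl⟩

/-- Agreement up to a bad event composes because the event is persistent: after a hit, the
continuation keeps the hit and contributes 0 to the expectation of `g`. -/
theorem AgreeOff.bind {Y Z : Type} {m m' : StateT (List (ESession η G)) S.SimM Y}
    {k k' : Y → StateT (List (ESession η G)) S.SimM Z} (hm : S.AgreeOff u x m m')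
    (hk : ∀ y, S.AgreeOff u x (k y) (k' y)) : S.AgreeOff u x (m >>= k) (m' >>= k') := by
  intro l
  refine ⟨fun w g hg => ?_, fun hl => ?_⟩
  · rw [ev_bind₂, ev_bind₂, (hm l).1]
    · congr 1
      funext r
      exact (hk r.1.1 r.1.2).1 r.2 g hg
    · intro r hr
      exact ev_eq_zero_of_ensures ((hk r.1.1 r.1.2).2 hr) r.2 hg
  · change Ensures _ (m l >>= fun r => k r.1 r.2)
    exact ((hm l).2 hl).bind' fun r hr => (hk r.1 r.2).2 hr

theorem AgreeOff.lift {Y : Type} (e : S.SimM Y) :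
    S.AgreeOff u x (liftM e : StateT (List (ESession η G)) S.SimM Y) (liftM e) := by
  refine fun l => ⟨fun _ _ _ => rfl, fun hl => ?_⟩
  change Ensures _ (e >>= fun a => Pure.pure (a, l))
  exact Ensures.bind fun _ => Ensures.pure hl

theorem ensures_hit_spend (E : S.PublicView η γ) (F : Fin η → ZMod p → G)
    (q : ℕ × S.Coin × S.Voucher × G × Bits lam) (l : List (ESession η G)) (hl : S.Hit u x l) :
    Ensures (fun r => S.Hit u x r.2) (S.spendOracleE E F q l) := by
  unfold spendOracleE
  rw [stateT_get_bind]
  rcases hs : l[q.1]? with _ | ⟨i, P, spent⟩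
  · exact Ensures.pure hl
  · dsimp only
    rw [stateT_lift_bind]
    refine Ensures.bind fun ok => ?_
    split_ifs
    · simp only [stateT_lift_bind, stateT_set_bind, stateT_pure]
      exact Ensures.bind fun T => Ensures.pure ((hit_set_iff hs true).2 hl)
    · exact Ensures.pure hl

/-- A spend evaluates `f` only at the point of its session. If no session has point `x`, the change
at `x` is invisible; otherwise both expectations vanish. -/
theorem AgreeOff.spend (E : S.PublicView η γ) (f : ZMod p → G) (z : G)
    (q : ℕ × S.Coin × S.Voucher × G × Bits lam) :
    S.AgreeOff u x (S.spendOracleE E (shifts u (Function.update f x z)) q)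
      (S.spendOracleE E (shifts u f) q) := by
  refine fun l => ⟨fun w g hg => ?_, ensures_hit_spend E _ q l⟩
  by_cases hl : S.Hit u x l
  · rw [ev_eq_zero_of_ensures (ensures_hit_spend E _ q l hl) w hg,
      ev_eq_zero_of_ensures (ensures_hit_spend E _ q l hl) w hg]
  · congr 1
    apply congrFun
    unfold spendOracleE
    rw [stateT_get_bind, stateT_get_bind]
    rcases hs : l[q.1]? with _ | ⟨i, P, spent⟩
    · rfl
    · have hne : S.hashCom P + 1 + u i ≠ x := fun h => hl ⟨_, List.mem_of_getElem? hs, h⟩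
      have hF : shifts u (Function.update f x z) i (S.hashCom P + 1) =
          shifts u f i (S.hashCom P + 1) := Function.update_of_ne hne _ _
      dsimp only
      rw [hF]

variable [Fintype G]

theorem AgreeOff.withdraw (E : S.PublicView η γ) (i : Fin η) :
    S.AgreeOff u x (S.withdrawE ηH E i) (S.withdrawE ηH E i) := by
  refine fun l => ⟨fun _ _ _ => rfl, fun hl => ?_⟩
  unfold withdrawE
  split_ifs
  · simp only [stateT_lift_bind, stateT_modify_bind, stateT_pure]
    exact Ensures.bind fun _ => Ensures.bind fun _ => Ensures.pure (hl.append _)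
  · exact Ensures.pure hl

theorem AgreeOff.run (E : S.PublicView η γ) (f : ZMod p → G) (z : G) {X Y : Type}
    (A : Circuit (S.anonIface η) X Y) (a : X) :
    S.AgreeOff u x (A.run (S.oracleE ηH E (shifts u (Function.update f x z))) a)
      (A.run (S.oracleE ηH E (shifts u f)) a) := by
  refine run_rel₀ (M₁ := StateT (List (ESession η G)) S.SimM)
    (M₂ := StateT (List (ESession η G)) S.SimM) _ _
    (fun Y m₁ m₂ => S.AgreeOff u x m₁ m₂) ?_ ?_ ?_ ?_ A a
  · exact fun Y y => AgreeOff.pure y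
  · exact fun hm hk => hm.bind hk
  · exact fun Y e => AgreeOff.lift (liftM e : S.SimM Y)
  · intro i q
    cases i with
    | hash => exact AgreeOff.lift (S.baseOracles.hash q)
    | withdraw => exact AgreeOff.withdraw ηH E q
    | spend => exact AgreeOff.spend E f z q

/-- The challenge takes its value from `y`, the same on both sides, so the function matters only
through the sessions. -/
theorem AgreeOff.game (b : Bool) (A : S.AnonAdversary η γ) (E : S.PublicView η γ)
    (f : ZMod p → G) (z : G) (y : Fin η → G → G) :
    S.AgreeOff u x (S.gameE ηH b A E (shifts u (Function.update f x z)) y)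
      (S.gameE ηH b A E (shifts u f) y) := by
  unfold gameE
  refine AgreeOff.bind (AgreeOff.run ηH E f z A.A₁ _) fun a => ?_
  refine AgreeOff.bind (AgreeOff.lift _) fun P => ?_
  refine AgreeOff.bind ?_ fun r => AgreeOff.pure _
  unfold restE
  by_cases h : a.1.val < ηH ∧ a.2.1.val < ηH ∧ a.1 ≠ a.2.1
  · simp only [if_pos h]
    refine AgreeOff.bind (AgreeOff.lift (S.challengeE E _ _ _ P _)) fun o => ?_
    rcases o with ⟨C, V, T⟩ | ⟨⟩
    · exact AgreeOff.run ηH E f z A.A₂ _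
    · exact AgreeOff.pure false
  · simp only [if_neg h]
    exact AgreeOff.pure false

end Bad

/-! ### Potentials that grow with the number of withdrawals -/

section Potential

variable {S : Scheme p lam G} {η γ : ℕ} (ηH : ℕ)

variable {φ : List (ESession η G) → ℝ≥0∞} {κ : ℝ≥0∞}

/-- The computation increases the potential by at most `c` on average. -/
def Raises (φ : List (ESession η G) → ℝ≥0∞) (c : ℝ≥0∞) {Y : Type}
    (m : StateT (List (ESession η G)) S.SimM Y) : Prop :=
  ∀ l w, (ev (m l w) fun r => φ r.1.2) ≤ φ l + c

theorem Raises.mono {c c' : ℝ≥0∞} (h : c ≤ c') {Y : Type}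
    {m : StateT (List (ESession η G)) S.SimM Y} (hm : Raises φ c m) : Raises φ c' m :=
  fun l w => (hm l w).trans (by gcongr)

theorem Raises.pure {Y : Type} (y : Y) :
    Raises φ 0 (Pure.pure y : StateT (List (ESession η G)) S.SimM Y) := by
  intro l w
  rw [ev_pure₂, add_zero]

theorem Raises.bind {c c' : ℝ≥0∞} {Y Z : Type} {m : StateT (List (ESession η G)) S.SimM Y}
    {k : Y → StateT (List (ESession η G)) S.SimM Z} (hm : Raises φ c m)
    (hk : ∀ y, Raises φ c' (k y)) : Raises φ (c + c') (m >>= k) := by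
  intro l w
  rw [ev_bind₂]
  refine (ev_mono _ (g' := fun r => φ r.1.2 + c') fun r => hk r.1.1 r.1.2 r.2).trans ?_
  rw [ev_add, ev_const, ← add_assoc]
  gcongr
  exact hm l w

theorem Raises.lift {Y : Type} (e : S.SimM Y) :
    Raises φ 0 (liftM e : StateT (List (ESession η G)) S.SimM Y) := by
  intro l w
  rw [ev_lift]
  exact (ev_const _ _).trans_le le_self_add

variable [Fintype G]

/-- A potential that every withdrawal increases by at most `κ` on average. -/
structure Potential (φ : List (ESession η G) → ℝ≥0∞) (κ : ℝ≥0∞) : Prop where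
  withdraw : ∀ l i, (ev (PMF.uniformOfFintype G) fun P => φ (l ++ [(i, P, false)])) ≤ φ l + κ
  spend : ∀ (l : List (ESession η G)) n i P b b', l[n]? = some (i, P, b) →
    φ (l.set n (i, P, b')) ≤ φ l

theorem Raises.withdraw (hφ : Potential φ κ) (E : S.PublicView η γ) (i : Fin η) :
    Raises φ κ (S.withdrawE ηH E i) := by
  intro l w
  unfold withdrawE
  split_ifs
  · rw [ev_bind₂, ev_lift, ev_liftM]
    refine le_trans (le_of_eq ?_) (hφ.withdraw l i)
    congr 1
    funext P
    simp only [stateT_lift_bind, stateT_modify_bind, stateT_pure, ev_bind₁, ev_pure, ev_const]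
  · rw [ev_pure₂]
    exact le_self_add

theorem Raises.spend (hφ : Potential φ κ) (E : S.PublicView η γ) (F : Fin η → ZMod p → G)
    (q : ℕ × S.Coin × S.Voucher × G × Bits lam) : Raises φ 0 (S.spendOracleE E F q) := by
  intro l w
  rw [add_zero]
  unfold spendOracleE
  rw [stateT_get_bind]
  rcases hs : l[q.1]? with _ | ⟨i, P, spent⟩
  · exact (ev_pure₂ _ l w _).le
  · dsimp only
    rw [ev_bind₂, ev_lift]
    refine ev_le_of_le _ fun r => ?_
    split_ifs
    · simp only [stateT_lift_bind, stateT_set_bind, stateT_pure, ev_bind₁, ev_pure, ev_const]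
      exact hφ.spend l _ i P spent true hs
    · exact (ev_pure₂ _ l _ _).le

/-- `run_rel` serves as an induction on the circuit: the second execution is ignored, and the budget
counts withdrawal gates, the only ones that may raise the potential. -/
theorem Raises.run (hφ : Potential φ κ) (E : S.PublicView η γ) (F : Fin η → ZMod p → G)
    {X Y : Type} (A : Circuit (S.anonIface η) X Y) (a : X) :
    Raises φ (A.gates AnonOracle.isWithdraw * κ) (A.run (S.oracleE ηH E F) a) := by
  refine run_rel (M₁ := StateT (List (ESession η G)) S.SimM)
    (M₂ := StateT (List (ESession η G)) S.SimM) _ (S.oracleE ηH E F) AnonOracle.isWithdraw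
    (fun n Y m _ => Raises φ (n * κ) m) ?_ ?_ ?_ ?_ ?_ A a
  · exact fun h hm => hm.mono (by gcongr)
  · intro Y y
    simpa using Raises.pure (φ := φ) y
  · intro m n Y Z a b f g hm hk
    have := hm.bind hk
    rwa [← add_mul, ← Nat.cast_add] at this
  · intro Y e
    exact (Raises.lift (liftM e : S.SimM Y)).mono zero_le
  · intro i q
    cases i with
    | hash => exact Raises.mono zero_le (Raises.lift (S.baseOracles.hash q))
    | withdraw => exact Raises.mono (by simp [AnonOracle.isWithdraw]) (Raises.withdraw ηH hφ E q)
    | spend => exact Raises.mono zero_le (Raises.spend hφ E F q)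

theorem Raises.rest (hφ : Potential φ κ) (E : S.PublicView η γ) (F : Fin η → ZMod p → G)
    (b : Bool) (A : S.AnonAdversary η γ) (a : Fin η × Fin η × Fin γ × Fin η × A.State) (P y : G) :
    Raises φ (A.A₂.gates AnonOracle.isWithdraw * κ) (S.restE ηH b A E F a P y) := by
  unfold restE
  by_cases h : a.1.val < ηH ∧ a.2.1.val < ηH ∧ a.1 ≠ a.2.1
  · simp only [if_pos h]
    rw [← zero_add (_ * κ)]
    refine Raises.bind (Raises.lift (S.challengeE E _ _ _ P y)) fun o => ?_
    rcases o with ⟨C, V, T⟩ | ⟨⟩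
    · exact Raises.run ηH hφ E F A.A₂ _
    · exact Raises.mono zero_le (Raises.pure false)
  · simp only [if_neg h]
    exact Raises.mono zero_le (Raises.pure false)

end Potential

end Scheme

namespace Scheme

open Circuit

variable {p lam : ℕ} [Fact p.Prime] {G : Type} [CommGroup G]

/-- Indicator of a proposition. -/
def ind (q : Prop) : ℝ≥0∞ := open Classical in if q then 1 else 0

theorem ind_pos {q : Prop} (h : q) : ind q = 1 := if_pos h

theorem ind_neg {q : Prop} (h : ¬q) : ind q = 0 := if_neg h

theorem ite_eq_ind (b : Bool) : (if b then 1 else 0 : ℝ≥0∞) = ind (b = true) := by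
  cases b <;> simp [ind]

theorem ind_le_one (q : Prop) : ind q ≤ 1 := by
  by_cases h : q
  · rw [ind_pos h]
  · rw [ind_neg h]; exact zero_le

theorem ind_mono {q q' : Prop} (h : q → q') : ind q ≤ ind q' := by
  by_cases hq : q
  · rw [ind_pos (h hq)]; exact ind_le_one q
  · rw [ind_neg hq]; exact zero_le

theorem ind_or_le (q q' : Prop) : ind (q ∨ q') ≤ ind q + ind q' := by
  by_cases h : q
  · rw [ind_pos h]; exact (ind_le_one _).trans le_self_add
  · by_cases h' : q'
    · rw [ind_pos h']; exact (ind_le_one _).trans le_add_self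
    · rw [ind_neg (not_or.2 ⟨h, h'⟩)]; exact zero_le

/-! ### Expectations bounded by the masses of the hash functions -/

section Masses

variable (S : Scheme p lam G)

theorem hashMass_nonneg : 0 ≤ S.hashMass := Real.iSup_nonneg fun _ => by positivity

theorem zeroMass_nonneg : 0 ≤ S.zeroMass := Real.iSup_nonneg fun _ => by positivity

theorem ev_hashCom_le [Fintype G] (v : ZMod p) :
    (ev (PMF.uniformOfFintype G) fun P => ind (S.hashCom P = v)) ≤ ENNReal.ofReal S.hashMass := by
  classical
  have h := ev_uniform_indicator (X := G) fun P => S.hashCom P = v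
  have h' : (fun P => ind (S.hashCom P = v)) = fun P => if S.hashCom P = v then 1 else 0 := by
    funext P
    unfold ind
    congr
  rw [h', h, ← Nat.card_eq_fintype_card (α := G), S.pp.card_eq]
  exact ENNReal.ofReal_le_ofReal (le_ciSup
    (f := fun v : ZMod p => (Nat.card {P : G // S.hashCom P = v} : ℝ) / p)
    (Set.finite_range _).bddAbove v)

theorem ev_hashTx_le [Fintype G] (y : G) :
    (ev (PMF.uniformOfFintype (Bits lam)) fun r => ind (S.hashTx (y, r) = 0)) ≤
      ENNReal.ofReal S.zeroMass := by
  classical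
  have h := ev_uniform_indicator (X := Bits lam) fun r => S.hashTx (y, r) = 0
  have h' : (fun r => ind (S.hashTx (y, r) = 0)) = fun r => if S.hashTx (y, r) = 0 then 1 else 0 := by
    funext P
    unfold ind
    congr
  have hc : (Fintype.card (Bits lam) : ℝ) = 2 ^ lam := by simp
  rw [h', h, hc]
  exact ENNReal.ofReal_le_ofReal (le_ciSup
    (f := fun y : G => (Nat.card {r : Bits lam // S.hashTx (y, r) = 0} : ℝ) / 2 ^ lam)
    (Set.finite_range _).bddAbove y)

end Masses

/-! ### The probability of a collision -/

section Bad

variable (S : Scheme p lam G) [Fintype G] {η γ : ℕ} (ηH : ℕ) (u : Fin η → ZMod p)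

/-- Bounds the expected number of sessions that exist when the challenge is made. -/
theorem potential_length : Potential (G := G) (η := η) (fun l => (l.length : ℝ≥0∞)) 1 where
  withdraw l i := by simp [ev_const]
  spend l n i P b b' h := by simp

theorem ev_point_le (i : Fin η) (x : ZMod p) :
    (ev (PMF.uniformOfFintype G) fun P => ind (S.point u i P = x)) ≤
      ENNReal.ofReal S.hashMass := by
  refine (ev_mono _ fun P => ind_mono fun h => ?_).trans (S.ev_hashCom_le (x - u i - 1))
  rw [← h, point]
  ring

/-- For sessions opened after the challenge: `x` is already fixed and each new commitment is
uniform. -/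
theorem potential_hit (x : ZMod p) :
    Potential (fun l => ind (S.Hit u x l)) (ENNReal.ofReal S.hashMass) where
  withdraw l i := by
    have h : ∀ P, ind (S.Hit u x (l ++ [(i, P, false)])) ≤
        ind (S.Hit u x l) + ind (S.point u i P = x) := by
      intro P
      refine (ind_mono ?_).trans (ind_or_le _ _)
      rintro ⟨s, hs, hx⟩
      rw [List.mem_append, List.mem_singleton] at hs
      rcases hs with hs | rfl
      · exact Or.inl ⟨s, hs, hx⟩
      · exact Or.inr hx
    refine (ev_mono _ h).trans ?_
    rw [ev_add, ev_const]
    gcongr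
    exact S.ev_point_le u i x
  spend l n i P b b' h := by rw [hit_set_iff h]

/-- For sessions opened before the challenge: the list is fixed and the commitment of the challenge
is uniform, so a union bound applies. -/
theorem ev_hit_le (i : Fin η) (l : List (ESession η G)) :
    (ev (PMF.uniformOfFintype G) fun P => ind (S.Hit u (S.point u i P) l)) ≤
      l.length * ENNReal.ofReal S.hashMass := by
  induction l with
  | nil =>
    refine ev_le_of_le _ fun P => ?_
    rw [ind_neg (by rintro ⟨s, hs, -⟩; simp at hs)]
    exact zero_le
  | cons s l ih =>
    have h : ∀ P, ind (S.Hit u (S.point u i P) (s :: l)) ≤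
        ind (S.Hit u (S.point u i P) l) + ind (S.point u i P = S.point u s.1 s.2.1) := by
      intro P
      refine (ind_mono ?_).trans (ind_or_le _ _)
      rintro ⟨s', hs, hx⟩
      rcases List.mem_cons.1 hs with rfl | hs
      · exact Or.inr hx.symm
      · exact Or.inl ⟨s', hs, hx⟩
    refine (ev_mono _ h).trans ?_
    rw [ev_add, List.length_cons, Nat.cast_add, Nat.cast_one, add_mul, one_mul]
    exact add_le_add ih (S.ev_point_le u i _)

variable {S}

/-- The point of the challenge is used by a withdrawal. -/
def Collides (r : (((Fin η × G) × Bool) × List (ESession η G)) × S.nizk.SimState) : Prop :=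
  S.Hit u (S.point u r.1.1.1.1 r.1.1.1.2) r.1.2

theorem ev_gameE (b : Bool) (A : S.AnonAdversary η γ) (E : S.PublicView η γ)
    (F : Fin η → ZMod p → G) (y : Fin η → G → G) (w : S.nizk.SimState)
    (g : (((Fin η × G) × Bool) × List (ESession η G)) × S.nizk.SimState → ℝ≥0∞) :
    ev (S.gameE ηH b A E F y [] w) g =
      ev (A.A₁.run (S.oracleE ηH E F) E.input [] w) fun r =>
        ev (PMF.uniformOfFintype G) fun P =>
          ev (S.restE ηH b A E F r.1.1 P (y (if b then r.1.1.2.1 else r.1.1.1) P) r.1.2 r.2)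
            fun r' => g ((((if b then r.1.1.2.1 else r.1.1.1, P), r'.1.1), r'.1.2), r'.2) := by
  unfold gameE
  simp only [ev_bind₂, ev_pure₂, ev_lift, ev_liftM]

/-- Sessions of the first stage are handled by the randomness of the challenge commitment, sessions
of the second stage by their own. As `F` and `y` are arbitrary, the bound holds in the real and in
the ideal game alike. -/
theorem ev_collides_le (b : Bool) (A : S.AnonAdversary η γ) (E : S.PublicView η γ)
    (F : Fin η → ZMod p → G) (y : Fin η → G → G) (w : S.nizk.SimState) :
    (ev (S.gameE ηH b A E F y [] w) fun r => ind (Collides u r)) ≤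
      A.withdrawals * ENNReal.ofReal S.hashMass := by
  rw [ev_gameE]
  have h₂ : ∀ (i : Fin η) a P y' l w, (ev (S.restE ηH b A E F a P y' l w) fun r =>
      ind (S.Hit u (S.point u i P) r.1.2)) ≤ ind (S.Hit u (S.point u i P) l) +
        A.A₂.gates AnonOracle.isWithdraw * ENNReal.ofReal S.hashMass :=
    fun i a P y' l w => Raises.rest ηH (S.potential_hit u _) E F b A a P _ l w
  have h₁ : (ev (A.A₁.run (S.oracleE ηH E F) E.input [] w) fun r => (r.1.2.length : ℝ≥0∞)) ≤
      A.A₁.gates AnonOracle.isWithdraw := by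
    refine (Raises.run ηH (potential_length (G := G) (η := η)) E F A.A₁ E.input [] w).trans ?_
    simp
  have h₃ : ∀ (i : Fin η) (l : List (ESession η G)) a w (y' : G → G),
      (ev (PMF.uniformOfFintype G) fun P => ev (S.restE ηH b A E F a P (y' P) l w) fun r =>
        ind (S.Hit u (S.point u i P) r.1.2)) ≤ l.length * ENNReal.ofReal S.hashMass +
          A.A₂.gates AnonOracle.isWithdraw * ENNReal.ofReal S.hashMass := by
    intro i l a w y'
    refine (ev_mono _ fun P => h₂ i a P (y' P) l w).trans ?_
    rw [ev_add, ev_const]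
    exact add_le_add (S.ev_hit_le u i l) le_rfl
  refine (ev_mono _ (g' := fun r => r.1.2.length * ENNReal.ofReal S.hashMass +
    A.A₂.gates AnonOracle.isWithdraw * ENNReal.ofReal S.hashMass)
    fun r => h₃ _ r.1.2 r.1.1 r.2 _).trans ?_
  rw [ev_add, ev_const, ev_mul_right, ← add_mul]
  unfold AnonAdversary.withdrawals
  rw [Nat.cast_add]
  exact mul_le_mul_left (add_le_add h₁ le_rfl) _

end Bad

/-! ### From a random function to an ideal challenge, and equality of the two bits -/

section Ideal

variable {S : Scheme p lam G} {η γ : ℕ} (ηH : ℕ) (u : Fin η → ZMod p)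

theorem ev_true_le (m : PMF ((((Fin η × G) × Bool) × List (ESession η G)) × S.nizk.SimState)) :
    (ev m fun r => ind (r.1.1.2 = true)) ≤
      (ev m fun r => ind (r.1.1.2 = true ∧ ¬Collides u r)) + ev m fun r => ind (Collides u r) := by
  rw [← ev_add]
  refine ev_mono _ fun r => (ind_mono fun h => ?_).trans (ind_or_le _ _)
  by_cases hc : Collides u r
  · exact Or.inr hc
  · exact Or.inl ⟨h, hc⟩

variable [Fintype G]

/-- The value of a random function at the point of the challenge can be replaced by an
independent one, if the point is not used otherwise. -/
theorem ev_game_not_collides (b : Bool) (A : S.AnonAdversary η γ) (E : S.PublicView η γ)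
    (w : S.nizk.SimState) :
    (ev (PMF.uniformOfFintype (ZMod p → G)) fun f =>
      ev (S.gameE ηH b A E (shifts u f) (fun i P => shifts u f i (S.hashCom P + 1)) [] w) fun r =>
        ind (r.1.1.2 = true ∧ ¬Collides u r)) =
      ev (PMF.uniformOfFintype (ZMod p → G)) fun f => ev (PMF.uniformOfFintype G) fun y =>
        ev (S.gameE ηH b A E (shifts u f) (fun _ _ => y) [] w) fun r =>
          ind (r.1.1.2 = true ∧ ¬Collides u r) := by
  -- The point of the challenge is random and depends on the run, whereas `ev_uniform_swap` needs a
  -- fixed one; hence the event is split according to the value `x` of the point.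
  let g (x : ZMod p) (r : (((Fin η × G) × Bool) × List (ESession η G)) × S.nizk.SimState) : ℝ≥0∞ :=
    ind (S.point u r.1.1.1.1 r.1.1.1.2 = x ∧ r.1.1.2 = true ∧ ¬Collides u r)
  have hsum : ∀ r, ind (r.1.1.2 = true ∧ ¬Collides u r) = ∑ x, g x r := by
    intro r
    rw [Fintype.sum_eq_single (S.point u r.1.1.1.1 r.1.1.1.2)]
    · unfold g
      simp only [true_and]
    · intro x hx
      exact ind_neg fun h => hx h.1.symm
  simp only [hsum, ev_sum]
  refine Finset.sum_congr rfl fun x _ => ?_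
  have hreal : ∀ f : ZMod p → G,
      ev (S.gameE ηH b A E (shifts u f) (fun i P => shifts u f i (S.hashCom P + 1)) [] w) (g x) =
        ev (S.gameE ηH b A E (shifts u f) (fun _ _ => f x) [] w) (g x) := by
    intro f
    rw [ev_gameE, ev_gameE]
    congr 1
    funext r
    congr 1
    funext P
    by_cases hx : S.point u (if b then r.1.1.2.1 else r.1.1.1) P = x
    · have : shifts u f (if b then r.1.1.2.1 else r.1.1.1) (S.hashCom P + 1) = f x := by
        rw [← hx]
        rfl
      rw [this]
    · have h0 : ∀ r' : (Bool × List (ESession η G)) × S.nizk.SimState,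
          g x (((((if b then r.1.1.2.1 else r.1.1.1), P), r'.1.1), r'.1.2), r'.2) = 0 :=
        fun r' => ind_neg fun h => hx h.1
      simp only [h0, ev_const]
  simp only [hreal]
  refine ev_uniform_swap x
    (fun f y => ev (S.gameE ηH b A E (shifts u f) (fun _ _ => y) [] w) (g x)) fun f y z => ?_
  -- If the challenge has point `x`, a hit of `x` is a collision, so `g x` vanishes on every outcome
  -- that could depend on `f x`.
  refine (AgreeOff.game ηH b A E f z (fun _ _ => y) []).1 w (g x) fun r hr => ind_neg fun h => ?_
  refine h.2.2 ?_
  unfold Collides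
  rw [h.1]
  exact hr

/-- Probability of the output `true` if the users' functions are derived from a random function. -/
def realProb (b : Bool) (A : S.AnonAdversary η γ) (E : S.PublicView η γ) (w : S.nizk.SimState) :
    ℝ≥0∞ :=
  ev (PMF.uniformOfFintype (ZMod p → G)) fun f =>
    ev (S.gameE ηH b A E (shifts u f) (fun i P => shifts u f i (S.hashCom P + 1)) [] w) fun r =>
      ind (r.1.1.2 = true)

/-- The same probability if the challenge uses an independent random value. -/
def idealProb (b : Bool) (A : S.AnonAdversary η γ) (E : S.PublicView η γ) (w : S.nizk.SimState) :
    ℝ≥0∞ :=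
  ev (PMF.uniformOfFintype (ZMod p → G)) fun f => ev (PMF.uniformOfFintype G) fun y =>
    ev (S.gameE ηH b A E (shifts u f) (fun _ _ => y) [] w) fun r => ind (r.1.1.2 = true)

theorem realProb_le (b : Bool) (A : S.AnonAdversary η γ) (E : S.PublicView η γ)
    (w : S.nizk.SimState) :
    realProb ηH u b A E w ≤ idealProb ηH u b A E w +
      A.withdrawals * ENNReal.ofReal S.hashMass := by
  refine (ev_mono _ fun f => (ev_true_le u _).trans
    (add_le_add le_rfl (ev_collides_le ηH u b A E _ _ w))).trans ?_
  rw [ev_add, ev_const, ev_game_not_collides]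
  gcongr
  exact ev_mono _ fun f => ev_mono _ fun y => ev_mono _ fun r => ind_mono fun h => h.1

theorem idealProb_le (b : Bool) (A : S.AnonAdversary η γ) (E : S.PublicView η γ)
    (w : S.nizk.SimState) :
    idealProb ηH u b A E w ≤ realProb ηH u b A E w +
      A.withdrawals * ENNReal.ofReal S.hashMass := by
  refine (ev_mono _ fun f => ev_mono _ fun y => (ev_true_le u _).trans
    (add_le_add le_rfl (ev_collides_le ηH u b A E _ _ w))).trans ?_
  simp only [ev_add, ev_const]
  rw [← ev_game_not_collides]
  gcongr
  exact ev_mono _ fun f => ev_mono _ fun r => ind_mono fun h => h.1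

/-- The merchant's randomness is drawn last, independently of coin and voucher. -/
theorem ev_issueE_le (E : S.PublicView η γ) (j : Fin γ) (P pkm : G) (w : S.nizk.SimState) :
    (ev (S.issueE E j P w) fun r => match r.1 with
      | .inl x => ind (S.hashTx (pkm, x.2) = 0)
      | .inr () => 0) ≤ ENNReal.ofReal S.zeroMass := by
  unfold issueE
  simp only [ev_bind₁]
  refine ev_le_of_le _ fun π => ev_le_of_le _ fun coin => ev_le_of_le _ fun o => ?_
  rcases o with ⟨CV | ⟨⟩, w'⟩
  · dsimp only
    rw [ev_bind₁]
    refine ev_le_of_le _ fun ok => ?_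
    split_ifs
    · rw [ev_bind₁, ev_liftM]
      simp only [ev_pure₁]
      exact S.ev_hashTx_le pkm
    · rw [ev_pure₁]
      exact zero_le
  · rw [ev_pure₁]
    exact zero_le

/-- A one-time pad: for `r_t ≠ 0` the map from `y` to `g^sk * y^{r_t}` permutes the group, so `Z` is
uniform whatever `sk` is, and the simulated proof sees only `Z`. The case `r_t = 0` costs at most 1.
-/
theorem ev_spendE_le (sk sk' : ZMod p) (P : G) (rc : ZMod p) (pkm : G) (rv : Bits lam)
    (w : S.nizk.SimState) (h : S.Tx × S.nizk.SimState → ℝ≥0∞) (hh : ∀ r, h r ≤ 1) :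
    (ev (PMF.uniformOfFintype G) fun y => ev (S.spendE sk P y rc pkm rv w) h) ≤
      (ev (PMF.uniformOfFintype G) fun y => ev (S.spendE sk' P y rc pkm rv w) h) +
        ind (S.hashTx (pkm, rv) = 0) := by
  by_cases h0 : S.hashTx (pkm, rv) = 0
  · rw [ind_pos h0]
    exact (ev_le_of_le _ fun y => ev_le_of_le _ hh).trans le_add_self
  · have key : ∀ sk : ZMod p,
        (ev (PMF.uniformOfFintype G) fun y => ev (S.spendE sk P y rc pkm rv w) h) =
          ev (PMF.uniformOfFintype G) fun Z => ev ((do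
            let π ← S.simProve (.spend P Z (rc + 1) (S.hashTx (pkm, rv)))
            pure (Z, π, rv, S.hashTx (pkm, rv)) : S.SimM S.Tx) w) h := by
      intro sk
      exact ev_uniform_comp (f := fun y => gpow S.pp.g sk * gpow y (S.hashTx (pkm, rv)))
        ((Group.mulLeft_bijective _).comp (gpow_left_bijective S.pp h0)) fun Z => ev ((do
            let π ← S.simProve (.spend P Z (rc + 1) (S.hashTx (pkm, rv)))
            pure (Z, π, rv, S.hashTx (pkm, rv)) : S.SimM S.Tx) w) h
    rw [key, key]
    exact le_self_add

/-- `issueE` does not mention the user, so coin, voucher and `rv` are shared by both sides, and `y`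
can be averaged after they are fixed. -/
theorem ev_challengeE_le (E : S.PublicView η γ) (i i' : Fin η) (j : Fin γ) (m : Fin η) (P : G)
    (w : S.nizk.SimState) (h : Opt (S.Coin × S.Voucher × S.Tx) × S.nizk.SimState → ℝ≥0∞)
    (hh : ∀ r, h r ≤ 1) :
    (ev (PMF.uniformOfFintype G) fun y => ev (S.challengeE E i j m P y w) h) ≤
      (ev (PMF.uniformOfFintype G) fun y => ev (S.challengeE E i' j m P y w) h) +
        ENNReal.ofReal S.zeroMass := by
  unfold challengeE
  simp only [ev_bind₁]
  rw [ev_comm _ (S.issueE E j P w), ev_comm _ (S.issueE E j P w)]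
  refine le_trans ?_ (add_le_add le_rfl (ev_issueE_le E j P (gpow S.pp.g (E.2.2 m).1) w))
  rw [← ev_add]
  refine ev_mono _ fun r => ?_
  rcases r with ⟨x | ⟨⟩, w'⟩
  · dsimp only
    simp only [ev_bind₁, ev_pure₁]
    exact ev_spendE_le (E.2.2 i).1 (E.2.2 i').1 P _ _ x.2 w'
      (fun r => h (.inl (x.1.1, x.1.2, r.1), r.2)) fun r => hh _
  · exact le_self_add

theorem ev_restE_le (b b' : Bool) (A : S.AnonAdversary η γ) (E : S.PublicView η γ)
    (F : Fin η → ZMod p → G) (a : Fin η × Fin η × Fin γ × Fin η × A.State) (P : G)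
    (l : List (ESession η G)) (w : S.nizk.SimState)
    (h : (Bool × List (ESession η G)) × S.nizk.SimState → ℝ≥0∞) (hh : ∀ r, h r ≤ 1) :
    (ev (PMF.uniformOfFintype G) fun y => ev (S.restE ηH b A E F a P y l w) h) ≤
      (ev (PMF.uniformOfFintype G) fun y => ev (S.restE ηH b' A E F a P y l w) h) +
        ENNReal.ofReal S.zeroMass := by
  unfold restE
  by_cases hg : a.1.val < ηH ∧ a.2.1.val < ηH ∧ a.1 ≠ a.2.1
  · simp only [if_pos hg, ev_bind₂, ev_lift]
    exact ev_challengeE_le E _ _ _ _ P w _ fun r => ev_le_of_le _ hh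
  · simp only [if_neg hg]
    exact le_self_add

/-- The first stage and `P` depend neither on the bit nor on `y`, so the average over `y` moves
inside them and the comparison is made for the rest of the game. -/
theorem idealProb_le_idealProb (b b' : Bool) (A : S.AnonAdversary η γ) (E : S.PublicView η γ)
    (w : S.nizk.SimState) :
    idealProb ηH u b A E w ≤ idealProb ηH u b' A E w + ENNReal.ofReal S.zeroMass := by
  have key : ∀ b, idealProb ηH u b A E w =
      ev (PMF.uniformOfFintype (ZMod p → G)) fun f =>
        ev (A.A₁.run (S.oracleE ηH E (shifts u f)) E.input [] w) fun r =>
          ev (PMF.uniformOfFintype G) fun P => ev (PMF.uniformOfFintype G) fun y =>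
            ev (S.restE ηH b A E (shifts u f) r.1.1 P y r.1.2 r.2) fun r' =>
              ind (r'.1.1 = true) := by
    intro b
    unfold idealProb
    congr 1
    funext f
    simp only [ev_gameE]
    rw [ev_comm]
    congr 1
    funext r
    rw [ev_comm]
  rw [key, key]
  exact ev_le_ev_add _ fun f => ev_le_ev_add _ fun r => ev_le_ev_add _ fun P =>
    ev_restE_le ηH b b' A E _ r.1.1 P r.1.2 r.2 _ fun _ => ind_le_one _

theorem realProb_le_realProb (b b' : Bool) (A : S.AnonAdversary η γ) (E : S.PublicView η γ)
    (w : S.nizk.SimState) :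
    realProb ηH u b A E w ≤ realProb ηH u b' A E w +
      (2 * (A.withdrawals * ENNReal.ofReal S.hashMass) + ENNReal.ofReal S.zeroMass) := by
  calc realProb ηH u b A E w
      ≤ idealProb ηH u b A E w + A.withdrawals * ENNReal.ofReal S.hashMass :=
        realProb_le ηH u b A E w
    _ ≤ (idealProb ηH u b' A E w + ENNReal.ofReal S.zeroMass) +
        A.withdrawals * ENNReal.ofReal S.hashMass :=
        add_le_add (idealProb_le_idealProb ηH u b b' A E w) le_rfl
    _ ≤ ((realProb ηH u b' A E w + A.withdrawals * ENNReal.ofReal S.hashMass) +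
        ENNReal.ofReal S.zeroMass) + A.withdrawals * ENNReal.ofReal S.hashMass :=
        add_le_add (add_le_add (idealProb_le ηH u b' A E w) le_rfl) le_rfl
    _ = _ := by ring

/-- The experiment draws the function first. Exchanging the order of averaging puts the keys
outside, so that the shifts `u` are constants when the random function is analysed. -/
theorem prfExp_false_apply (b : Bool) (A : S.AnonAdversary η γ) :
    prfExp (dyPRF S.pp) false (S.prfReduction ηH b A) true =
      ev S.nizk.simInit fun w => ev (S.setup η γ) fun K =>
        realProb ηH (fun i => (K.2.2 i).2.1) b A (S.publicView ηH K) w := by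
  rw [prfExp_false, ← ev_bool, ev_bind]
  have h : ∀ f : ZMod p → G,
      (ev (S.simExp ηH (fun u x => f (x + u)) b A) fun b => if b then 1 else 0) =
        ev S.nizk.simInit fun w => ev (S.setup η γ) fun K =>
          ev (S.gameE ηH b A (S.publicView ηH K) (shifts (fun i => (K.2.2 i).2.1) f)
            (fun i P => shifts (fun i => (K.2.2 i).2.1) f i (S.hashCom P + 1)) [] w) fun r =>
              ind (r.1.1.2 = true) := by
    intro f
    rw [simExp_eq ηH (fun u x => f (x + u)) (fun K => shifts (fun i => (K.2.2 i).2.1) f)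
      fun K i _ => rfl]
    simp only [ev_bind, ev_pure, ite_eq_ind]
  simp only [h]
  rw [ev_comm]
  congr 1
  funext w
  rw [ev_comm]
  rfl

theorem prTrue_prfExp_false_le (b b' : Bool) (A : S.AnonAdversary η γ) :
    prTrue (prfExp (dyPRF S.pp) false (S.prfReduction ηH b A)) ≤
      prTrue (prfExp (dyPRF S.pp) false (S.prfReduction ηH b' A)) +
        (2 * (A.withdrawals * S.hashMass) + S.zeroMass) := by
  have h : prfExp (dyPRF S.pp) false (S.prfReduction ηH b A) true ≤
      prfExp (dyPRF S.pp) false (S.prfReduction ηH b' A) true +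
        (2 * (A.withdrawals * ENNReal.ofReal S.hashMass) + ENNReal.ofReal S.zeroMass) := by
    rw [prfExp_false_apply, prfExp_false_apply]
    exact ev_le_ev_add _ fun w => ev_le_ev_add _ fun K =>
      realProb_le_realProb ηH _ b b' A (S.publicView ηH K) w
  have hm := S.hashMass_nonneg
  have hz := S.zeroMass_nonneg
  have hc : 2 * (A.withdrawals * ENNReal.ofReal S.hashMass) + ENNReal.ofReal S.zeroMass =
      ENNReal.ofReal (2 * (A.withdrawals * S.hashMass) + S.zeroMass) := by
    rw [ENNReal.ofReal_add (by positivity) hz, ENNReal.ofReal_mul (by norm_num),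
      ENNReal.ofReal_mul (by positivity)]
    simp
  rw [hc] at h
  have hfin := PMF.apply_ne_top (prfExp (dyPRF S.pp) false (S.prfReduction ηH b' A)) true
  have := ENNReal.toReal_mono (ENNReal.add_ne_top.2 ⟨hfin, ENNReal.ofReal_ne_top⟩) h
  rwa [ENNReal.toReal_add hfin ENNReal.ofReal_ne_top, ENNReal.toReal_ofReal (by positivity)] at this

end Ideal

end Scheme

end ECash

end

theorem mainTheorem2 :
    ∃ a : ℕ, ∀ (p lam : ℕ) [Fact p.Prime] (G : Type) [CommGroup G] [Fintype G]
      (S : ECash.Scheme p lam G) (η ηH γ : ℕ) (c : ECash.CostModel) (τ : ℕ∞) (ρ : ℕ)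
      (_ : S.CostBound η ηH γ c τ ρ) (t : ℕ∞) (q : ℕ) (A : S.AnonAdversary η γ)
      (_ : A.time c ≤ t) (_ : A.queries ≤ q),
      let t' : ℕ∞ := t + a * (q + 1) * (ρ + 1) * (τ + 1)
      |ECash.prTrue (S.anonExp ηH false A) - ECash.prTrue (S.anonExp ηH true A)| ≤
        4 * ECash.zkAdv S.nizk c t' (a * (q + 1) * (ρ + 1)) +
          2 * ECash.hidingAdv (ECash.comm S.pp) c t' (q + 1) +
          2 * ECash.prfAdv (ECash.dyPRF S.pp) c t' (q + 1) +
          2 * (A.withdrawals * S.hashMass + S.zeroMass) := by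
  -- 231 is the constant term of the larger time bound, and it also dominates the coefficients 70, 5
  -- and 20 of the time and query bounds.
  refine ⟨231, fun p lam _ G _ _ S η ηH γ c τ ρ hc t q A ht hq => ?_⟩
  intro t'
  have hcoef : ((70 * A.queries + 231 : ℕ) : ℕ∞) ≤ ((231 * (q + 1) : ℕ) : ℕ∞) := by
    exact_mod_cast (by omega : 70 * A.queries + 231 ≤ 231 * (q + 1))
  have htime : A.time c + (70 * A.queries + 231) * (ρ + 1) * (τ + 1) ≤ t' := by
    push_cast at hcoef
    exact add_le_add ht (by gcongr; exact_mod_cast hcoef)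
  have hzk : ∀ b, |ECash.prTrue (S.simExp ηH (ECash.dyPRF S.pp) b A) -
      ECash.prTrue (S.anonExp ηH b A)| ≤ ECash.zkAdv S.nizk c t' (231 * (q + 1) * (ρ + 1)) := by
    intro b
    rw [← S.zkExp_true, ← S.zkExp_false]
    refine ECash.abs_le_zkAdv S.nizk _ (le_trans ?_ htime)
      ((S.queries_zkReduction_le ηH hc b A).trans (Nat.mul_le_mul_right _ (by omega)))
    refine (add_le_add (S.time_zkReduction_le ηH hc b A) le_rfl).trans ?_
    rw [add_assoc]
    gcongr
    calc (70 * (A.queries : ℕ∞) + 230) * (τ + 1) + 1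
        ≤ (70 * (A.queries : ℕ∞) + 230) * (τ + 1) + (τ + 1) := by gcongr; exact le_add_self
      _ = (70 * A.queries + 231) * 1 * (τ + 1) := by ring
      _ ≤ _ := by gcongr; exact le_add_self
  have hprf : ∀ b, |ECash.prTrue (S.simExp ηH (ECash.dyPRF S.pp) b A) -
      ECash.prTrue (ECash.prfExp (ECash.dyPRF S.pp) false (S.prfReduction ηH b A))| ≤
        ECash.prfAdv (ECash.dyPRF S.pp) c t' (q + 1) := by
    intro b
    rw [← S.prfExp_true_eq]
    exact ECash.le_prfAdv _ _ ((S.time_prfReduction_le ηH hc b A).trans htime)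
      ((S.queries_prfReduction_le ηH b A).trans (by omega))
  have hstat := ECash.Scheme.prTrue_prfExp_false_le (S := S) (η := η) (γ := γ) ηH
  have h₀ := ECash.zkAdv_nonneg S.nizk c t' (231 * (q + 1) * (ρ + 1))
  have h₁ := ECash.hidingAdv_nonneg (ECash.comm S.pp) c t' (q + 1)
  have h₂ := S.zeroMass_nonneg
  have z₀ := abs_le.1 (hzk false)
  have z₁ := abs_le.1 (hzk true)
  have f₀ := abs_le.1 (hprf false)
  have f₁ := abs_le.1 (hprf true)
  have s₀ := hstat false true A
  have s₁ := hstat true false A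
  rw [abs_le]
  -- The chain of games uses two zero-knowledge terms, two PRF terms and `2wμ + ζ`; nonnegativity of
  -- the advantages and of `ζ` supplies the rest of the bound.
  constructor <;> linarith
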